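/- Let $\Sigma$ be a finite alphabet and let $L\subseteq\Sigma^\omega$ be a language of $\omega$-words that is not $\omega$-regular (not recognised by any finite nondeterministic Büchi automaton) and has a neutral letter, i.e. there is a letter $1\in\Sigma$ such that $$w_1\,1\,w_2\,1\cdots\in L \iff w_1w_2\cdots\in L$$ for all finite words $w_1,w_2,\ldots\in\Sigma^*$ of which infinitely many are nonempty. Then $\mathrm{MSO{+}U}\subseteq\mathrm{MSO{+}}L$: for every finite alphabet $\Gamma$, every language $K\subseteq\Gamma^\omega$ that is definable in MSO+U is definable in MSO+$L$. Here formulas are evaluated over $(\omega,<)$ with unary predicates for the letters of the input word in $\Gamma^\omega$. The logic MSO+$L$ is monadic second-order logic extended with a predicate that takes a family of sets $(X_a)_{a\in\Sigma}$ and holds if these sets form a partition of $\omega$ (with possibly empty parts) and the $\omega$-word over $\Sigma$ having letter $a$ exactly at the positions in $X_a$ belongs to $L$. The inclusion holds for both meanings of MSO+U: (i) the extension of monadic second-order logic with the bounding quantifier $\mathsf U X\,\varphi(X)$, which says that $\varphi(X)$ is true for finite sets $X\subseteq\omega$ of unbounded size; and (ii) the logic MSO+$U$ for the language $U=\{a^{k_1}ba^{k_2}b\cdots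 : \limsup k_n=\infty\}\subseteq\{a,b\}^\omega$. -/

import Mathlib

open Filter

namespace OmegaMSO

universe u v

/-- An `ω`-word over the alphabet `A`. -/
abbrev OmegaWord (A : Type u) : Type u := ℕ → A

/-- A language of `ω`-words over the alphabet `A`. -/
abbrev OmegaLanguage (A : Type u) : Type u := Set (OmegaWord A)

/-- `IsConcat w x`: infinitely many of the finite words `w 0, w 1, …` are nonempty, and the
`ω`-word `x` is their concatenation `w 0 w 1 w 2 ⋯` (the `i`-th letter of `w n` stands at position
`|w 0| + ⋯ + |w (n - 1)| + i`). -/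
def IsConcat {A : Type u} (w : ℕ → List A) (x : OmegaWord A) : Prop :=
  (∃ᶠ n in atTop, w n ≠ []) ∧
    ∀ (n i : ℕ) (h : i < (w n).length),
      x ((∑ j ∈ Finset.range n, (w j).length) + i) = (w n)[i]

/-- The letter `e` is neutral for `L`: `w₀ e w₁ e ⋯ ∈ L ↔ w₀ w₁ ⋯ ∈ L` for all finite words
`w₀, w₁, …`, infinitely many of which are nonempty. -/
def IsNeutralLetter {A : Type u} (L : OmegaLanguage A) (e : A) : Prop :=
  ∀ (w : ℕ → List A) (x y : OmegaWord A), (∃ᶠ n in atTop, w n ≠ []) →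
    IsConcat w x → IsConcat (fun n => w n ++ [e]) y → (y ∈ L ↔ x ∈ L)

/-- `L` has a neutral letter. -/
def HasNeutralLetter {A : Type u} (L : OmegaLanguage A) : Prop :=
  ∃ e : A, IsNeutralLetter L e

/-- The `ω`-language recognised by a nondeterministic automaton with the Büchi condition: words
that admit a run from a start state visiting accepting states infinitely often. -/
def buchiLanguage {A : Type u} {Q : Type} (M : NFA A Q) : OmegaLanguage A :=
  {x | ∃ r : ℕ → Q, r 0 ∈ M.start ∧ (∀ n, r (n + 1) ∈ M.step (r n) (x n)) ∧
    ∃ᶠ n in atTop, r n ∈ M.accept}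

/-- `L` is `ω`-regular: it is recognised by a finite nondeterministic Büchi automaton. -/
def IsOmegaRegular {A : Type u} (L : OmegaLanguage A) : Prop :=
  ∃ (Q : Type) (_ : Finite Q) (M : NFA A Q), buchiLanguage M = L

/-- Formulas of MSO extended with the bounding quantifier, over `ω`-words on the alphabet `Γ`.
In `FormulaU Γ n m` the free first-order (position) variables are numbered by `Fin n` and the free
monadic (set) variables by `Fin m`; a quantifier binds the variable numbered `0`. -/
inductive FormulaU (Γ : Type v) : ℕ → ℕ → Type v
  | label {n m : ℕ} (a : Γ) (x : Fin n) : FormulaU Γ n m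
  | lt {n m : ℕ} (x y : Fin n) : FormulaU Γ n m
  | mem {n m : ℕ} (x : Fin n) (X : Fin m) : FormulaU Γ n m
  | neg {n m : ℕ} (φ : FormulaU Γ n m) : FormulaU Γ n m
  | conj {n m : ℕ} (φ ψ : FormulaU Γ n m) : FormulaU Γ n m
  | exPos {n m : ℕ} (φ : FormulaU Γ (n + 1) m) : FormulaU Γ n m
  | exSet {n m : ℕ} (φ : FormulaU Γ n (m + 1)) : FormulaU Γ n m
  | unbounded {n m : ℕ} (φ : FormulaU Γ n (m + 1)) : FormulaU Γ n m

/-- Truth of a formula in the `ω`-word `x`, under a valuation `p` of the position variables and a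
valuation `S` of the set variables. The formula `unbounded φ` says that `φ(X)` is true for finite
sets `X` of unbounded size. -/
def FormulaU.Sat {Γ : Type v} (x : OmegaWord Γ) :
    {n m : ℕ} → FormulaU Γ n m → (Fin n → ℕ) → (Fin m → Set ℕ) → Prop
  | _, _, .label a i, p, _ => x (p i) = a
  | _, _, .lt i j, p, _ => p i < p j
  | _, _, .mem i j, p, S => p i ∈ S j
  | _, _, .neg φ, p, S => ¬ φ.Sat x p S
  | _, _, .conj φ ψ, p, S => φ.Sat x p S ∧ ψ.Sat x p S
  | _, _, .exPos φ, p, S => ∃ k : ℕ, φ.Sat x (Fin.cons k p : Fin _ → ℕ) S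
  | _, _, .exSet φ, p, S => ∃ X : Set ℕ, φ.Sat x p (Fin.cons X S : Fin _ → Set ℕ)
  | _, _, .unbounded φ, p, S =>
      ∀ k : ℕ, ∃ X : Set ℕ, X.Finite ∧ k ≤ X.ncard ∧
        φ.Sat x p (Fin.cons X S : Fin _ → Set ℕ)

/-- `K` is definable by a sentence of MSO extended with the bounding quantifier. -/
def DefinableMSOU {Γ : Type v} (K : OmegaLanguage Γ) : Prop :=
  ∃ φ : FormulaU Γ 0 0, K = {x | φ.Sat x Fin.elim0 Fin.elim0}

/-- Formulas of MSO extended with a predicate for a language of `ω`-words over the alphabet `A`,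
over `ω`-words on the alphabet `Γ`. The predicate takes one set variable for each letter of `A`.
Variables are as in `FormulaU`. -/
inductive FormulaL (A : Type u) (Γ : Type v) : ℕ → ℕ → Type (max u v)
  | label {n m : ℕ} (a : Γ) (x : Fin n) : FormulaL A Γ n m
  | lt {n m : ℕ} (x y : Fin n) : FormulaL A Γ n m
  | mem {n m : ℕ} (x : Fin n) (X : Fin m) : FormulaL A Γ n m
  | neg {n m : ℕ} (φ : FormulaL A Γ n m) : FormulaL A Γ n m
  | conj {n m : ℕ} (φ ψ : FormulaL A Γ n m) : FormulaL A Γ n m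
  | exPos {n m : ℕ} (φ : FormulaL A Γ (n + 1) m) : FormulaL A Γ n m
  | exSet {n m : ℕ} (φ : FormulaL A Γ n (m + 1)) : FormulaL A Γ n m
  | lang {n m : ℕ} (X : A → Fin m) : FormulaL A Γ n m

/-- Truth of a formula in the `ω`-word `x`, where the additional predicate is interpreted by the
language `L`: it holds of a family of sets indexed by the letters of `A` if the family is a
partition of `ω` (with possibly empty parts) and the word encoded by it, which has the letter `a`
exactly at the positions in the set with index `a`, belongs to `L`. -/
def FormulaL.Sat {A : Type u} {Γ : Type v} (L : OmegaLanguage A) (x : OmegaWord Γ) :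
    {n m : ℕ} → FormulaL A Γ n m → (Fin n → ℕ) → (Fin m → Set ℕ) → Prop
  | _, _, .label a i, p, _ => x (p i) = a
  | _, _, .lt i j, p, _ => p i < p j
  | _, _, .mem i j, p, S => p i ∈ S j
  | _, _, .neg φ, p, S => ¬ φ.Sat L x p S
  | _, _, .conj φ ψ, p, S => φ.Sat L x p S ∧ ψ.Sat L x p S
  | _, _, .exPos φ, p, S => ∃ k : ℕ, φ.Sat L x (Fin.cons k p : Fin _ → ℕ) S
  | _, _, .exSet φ, p, S => ∃ X : Set ℕ, φ.Sat L x p (Fin.cons X S : Fin _ → Set ℕ)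
  | _, _, .lang X, _, S => ∃ y ∈ L, ∀ a : A, S (X a) = {k | y k = a}

/-- `K` is definable by a sentence of MSO extended with the language `L`. -/
def DefinableMSOPlus {A : Type u} {Γ : Type v} (L : OmegaLanguage A) (K : OmegaLanguage Γ) :
    Prop :=
  ∃ φ : FormulaL A Γ 0 0, K = {x | φ.Sat L x Fin.elim0 Fin.elim0}

/-- The language `U` of the words `a^(k 0) b a^(k 1) b ⋯` with `limsup k = ∞`, where the letter `a`
is `true` and the letter `b` is `false`. -/
def languageU : OmegaLanguage Bool :=
  {x | ∃ k : ℕ → ℕ, IsConcat (fun n => List.replicate (k n) true ++ [false]) x ∧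
    limsup (fun n => (k n : ℕ∞)) atTop = ⊤}

end OmegaMSO

/-! Both meanings of MSO+U reduce to one predicate of two sets `D` and `W`: `D` is infinite, and the
intervals free of `D` contain unboundedly many elements of `W`. For the language `U`, take for `D`
the positions of the letter b and for `W` those of a (`mem_languageU_iff`). For the bounding
quantifier, guess `D` and `W` such that the part of `W` in any interval free of `D` is covered by a
finite set satisfying the formula (`forall_exists_le_ncard_iff`). It remains to define this
predicate in MSO+`L`.

Let `e` be the neutral letter. Membership in `L` depends only on the letters other than `e`
(`mem_iff_of_filter`), so a finite word can be written on any sufficiently large set of positions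
inside a block, the stretch between an element of `D` and the next one, with `e` as padding.
Statements about rewriting blocks thereby become statements about Myhill–Nerode style equivalences
of finite words.

Three properties of `(D, W)` are expressible in MSO+`L`: `ReplaceProp`, `LimReplaceProp` and
`MoveProp`. All three hold if `W` is bounded on the blocks, since then only finitely many block
contents occur. Conversely, suppose that each of them holds for some unbounded pair, not necessarily
the same one. Unbounded blocks can host any sequence of finite words. Then `MoveProp` makes prefix
equivalence of finite index; `MoveProp` and `LimReplaceProp` together make the equivalence of
infinitely repeated factors of finite index; `ReplaceProp` shows that termwise equivalent sequences
of factors are interchangeable. By a Ramsey factorization these facts give a Büchi automaton for `L`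
(`isOmegaRegular_of_finite`).

As `L` is not regular, one of the three properties fails for every unbounded pair
(`exists_unbounded_criterion`). Its negation therefore defines unboundedness. Which of the three it
is depends on `L`, and only the existence of a formula is needed. -/

namespace OmegaMSO

universe u v w

/-! ### Concatenations of infinitely many finite words -/

/-- The concatenation of the first `n` words of a sequence. -/
def pre {A : Type u} (w : ℕ → List A) (n : ℕ) : List A := ((List.range n).map w).flatten

/-- The finite word `l` is a prefix of the `ω`-word `x`. -/
def IsPre {A : Type u} (l : List A) (x : OmegaWord A) : Prop :=
  ∀ (i : ℕ) (h : i < l.length), x i = l[i]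

section Concat

variable {A : Type u}

@[simp] theorem pre_zero (w : ℕ → List A) : pre w 0 = [] := rfl

theorem pre_succ (w : ℕ → List A) (n : ℕ) : pre w (n + 1) = pre w n ++ w n := by
  simp [pre, List.range_succ]

theorem length_pre (w : ℕ → List A) (n : ℕ) :
    (pre w n).length = ∑ j ∈ Finset.range n, (w j).length := by
  induction n with
  | zero => simp
  | succ n ih => rw [pre_succ, List.length_append, ih, Finset.sum_range_succ]

theorem pre_prefix (w : ℕ → List A) {m n : ℕ} (h : m ≤ n) : pre w m <+: pre w n := by
  induction n, h using Nat.le_induction with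
  | base => exact List.prefix_rfl
  | succ n _ ih => exact ih.trans (pre_succ w n ▸ List.prefix_append _ _)

theorem IsPre.of_prefix {l l' : List A} {x : OmegaWord A} (h : IsPre l' x) (hl : l <+: l') :
    IsPre l x := by
  intro i hi
  rw [h i (hi.trans_le hl.length_le)]
  exact (hl.getElem hi).symm

theorem isPre_append {l l' : List A} {x : OmegaWord A} :
    IsPre (l ++ l') x ↔ IsPre l x ∧ ∀ (i : ℕ) (h : i < l'.length), x (l.length + i) = l'[i] := by
  constructor
  · intro h
    refine ⟨h.of_prefix (List.prefix_append _ _), fun i hi => ?_⟩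
    rw [h (l.length + i) (by simp; omega)]
    simp
  · rintro ⟨h, h'⟩ i hi
    by_cases hl : i < l.length
    · rw [h i hl, List.getElem_append_left hl]
    · push Not at hl
      obtain ⟨j, rfl⟩ := Nat.exists_eq_add_of_le hl
      rw [h' j (by simpa using hi)]
      simp

theorem isConcat_iff {w : ℕ → List A} {x : OmegaWord A} :
    IsConcat w x ↔ (∃ᶠ n in atTop, w n ≠ []) ∧ ∀ n, IsPre (pre w n) x := by
  refine and_congr_right fun _ => ⟨fun h n => ?_, fun h n i hi => ?_⟩
  · induction n with
    | zero => intro i hi; simp at hi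
    | succ n ih =>
      rw [pre_succ, isPre_append]
      refine ⟨ih, fun i hi => ?_⟩
      rw [length_pre]
      exact h n i hi
  · have := h (n + 1)
    rw [pre_succ, isPre_append] at this
    rw [← length_pre]
    exact this.2 i hi

theorem le_length_pre {w : ℕ → List A} (h : ∀ n, w n ≠ []) (n : ℕ) : n ≤ (pre w n).length := by
  induction n with
  | zero => simp
  | succ n ih =>
    rw [pre_succ, List.length_append]
    have := List.length_pos_iff.2 (h n)
    omega

/-- The concatenation of a sequence of nonempty words, with a default letter. -/
def cat (e : A) (w : ℕ → List A) : OmegaWord A := fun k => (pre w (k + 1)).getD k e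

theorem isConcat_cat (e : A) {w : ℕ → List A} (h : ∀ n, w n ≠ []) : IsConcat w (cat e w) := by
  refine isConcat_iff.2 ⟨Frequently.of_forall h, fun n i hi => ?_⟩
  have h1 : i < (pre w (i + 1)).length := le_length_pre h (i + 1)
  rw [cat, List.getD_eq_getElem _ _ h1]
  rcases le_total n (i + 1) with hn | hn
  · exact ((pre_prefix w hn).getElem hi).symm
  · exact (pre_prefix w hn).getElem h1

theorem pre_flatten (W : ℕ → List (List A)) (n : ℕ) :
    pre (fun i => (W i).flatten) n = (pre W n).flatten := by
  induction n with
  | zero => rfl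
  | succ n ih => rw [pre_succ, pre_succ, ih, List.flatten_append]

/-- Every group `W i` is nonempty, so the first `n` groups already contain the first `n` words. -/
theorem pre_eq_flatten_take {W : ℕ → List (List A)} {w : ℕ → List A}
    (hW : ∀ i, W i ≠ []) (hw : IsConcat W w) (n : ℕ) :
    pre w n = ((pre W n).take n).flatten := by
  rw [pre]
  congr 1
  apply List.ext_getElem
  · simp [le_length_pre hW n]
  · intro i h1 h2
    simp only [List.getElem_map, List.getElem_range, List.getElem_take]
    exact (isConcat_iff.1 hw).2 n i _

/-- Associativity of infinite concatenation: a concatenation of groups of words is also the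
concatenation of the words themselves. -/
theorem IsConcat.regroup {W : ℕ → List (List A)} {w : ℕ → List A} {x : OmegaWord A}
    (hW : ∀ i, W i ≠ []) (hw : IsConcat W w) (hx : IsConcat (fun i => (W i).flatten) x) :
    IsConcat w x := by
  rw [isConcat_iff] at hx
  refine isConcat_iff.2 ⟨?_, fun n => ?_⟩
  · rw [frequently_atTop] at *
    intro N
    obtain ⟨i, hi, hne⟩ := hx.1 N
    simp only [ne_eq, List.flatten_eq_nil_iff, not_forall] at hne
    obtain ⟨l, hl, hl'⟩ := hne
    obtain ⟨j, hj, rfl⟩ := List.getElem_of_mem hl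
    refine ⟨(pre W i).length + j, ?_, ?_⟩
    · have := le_length_pre hW i
      omega
    · have := hw.2 i j hj
      rw [← length_pre] at this
      rwa [this]
  · refine (hx.2 n).of_prefix ?_
    rw [pre_flatten, pre_eq_flatten_take hW hw]
    conv_rhs => rw [← List.take_append_drop n (pre W n), List.flatten_append]
    exact List.prefix_append _ _

theorem IsConcat.map {B : Type v} {W : ℕ → List A} {w : OmegaWord A} (f : A → B)
    (hw : IsConcat W w) : IsConcat (fun i => (W i).map f) (fun n => f (w n)) := by
  refine ⟨by simpa using hw.1, fun n i hi => ?_⟩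
  simp only [List.length_map, List.getElem_map]
  rw [← hw.2 n i (by simpa using hi)]

end Concat

/-! ### Consequences of a neutral letter -/

section Neutral

variable {A : Type u} {L : OmegaLanguage A} {e : A}

/-- Two finite words that become equal when cut into pieces followed by the letter `e`. -/
def Padded (e : A) (X Y : List A) : Prop :=
  ∃ W V : List (List A), W ≠ [] ∧ V ≠ [] ∧ W.flatten = X ∧ V.flatten = Y ∧
    (W.map (· ++ [e])).flatten = (V.map (· ++ [e])).flatten

theorem Padded.append {X Y X' Y' : List A} (h : Padded e X Y) (h' : Padded e X' Y') :
    Padded e (X ++ X') (Y ++ Y') := by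
  obtain ⟨W, V, hW, hV, rfl, rfl, hWV⟩ := h
  obtain ⟨W', V', hW', hV', rfl, rfl, hWV'⟩ := h'
  refine ⟨W ++ W', V ++ V', by simp [hW], by simp [hV], by simp, by simp, ?_⟩
  simp only [List.map_append, List.flatten_append, hWV, hWV']

theorem Padded.refl (X : List A) : Padded e X X := ⟨[X], [X], by simp, by simp, by simp⟩

open Classical in
theorem padded_filter (X : List A) : Padded e X (X.filter (· ≠ e)) := by
  induction X with
  | nil => exact Padded.refl _
  | cons a X ih =>
    by_cases ha : a = e
    · subst ha
      rw [List.filter_cons_of_neg (by simp)]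
      -- The word `e` taken as one piece and the empty word taken as two empty pieces both become
      -- `ee` after padding.
      exact Padded.append (X := [a]) (Y := []) ⟨[[a]], [[], []], by simp⟩ ih
    · rw [List.filter_cons_of_pos (by simpa using ha)]
      exact Padded.append (X := [a]) (Y := [a]) (Padded.refl _) ih

theorem padded_nil : Padded e [] [e] := ⟨[[], []], [[e]], by simp⟩

/-- Neutrality applies to the finer decompositions into pieces. Both padded words are the same word,
so the two original words are equivalent to a common third one. -/
theorem mem_iff_of_padded (hL : IsNeutralLetter L e) {X Y : ℕ → List A}
    (h : ∀ n, Padded e (X n) (Y n)) {x y : OmegaWord A}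
    (hx : IsConcat X x) (hy : IsConcat Y y) : x ∈ L ↔ y ∈ L := by
  choose W V hW hV hWX hVY hWV using h
  have key : ∀ (U : ℕ → List (List A)) (z : OmegaWord A), (∀ n, U n ≠ []) →
      IsConcat (fun n => (U n).flatten) z →
      (cat e (fun n => ((U n).map (· ++ [e])).flatten) ∈ L ↔ z ∈ L) := by
    intro U z hU hz
    have h1 := isConcat_cat [] hU
    have h2 := IsConcat.regroup hU h1 hz
    refine hL _ _ _ h2.1 h2 ?_
    refine IsConcat.regroup (W := fun n => (U n).map (· ++ [e])) (by simpa using hU)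
      (h1.map (· ++ [e])) (isConcat_cat e fun n hn => hU n ?_)
    rw [List.eq_nil_iff_forall_not_mem]
    intro l hl
    have := List.flatten_eq_nil_iff.1 hn (l ++ [e]) (List.mem_map_of_mem hl)
    simp at this
  rw [← key W x hW (by simpa only [hWX] using hx), ← key V y hV (by simpa only [hVY] using hy)]
  simp only [hWV]

open Classical in
-- Both words are compared with the one built from the filtered segments. An extra `e` in front of
-- each filtered segment keeps it nonempty, as `cat` requires.
theorem mem_iff_of_filter (hL : IsNeutralLetter L e) {X Y : ℕ → List A} (hX : ∀ n, X n ≠ [])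
    (hY : ∀ n, Y n ≠ []) (h : ∀ n, (X n).filter (· ≠ e) = (Y n).filter (· ≠ e))
    {x y : OmegaWord A} (hx : IsConcat X x) (hy : IsConcat Y y) : x ∈ L ↔ y ∈ L := by
  have key : ∀ (Z : ℕ → List A) (z : OmegaWord A), (∀ n, Z n ≠ []) → IsConcat Z z →
      (z ∈ L ↔ cat e (fun n => [e] ++ (Z n).filter (· ≠ e)) ∈ L) := fun Z z hZ hz =>
    mem_iff_of_padded hL
      (fun n => by simpa using padded_nil.append (padded_filter (Z n))) hz
      (isConcat_cat e (by simp))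
  rw [key X x hX hx, key Y y hY hy]
  simp only [h]

/-- The letters different from `e` of the word `y` between the positions `a` and `b`. -/
noncomputable def red (e : A) (y : OmegaWord A) (a b : ℕ) : List A :=
  open Classical in ((List.Ico a b).map y).filter (· ≠ e)

theorem red_append (y : OmegaWord A) {a b c : ℕ} (h : a ≤ b) (h' : b ≤ c) :
    red e y a b ++ red e y b c = red e y a c := by
  classical
  rw [red, red, red, ← List.filter_append, ← List.map_append, List.Ico.append_consecutive h h']

theorem red_congr {y z : OmegaWord A} {a b : ℕ} (h : ∀ k, a ≤ k → k < b → y k = z k) :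
    red e y a b = red e z a b := by
  classical
  rw [red, red]
  congr 1
  refine List.map_congr_left fun k hk => ?_
  rw [List.Ico.mem] at hk
  exact h k hk.1 hk.2

theorem red_eq_nil {y : OmegaWord A} {a b : ℕ} (h : ∀ k, a ≤ k → k < b → y k = e) :
    red e y a b = [] := by
  classical
  rw [red, List.filter_eq_nil_iff]
  simp only [List.mem_map, List.Ico.mem]
  rintro _ ⟨k, hk, rfl⟩
  simpa using h k hk.1 hk.2

/-- The words `w 0`, `w 1`, … and the letters `e` make up the segments of `y` cut at the
positions `p`. -/
def Realizes (e : A) (y : OmegaWord A) (p : ℕ → ℕ) (w : ℕ → List A) : Prop :=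
  open Classical in
  StrictMono p ∧ p 0 = 0 ∧ ∀ n, red e y (p n) (p (n + 1)) = (w n).filter (· ≠ e)

/-- The words of the sequence `w`, separated by the letter `e`, concatenate to a word in `L`. -/
def Acc (L : OmegaLanguage A) (e : A) (w : ℕ → List A) : Prop :=
  cat e (fun n => e :: w n) ∈ L

theorem isConcat_segments (y : OmegaWord A) {p : ℕ → ℕ} (hp : StrictMono p) (h0 : p 0 = 0) :
    IsConcat (fun n => (List.Ico (p n) (p (n + 1))).map y) y := by
  have hne : ∀ n, (List.Ico (p n) (p (n + 1))).map y ≠ [] := fun n h => by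
    rw [List.map_eq_nil_iff, List.Ico.eq_empty_iff] at h
    exact absurd (hp (Nat.lt_succ_self n)) (not_lt.2 h)
  refine isConcat_iff.2 ⟨Frequently.of_forall hne, fun n => ?_⟩
  have : pre (fun n => (List.Ico (p n) (p (n + 1))).map y) n = (List.Ico 0 (p n)).map y := by
    induction n with
    | zero => simp [h0]
    | succ n ih =>
      rw [pre_succ, ih, ← List.map_append,
        List.Ico.append_consecutive (Nat.zero_le _) (hp (Nat.lt_succ_self n)).le]
  rw [this]
  intro i hi
  simp [List.Ico]

theorem Realizes.mem_iff (hL : IsNeutralLetter L e) {y : OmegaWord A} {p : ℕ → ℕ}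
    {w : ℕ → List A} (h : Realizes e y p w) : y ∈ L ↔ Acc L e w := by
  refine mem_iff_of_filter hL (fun n hn => ?_) (by simp) (fun n => ?_)
    (isConcat_segments y h.1 h.2.1) (isConcat_cat e (by simp))
  · rw [List.map_eq_nil_iff, List.Ico.eq_empty_iff] at hn
    exact absurd (h.1 (Nat.lt_succ_self n)) (not_lt.2 hn)
  · have := h.2.2 n
    rw [red] at this
    rw [List.filter_cons_of_neg (by simp), ← this]

theorem exists_realizes (e : A) (w : ℕ → List A) : ∃ y p, Realizes e y p w := by
  classical
  refine ⟨cat e (fun n => e :: w n), fun n => (pre (fun n => e :: w n) n).length, ?_, rfl, ?_⟩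
  · refine strictMono_nat_of_lt_succ fun n => ?_
    rw [pre_succ]
    simp
  · intro n
    have h := (isConcat_cat e (w := fun n => e :: w n) (by simp)).2 n
    rw [← length_pre] at h
    have : (List.Ico (pre (fun n => e :: w n) n).length
        (pre (fun n => e :: w n) (n + 1)).length).map (cat e fun n => e :: w n) = e :: w n := by
      apply List.ext_getElem
      · rw [pre_succ]; simp
      · intro i h1 h2
        rw [List.getElem_map, ← h i h2]
        simp [List.Ico]
    rw [red, this, List.filter_cons_of_neg (by simp)]

open Classical in
theorem acc_congr (hL : IsNeutralLetter L e) {w w' : ℕ → List A}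
    (h : ∀ n, (w n).filter (· ≠ e) = (w' n).filter (· ≠ e)) : Acc L e w ↔ Acc L e w' := by
  obtain ⟨y, p, hy⟩ := exists_realizes e w
  rw [← hy.mem_iff hL]
  exact Realizes.mem_iff hL ⟨hy.1, hy.2.1, fun n => by rw [hy.2.2, h]⟩

/-- Words that agree, up to the letter `e`, on all segments of a common decomposition. -/
theorem mem_iff_of_chain (hL : IsNeutralLetter L e) {y z : OmegaWord A} (Q : ℕ → Prop)
    (h0 : Q 0) (h : ∀ n, Q n → ∃ m, n < m ∧ Q m ∧ red e y n m = red e z n m) :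
    y ∈ L ↔ z ∈ L := by
  classical
  -- The iterates of `f` starting from 0 are the common cut points.
  choose! f hlt hQ hf using h
  have hQ' : ∀ n, Q (f^[n] 0) := fun n => by
    induction n with
    | zero => exact h0
    | succ n ih => rw [Function.iterate_succ_apply']; exact hQ _ ih
  have hm : StrictMono fun n => f^[n] 0 := strictMono_nat_of_lt_succ fun n => by
    rw [Function.iterate_succ_apply']; exact hlt _ (hQ' n)
  have hfil : ∀ (x : OmegaWord A) a b, (red e x a b).filter (· ≠ e) = red e x a b :=
    fun x a b => by rw [red, List.filter_filter]; simp
  rw [Realizes.mem_iff hL (y := y) (w := fun n => red e y (f^[n] 0) (f^[n + 1] 0))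
      ⟨hm, rfl, fun n => (hfil _ _ _).symm⟩,
    Realizes.mem_iff hL (y := z) (w := fun n => red e y (f^[n] 0) (f^[n + 1] 0))
      ⟨hm, rfl, fun n => by
        rw [hfil]; simp only [Function.iterate_succ_apply']; exact (hf _ (hQ' n)).symm⟩]

end Neutral

/-! ### A congruence criterion for regularity -/

section Regular

variable {A : Type u} {L : OmegaLanguage A} {e : A}

/-- The sequence of words with first term `s`, followed by the terms of `w`. -/
def seqCons (s : List A) (w : ℕ → List A) : ℕ → List A
  | 0 => s
  | n + 1 => w n

/-- The concatenation of `s` and the sequence `w` belongs to `L`, up to letters `e`. -/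
def AccS (L : OmegaLanguage A) (e : A) (s : List A) (w : ℕ → List A) : Prop :=
  Acc L e (seqCons s w)

open Classical in
theorem accS_congr (hL : IsNeutralLetter L e) {s s' : List A} {w w' : ℕ → List A}
    (hs : s.filter (· ≠ e) = s'.filter (· ≠ e))
    (h : ∀ n, (w n).filter (· ≠ e) = (w' n).filter (· ≠ e)) :
    AccS L e s w ↔ AccS L e s' w' :=
  acc_congr hL fun n => by cases n; exacts [hs, h _]

theorem accS_append (hL : IsNeutralLetter L e) (s t : List A) (w : ℕ → List A) :
    AccS L e (s ++ t) w ↔ AccS L e s (seqCons t w) := by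
  classical
  obtain ⟨y, p, hp, h0, hy⟩ := exists_realizes e (seqCons s (seqCons t w))
  have h1 : Realizes e y p (seqCons s (seqCons t w)) := ⟨hp, h0, hy⟩
  rw [AccS, AccS, ← h1.mem_iff hL]
  symm
  -- Dropping the cut `p 1` merges the segments of `s` and `t` into one.
  refine Realizes.mem_iff hL (p := fun n => if n = 0 then 0 else p (n + 1)) ⟨?_, by simp, ?_⟩
  · refine strictMono_nat_of_lt_succ fun n => ?_
    have : p 0 < p (1 + 1) := hp (by norm_num)
    rcases n with _ | n
    · simpa [h0] using this
    · simpa using hp (by omega)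
  · intro n
    rcases n with _ | n
    · have ha := hy 0
      have hb := hy 1
      simp only [seqCons, h0] at ha hb
      simp only [if_true, seqCons, List.filter_append, ← ha, ← hb]
      rw [if_neg (by omega), red_append _ (Nat.zero_le _) (hp (by omega)).le]
    · simpa [seqCons] using hy (n + 2)

/-- Words that may replace each other as prefixes of words in `L`. -/
def prefixSetoid (L : OmegaLanguage A) (e : A) : Setoid (List A) where
  r u v := ∀ w, AccS L e u w ↔ AccS L e v w
  iseqv := ⟨fun _ _ => Iff.rfl, fun h w => (h w).symm, fun h h' w => (h w).trans (h' w)⟩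

/-- Words that may replace each other, infinitely often, as factors of words in `L`. -/
def factorSetoid (L : OmegaLanguage A) (e : A) : Setoid (List A) where
  r u v := ∀ (s : List A) (t : ℕ → List A), AccS L e s (fun n => u ++ t n) ↔ AccS L e s (fun n => v ++ t n)
  iseqv := ⟨fun _ _ _ => Iff.rfl, fun h s t => (h s t).symm, fun h h' s t =>
    (h s t).trans (h' s t)⟩

theorem prefixSetoid_append (hL : IsNeutralLetter L e) {u v : List A}
    (h : prefixSetoid L e u v) (t : List A) : prefixSetoid L e (u ++ t) (v ++ t) := fun w => by
  rw [accS_append hL, accS_append hL]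
  exact h _

/-- Words that may replace each other once, as factors of words in `L`. -/
def contextSetoid (L : OmegaLanguage A) (e : A) : Setoid (List A) where
  r u v := ∀ s, prefixSetoid L e (s ++ u) (s ++ v)
  iseqv := ⟨fun _ _ => Setoid.refl' _ _, fun h s => Setoid.symm' _ (h s), fun h h' s =>
    Setoid.trans' _ (h s) (h' s)⟩

theorem contextSetoid_append (hL : IsNeutralLetter L e) {u v : List A}
    (h : contextSetoid L e u v) (t : List A) : contextSetoid L e (u ++ t) (v ++ t) := fun s => by
  rw [← List.append_assoc, ← List.append_assoc]
  exact prefixSetoid_append hL (h s) t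

/-- A word acts on prefix classes by appending it on the right. Its context class is determined by
this self-map of a finite set. -/
theorem finite_contextSetoid (h : Finite (Quotient (prefixSetoid L e))) (hL : IsNeutralLetter L e) :
    Finite (Quotient (contextSetoid L e)) := by
  let f : Quotient (contextSetoid L e) → Quotient (prefixSetoid L e) →
      Quotient (prefixSetoid L e) :=
    Quotient.lift (fun u => Quotient.map (fun s => s ++ u) fun _ _ hs =>
      prefixSetoid_append hL hs u) fun u v huv => by
        funext q
        induction q using Quotient.inductionOn with
        | h s => exact Quotient.sound (huv s)
  refine Finite.of_injective f fun p q hpq => ?_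
  induction p using Quotient.inductionOn with
  | h u =>
    induction q using Quotient.inductionOn with
    | h v => exact Quotient.sound fun s => Quotient.exact (congrFun hpq (Quotient.mk _ s))

theorem factorSetoid_append {u v : List A}
    (h : factorSetoid L e u v) (t : List A) : factorSetoid L e (u ++ t) (v ++ t) := fun s t' => by
  simp only [List.append_assoc]
  exact h _ _

/-- A weak Ramsey theorem by induction on the set of colours: either consecutive pairs of a
subsequence all have colour `c`, or some subsequence avoids `c` on all increasing pairs. Only
consecutive pairs matter, because the automaton checks only consecutive factors. -/
theorem exists_monochromatic_consecutive {κ : Type v} (χ : ℕ → ℕ → κ) (s : Finset κ) :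
    ∀ f : ℕ → ℕ, StrictMono f → (∀ i j, i < j → χ (f i) (f j) ∈ s) →
      ∃ g : ℕ → ℕ, StrictMono g ∧ ∃ c, ∀ n, χ (f (g n)) (f (g (n + 1))) = c := by
  classical
  induction s using Finset.induction with
  | empty => exact fun f _ h => absurd (h 0 1 (by norm_num)) (by simp)
  | insert c s _ ih =>
    intro f hf h
    obtain ⟨g, hg | hg⟩ := exists_increasing_or_nonincreasing_subseq' (fun a b => χ a b = c) f
    · exact ⟨g, g.strictMono, c, hg⟩
    · obtain ⟨g', hg', c', hc'⟩ := ih (fun n => f (g n)) (hf.comp g.strictMono) fun i j hij =>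
        (Finset.mem_insert.1 (h _ _ (g.strictMono hij))).resolve_left (hg i j hij)
      exact ⟨fun n => g (g' n), g.strictMono.comp hg', c', hc'⟩

/-- The factor of `x` between the positions `a` and `b`. -/
def seg (x : OmegaWord A) (a b : ℕ) : List A := (List.Ico a b).map x

theorem seg_succ (x : OmegaWord A) {a b : ℕ} (h : a ≤ b) :
    seg x a (b + 1) = seg x a b ++ [x b] := by
  rw [seg, List.Ico.succ_top h, List.map_append]; rfl

@[simp] theorem seg_self (x : OmegaWord A) (a : ℕ) : seg x a a = [] := by simp [seg]

theorem mem_iff_accS_seg (hL : IsNeutralLetter L e) (x : OmegaWord A) {f : ℕ → ℕ}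
    (hf : StrictMono f) (h0 : 0 < f 0) :
    x ∈ L ↔ AccS L e (seg x 0 (f 0)) (fun n => seg x (f n) (f (n + 1))) := by
  refine Realizes.mem_iff hL (p := fun n => if n = 0 then 0 else f (n - 1)) ⟨?_, by simp, ?_⟩
  · refine strictMono_nat_of_lt_succ fun n => ?_
    rcases n with _ | n
    · simpa using h0
    · simpa using hf (Nat.lt_succ_self n)
  · intro n
    rcases n with _ | n
    · simp [red, seqCons, seg]
    · simp [red, seqCons, seg]

/-- A nondeterministic automaton that guesses a factorization of its input whose first factor has
class `p` and whose other factors have class `q`, for some pair `(p, q)` in `F`. -/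
def factorNFA {k : ℕ} (π : List A → Fin k) (δ : Fin k → A → Fin k) (F : Set (Fin k × Fin k)) :
    NFA A ((Fin k × Fin k) × Bool × Fin k × Bool) where
  -- A state holds the guessed pair, whether a cut has been made, the class of what was read since
  -- the last cut, and whether a cut was made just now. At a cut the class must be the guessed one.
  step := fun ⟨pq, ph, m, _⟩ a =>
    {(pq, ph, δ m a, false)} ∪ {z | z = (pq, true, π [], true) ∧
      δ m a = if ph then pq.2 else pq.1}
  start := {z | z.1 ∈ F ∧ z.2 = (false, π [], false)}
  accept := {z | z.2.2.2 = true}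

theorem mem_factorNFA {k : ℕ} {π : List A → Fin k} {δ : Fin k → A → Fin k}
    (hδ : ∀ u a, δ (π u) a = π (u ++ [a])) (F : Set (Fin k × Fin k)) (x : OmegaWord A) :
    x ∈ buchiLanguage (factorNFA π δ F) ↔ ∃ f : ℕ → ℕ, StrictMono f ∧ 0 < f 0 ∧ ∃ q,
      (π (seg x 0 (f 0)), q) ∈ F ∧ ∀ n, π (seg x (f n) (f (n + 1))) = q := by
  classical
  constructor
  · rintro ⟨r, hr0, hr, hacc⟩
    obtain ⟨⟨p, q⟩, hpq⟩ : ∃ pq, pq = (r 0).1 := ⟨_, rfl⟩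
    let T : ℕ → Prop := fun n => (r n).2.2.2 = true
    have hT0 : ¬ T 0 := by
      have := hr0.2
      simp only [T, this, Bool.false_eq_true, not_false_eq_true]
    -- `c n` is the last cut up to `n`. The default value 0 means that there is none, which is
    -- unambiguous because `T 0` fails.
    let c : ℕ → ℕ := Nat.findGreatest T
    have hcle : ∀ n, c n ≤ n := Nat.findGreatest_le
    have hstep : ∀ n, r (n + 1) = ((r n).1, (r n).2.1, δ (r n).2.2.1 (x n), false) ∨
        (r (n + 1) = ((r n).1, true, π [], true) ∧
          δ (r n).2.2.1 (x n) = if (r n).2.1 then (r n).1.2 else (r n).1.1) := fun n => hr n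
    have inv : ∀ n, (r n).1 = (p, q) ∧ (r n).2.1 = decide (c n ≠ 0) ∧
        (r n).2.2.1 = π (seg x (c n) n) := by
      intro n
      induction n with
      | zero =>
        have := hr0.2
        simp [hpq, this, c]
      | succ n ih =>
        rcases hstep n with h | ⟨h, h'⟩
        · have hc : c (n + 1) = c n := Nat.findGreatest_of_not (by simp [T, h])
          rw [h, hc, seg_succ _ (hcle n), ← hδ, ← ih.2.2]
          exact ⟨ih.1, ih.2.1, rfl⟩
        · have hc : c (n + 1) = n + 1 := Nat.findGreatest_eq (by simp [T, h])
          rw [h, hc]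
          simp [ih.1]
    have hcut : ∀ n, T (n + 1) → π (seg x (c n) (n + 1)) = if c n ≠ 0 then q else p := by
      intro n hn
      rcases hstep n with h | ⟨h, h'⟩
      · simp [T, h] at hn
      · rw [seg_succ _ (hcle n), ← hδ, ← (inv n).2.2, h', (inv n).1, (inv n).2.1]
        simp
    have hinf : {n | T n}.Infinite := Nat.frequently_atTop_iff_infinite.1 hacc
    have hnth : StrictMono (Nat.nth T) := Nat.nth_strictMono hinf
    have hmem : ∀ n, T (Nat.nth T n) := Nat.nth_mem_of_infinite hinf
    have hran : ∀ k, T k → ∃ i, Nat.nth T i = k := fun k hk => by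
      have h : k ∈ Set.range (Nat.nth T) := by
        rw [Nat.range_nth_of_infinite hinf]
        exact hk
      exact h
    have hpos : 0 < Nat.nth T 0 := Nat.pos_of_ne_zero fun h => hT0 (h ▸ hmem 0)
    refine ⟨Nat.nth T, hnth, hpos, q, ?_, fun n => ?_⟩
    · have h := hcut (Nat.nth T 0 - 1)
      rw [Nat.sub_add_cancel hpos] at h
      have hc : c (Nat.nth T 0 - 1) = 0 := by
        rw [Nat.findGreatest_eq_zero_iff]
        intro k _ hk hTk
        obtain ⟨i, rfl⟩ := hran k hTk
        have := hnth.monotone (Nat.zero_le i)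
        omega
      rw [hc] at h
      rw [h (hmem 0)]
      simp only [ne_eq, not_true_eq_false, if_false]
      have := hr0.1
      rwa [← hpq] at this
    · have h := hcut (Nat.nth T (n + 1) - 1)
      have hp1 : Nat.nth T n < Nat.nth T (n + 1) := hnth (Nat.lt_succ_self n)
      rw [Nat.sub_add_cancel (by omega)] at h
      have hc : c (Nat.nth T (n + 1) - 1) = Nat.nth T n := by
        rw [Nat.findGreatest_eq_iff]
        refine ⟨by omega, fun _ => hmem n, fun {k} hk hk' hTk => ?_⟩
        obtain ⟨i, rfl⟩ := hran k hTk
        have h1 := hnth.lt_iff_lt.1 hk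
        have h2 : Nat.nth T i < Nat.nth T (n + 1) := by omega
        have := hnth.lt_iff_lt.1 h2
        omega
      rw [hc] at h
      rw [h (hmem _), if_pos]
      have := hnth.monotone (Nat.zero_le n)
      omega
  · rintro ⟨f, hf, hf0, q, hF, hq⟩
    let P : ℕ → Prop := fun n => n ∈ Set.range f
    let c : ℕ → ℕ := Nat.findGreatest P
    have hcle : ∀ n, c n ≤ n := Nat.findGreatest_le
    have hcf : ∀ i, c (f i) = f i := fun i => Nat.findGreatest_eq ⟨i, rfl⟩
    -- The run with cuts at the values of `f`. The flag needs `n ≠ 0` because `c 0 = 0` by default,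
    -- although no cut is made there.
    refine ⟨fun n => ((π (seg x 0 (f 0)), q), decide (c n ≠ 0), π (seg x (c n) n),
      decide (c n = n ∧ n ≠ 0)), ⟨hF, by simp [c]⟩, fun n => ?_, ?_⟩
    · by_cases hn : P (n + 1)
      · right
        have hc : c (n + 1) = n + 1 := Nat.findGreatest_eq hn
        refine ⟨by simp [hc], ?_⟩
        rw [hδ, ← seg_succ _ (hcle n)]
        obtain ⟨i, hi⟩ := hn
        rw [← hi]
        rcases i with _ | i
        · have : c n = 0 := by
            rw [Nat.findGreatest_eq_zero_iff]
            rintro k _ hk ⟨j, rfl⟩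
            have := hf.monotone (Nat.zero_le j)
            omega
          simp [this]
        · have h1 : f i < f (i + 1) := hf (Nat.lt_succ_self i)
          have : c n = f i := by
            rw [Nat.findGreatest_eq_iff]
            refine ⟨by omega, fun _ => ⟨i, rfl⟩, ?_⟩
            rintro _ hk hk' ⟨j, rfl⟩
            have h2 := hf.lt_iff_lt.1 hk
            have h3 : f j < f (i + 1) := by omega
            have := hf.lt_iff_lt.1 h3
            omega
          have h2 := hf.monotone (Nat.zero_le i)
          have h3 : f i ≠ 0 := by omega
          simp [this, hq, h3]
      · left
        have hc : c (n + 1) = c n := Nat.findGreatest_of_not hn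
        have h1 := hcle n
        have h2 : c n ≠ n + 1 := by omega
        simp [hc, hδ, h2, seg_succ _ h1]
    · rw [frequently_atTop]
      intro N
      refine ⟨f N, hf.id_le N, ?_⟩
      have := hf.monotone (Nat.zero_le N)
      have h2 : f N ≠ 0 := by omega
      simp [factorNFA, hcf, h2]

/-- The pair of context class and factor class of a finite word can be computed letter by letter,
and there are finitely many pairs. By Ramsey every word has a factorization into factors that, after
the first, all have the same class; by `hsat` membership in `L` depends only on this class and that
of the first factor. -/
theorem isOmegaRegular_of_finite (hL : IsNeutralLetter L e)
    (h1 : Finite (Quotient (prefixSetoid L e))) (h2 : Finite (Quotient (factorSetoid L e)))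
    (hsat : ∀ u v : ℕ → List A, (∀ n, contextSetoid L e (u n) (v n)) →
      (∀ n, factorSetoid L e (u n) (v n)) → ∀ s,
      AccS L e s u → AccS L e s v) : IsOmegaRegular L := by
  classical
  have h1 := finite_contextSetoid h1 hL
  obtain ⟨k, ⟨ε⟩⟩ := Finite.exists_equiv_fin
    (Quotient (contextSetoid L e) × Quotient (factorSetoid L e))
  let π : List A → Fin k := fun u => ε (Quotient.mk _ u, Quotient.mk _ u)
  have hπ : ∀ {u v}, π u = π v ↔ contextSetoid L e u v ∧ factorSetoid L e u v := fun {u v} => by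
    simp only [π, ε.apply_eq_iff_eq, Prod.mk.injEq, Quotient.eq]
  let δ : Fin k → A → Fin k := fun m a => if h : ∃ u, π u = m then π (h.choose ++ [a]) else m
  have hδ : ∀ u a, δ (π u) a = π (u ++ [a]) := fun u a => by
    have h : ∃ v, π v = π u := ⟨u, rfl⟩
    simp only [δ, dif_pos h]
    have := hπ.1 h.choose_spec
    exact hπ.2 ⟨contextSetoid_append hL this.1 _, factorSetoid_append this.2 _⟩
  -- A pair is accepting if one sequence with these classes is accepted; saturation extends this to
  -- all such sequences.
  let F : Set (Fin k × Fin k) := {pq | ∃ s w, π s = pq.1 ∧ (∀ n, π (w n) = pq.2) ∧ AccS L e s w}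
  refine ⟨_, inferInstance, factorNFA π δ F, ?_⟩
  ext x
  rw [mem_factorNFA hδ]
  constructor
  · rintro ⟨f, hf, hf0, q, ⟨s, w, hs, hw, hacc⟩, hq⟩
    rw [mem_iff_accS_seg hL x hf hf0]
    have h := fun n => hπ.1 ((hw n).trans (hq n).symm)
    -- Context equivalence with empty left part is prefix equivalence; it exchanges the first
    -- factor, and `hsat` exchanges all others.
    exact ((hπ.1 hs).1 [] _).1 (hsat _ _ (fun n => (h n).1) (fun n => (h n).2) _ hacc)
  · intro hx
    -- Starting from `Nat.succ` keeps the first cut positive.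
    obtain ⟨g, hg, q, hq⟩ := exists_monochromatic_consecutive (fun i j => π (seg x i j))
      Finset.univ Nat.succ (fun _ _ h => Nat.succ_lt_succ h) (by simp)
    have hf : StrictMono fun n => (g n).succ := fun _ _ h => Nat.succ_lt_succ (hg h)
    exact ⟨fun n => (g n).succ, hf, Nat.succ_pos _, q,
      ⟨_, _, rfl, hq, (mem_iff_accS_seg hL x hf (Nat.succ_pos _)).1 hx⟩, hq⟩

end Regular

/-! ### Blocks, and the three properties that detect unboundedness -/

section Blocks

variable {A : Type u} {L : OmegaLanguage A} {e : A}

/-- The position `k` lies strictly between an element of `X` and the next element of `D`. -/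
def InBlock (D X : Set ℕ) (k : ℕ) : Prop := ∃ d ∈ X, d < k ∧ ∀ j ∈ D, d < j → k < j

/-- The intervals disjoint from `D` contain a bounded number of elements of `W`. -/
def Bdd (D W : Set ℕ) : Prop :=
  ∃ K, ∀ a b, (∀ j ∈ D, ¬ (a ≤ j ∧ j < b)) → (W ∩ Set.Ico a b).ncard ≤ K

/-- All letters of `y` outside the set `W` are `e`. -/
def Supp (e : A) (y : OmegaWord A) (W : Set ℕ) : Prop := ∀ k, y k ≠ e → k ∈ W

/-- Replacing `u` by `v` on the blocks in any subset of `Z` does not change membership in `L`. -/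
def Replaceable (L : OmegaLanguage A) (D : Set ℕ) (u v : OmegaWord A) (Z : Set ℕ) : Prop :=
  ∀ X, X ⊆ Z → ∀ y z : OmegaWord A, (∀ k, InBlock D X k → y k = u k ∧ z k = v k) →
    (∀ k, ¬ InBlock D X k → y k = z k) → (y ∈ L ↔ z ∈ L)

/-- Replacing `u` by `v` on the blocks in any infinite subset `X` of `Z` does not change membership
in `L`, where the other letters different from `e` stand before the first of these blocks or in the
intersection of these blocks with `C`. -/
def LimReplaceable (L : OmegaLanguage A) (e : A) (D C : Set ℕ) (u v : OmegaWord A) (Z : Set ℕ) :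
    Prop :=
  ∀ X, X.Infinite → X ⊆ Z → ∀ y z : OmegaWord A,
    (∀ k, InBlock D X k → k ∉ C → y k = u k ∧ z k = v k) →
    (∀ k, InBlock D X k → k ∈ C → y k = z k) →
    (∀ k, ¬ InBlock D X k → y k = z k ∧ (y k = e ∨ ∀ d ∈ X, k < d)) → (y ∈ L ↔ z ∈ L)

/-- In every block the set `C` comes after the letters of `u` and `v` that are not `e`. -/
def ComesAfter (e : A) (D C : Set ℕ) (u v : OmegaWord A) : Prop :=
  ∀ d ∈ D, ∀ i k, d < i → d < k → (∀ j ∈ D, d < j → i < j) → (∀ j ∈ D, d < j → k < j) →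
    k ∈ C → u i ≠ e ∨ v i ≠ e → i < k

/-- `x'` is the next element of `E ∪ O` after `x`. -/
def NextIn (E O : Set ℕ) (x x' : ℕ) : Prop := x < x' ∧ ∀ z, z ∈ E ∨ z ∈ O → ¬ (x < z ∧ z < x')

/-- The elements of `E` and of `O` alternate, starting in `E` and not ending in `E`. -/
def Alternate (E O : Set ℕ) : Prop :=
  (∀ x ∈ E, x ∉ O) ∧ (∀ x ∈ E, ∃ x' ∈ O, NextIn E O x x') ∧ (∀ x' ∈ O, ∃ x ∈ E, NextIn E O x x')

/-- `k` lies between an element of `E` and the end of the next block in `O`. -/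
def InZone (D E O : Set ℕ) (k : ℕ) : Prop :=
  ∃ x ∈ E, ∃ x' ∈ O, NextIn E O x x' ∧ x ≤ k ∧ ∀ j ∈ D, x' < j → k < j

/-- Moving the contents of `w` from the blocks in `E` to the blocks in `O` does not change
membership in `L`, whenever `E` and `O` alternate in `Y`. -/
def Movable (L : OmegaLanguage A) (e : A) (D : Set ℕ) (w : OmegaWord A) (Y : Set ℕ) : Prop :=
  ∀ E O, E ⊆ Y → O ⊆ Y → Alternate E O → ∀ y z : OmegaWord A,
    (∀ k, InZone D E O k → (InBlock D E k → y k = w k) ∧ (¬ InBlock D E k → y k = e) ∧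
      (InBlock D O k → z k = w k) ∧ (¬ InBlock D O k → z k = e)) →
    (∀ k, ¬ InZone D E O k → y k = z k) → (y ∈ L ↔ z ∈ L)

/-- If `W` is bounded, `P` can be the set of blocks whose two contents are equivalent. If `W` is
unbounded, the last clause forces `P` to meet every infinite replaceable subset of `D`, and the
replaceability of `P` then exchanges infinitely many different pairs of words at once. -/
def ReplaceProp (L : OmegaLanguage A) (e : A) (D W : Set ℕ) : Prop :=
  ∀ u v : OmegaWord A, Supp e u W → Supp e v W → ∃ P, P ⊆ D ∧ Replaceable L D u v P ∧
    ∀ Z, Z ⊆ D → Z.Infinite → (∀ d ∈ Z, d ∉ P) → ¬ Replaceable L D u v Z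

/-- The set `C` reserves room after the contents of a block for the following word of the context,
and its size there bounds the length of that word. Thinning `Z` to `Z'` is needed because `LimEquiv`
concerns a single pair of words: blocks with equivalent contents become replaceable only once their
contents are constant. -/
def LimReplaceProp (L : OmegaLanguage A) (e : A) (D W : Set ℕ) : Prop :=
  ∀ (u v : OmegaWord A) (C : Set ℕ), Supp e u W → Supp e v W → C ⊆ W → ComesAfter e D C u v →
    ∃ P, P ⊆ D ∧
      (∀ Z, Z ⊆ P → Z.Infinite → ∃ Z', Z' ⊆ Z ∧ Z'.Infinite ∧ LimReplaceable L e D C u v Z') ∧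
      ∀ Z, Z ⊆ D → Z.Infinite → (∀ d ∈ Z, d ∉ P) → ¬ LimReplaceable L e D C u v Z

/-- The source of finite index. With finitely many contents, the pigeonhole principle gives `Y`; on
unbounded blocks that host an arbitrary sequence of words, `Y` compares different words of the
sequence. -/
def MoveProp (L : OmegaLanguage A) (e : A) (D W : Set ℕ) : Prop :=
  ∀ w : OmegaWord A, Supp e w W → ∀ S, S ⊆ D → S.Infinite →
    ∃ Y, Y ⊆ S ∧ Y.Infinite ∧ Movable L e D w Y

/-- The least element of `D` above `d`. -/
noncomputable def nxt (D : Set ℕ) (d : ℕ) : ℕ := sInf {j | j ∈ D ∧ d < j}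

variable {D : Set ℕ}

theorem nxt_spec (hD : D.Infinite) (d : ℕ) : nxt D d ∈ D ∧ d < nxt D d :=
  Nat.sInf_mem (s := {j | j ∈ D ∧ d < j}) ((hD.exists_gt d).imp fun _ h => ⟨h.1, h.2⟩)

theorem nxt_le {d j : ℕ} (hj : j ∈ D) (h : d < j) : nxt D d ≤ j := Nat.sInf_le ⟨hj, h⟩

theorem before_iff (hD : D.Infinite) {d k : ℕ} : (∀ j ∈ D, d < j → k < j) ↔ k < nxt D d :=
  ⟨fun h => h _ (nxt_spec hD d).1 (nxt_spec hD d).2, fun h _ hj hd => h.trans_le (nxt_le hj hd)⟩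

theorem inBlock_iff (hD : D.Infinite) {X : Set ℕ} {k : ℕ} :
    InBlock D X k ↔ ∃ d ∈ X, d < k ∧ k < nxt D d := by
  simp only [InBlock, before_iff hD]

theorem block_unique {d d' k : ℕ} (hd : d ∈ D) (hd' : d' ∈ D) (h : d < k)
    (h1 : k < nxt D d) (h' : d' < k) (h1' : k < nxt D d') : d = d' := by
  rcases lt_trichotomy d d' with hlt | rfl | hlt
  · have := nxt_le hd' hlt; omega
  · rfl
  · have := nxt_le hd hlt; omega

/-- The letters of `y` different from `e` in the block starting at `d`. -/
noncomputable def content (e : A) (D : Set ℕ) (y : OmegaWord A) (d : ℕ) : List A :=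
  red e y (d + 1) (nxt D d)

@[simp] theorem filter_red (y : OmegaWord A) (a b : ℕ) [DecidablePred (fun x : A => x ≠ e)] :
    (red e y a b).filter (· ≠ e) = red e y a b := by
  rw [red, List.filter_eq_self]
  intro c hc
  simpa using (List.mem_filter.1 hc).2

open Classical in
/-- The word with the letters of `l` on the set `F`. -/
noncomputable def place (e : A) (F : Finset ℕ) (l : List A) : OmegaWord A := fun k =>
  if k ∈ F then l.getD (F.filter (· < k)).card e else e

theorem place_supp (F : Finset ℕ) (l : List A) : Supp e (place e F l) F := fun k hk => by
  by_contra h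
  exact hk (if_neg h)

open Classical in
-- The positions in `F` receive the letters of `l` in increasing order. Induction on the right end
-- of the interval: up to `b`, as many letters of `l` are read as `F` has elements below `b`.
theorem red_place {F : Finset ℕ} {l : List A} {a b : ℕ} (hF : ∀ k ∈ F, a ≤ k ∧ k < b)
    (hl : l.length ≤ F.card) : red e (place e F l) a b = l.filter (· ≠ e) := by
  have key : ∀ b, a ≤ b → red e (place e F l) a b =
      (l.take (F.filter (· < b)).card).filter (· ≠ e) := by
    intro b hb
    induction b, hb using Nat.le_induction with
    | base =>
      have : F.filter (· < a) = ∅ := Finset.filter_eq_empty_iff.2 fun k hk => by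
        have := hF k hk; omega
      simp [red, this]
    | succ b hb ih =>
      rw [← red_append _ hb (Nat.le_succ b), ih]
      have h1 : red e (place e F l) b (b + 1) = [place e F l b].filter (· ≠ e) := by
        rw [red, List.Ico.succ_singleton]; rfl
      rw [h1, ← List.filter_append]
      by_cases hbF : b ∈ F
      · have h2 : F.filter (· < b + 1) = insert b (F.filter (· < b)) := by
          ext k
          simp only [Finset.mem_filter, Finset.mem_insert, Nat.lt_succ_iff_lt_or_eq]
          constructor
          · tauto
          · rintro (rfl | h)
            · exact ⟨hbF, Or.inr rfl⟩
            · exact ⟨h.1, Or.inl h.2⟩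
        rw [h2, Finset.card_insert_of_notMem (by simp), place, if_pos hbF, List.take_add_one]
        by_cases hlt : (F.filter (· < b)).card < l.length
        · simp [List.getElem?_eq_getElem hlt]
        -- When `l` is exhausted, the default letter `e` is written, which the filter removes.
        · rw [List.getD_eq_default _ _ (by omega), List.getElem?_eq_none (by omega)]
          simp
      · have h2 : F.filter (· < b + 1) = F.filter (· < b) := by
          ext k
          simp only [Finset.mem_filter, Nat.lt_succ_iff_lt_or_eq]
          constructor
          · rintro ⟨h, h' | rfl⟩
            · exact ⟨h, h'⟩
            · exact absurd h hbF
          · tauto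
        rw [h2, place, if_neg hbF]
        simp
  by_cases hab : a ≤ b
  · rw [key b hab, Finset.filter_true_of_mem fun k hk => (hF k hk).2, List.take_of_length_le hl]
  · have : F = ∅ := Finset.eq_empty_of_forall_notMem fun k hk => by have := hF k hk; omega
    subst this
    have : l = [] := by simpa using hl
    subst this
    rw [red, List.Ico.eq_nil_of_le (by omega)]
    rfl

theorem exists_strictMono_seq {p : ℕ → ℕ → Prop} (h : ∀ n N, ∃ i, N ≤ i ∧ p n i) (N : ℕ)
    (G : ℕ → ℕ → ℕ) : ∃ i : ℕ → ℕ, StrictMono i ∧ N ≤ i 0 ∧ (∀ n, p n (i n)) ∧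
      ∀ n, G n (i n) ≤ i (n + 1) := by
  choose g hg hp using h
  let i : ℕ → ℕ := fun n => Nat.rec (g 0 N) (fun n a => g (n + 1) (max (a + 1) (G n a))) n
  have hi : ∀ n, max (i n + 1) (G n (i n)) ≤ i (n + 1) := fun n => hg _ _
  exact ⟨i, strictMono_nat_of_lt_succ fun n => (le_max_left _ _).trans (hi n), hg _ _,
    fun n => by cases n <;> exact hp _ _, fun n => (le_max_right _ _).trans (hi n)⟩

theorem exists_glue {p : ℕ → ℕ} (hp : StrictMono p) (f : ℕ → OmegaWord A) :
    ∃ y : OmegaWord A, ∀ n k, p n ≤ k → k < p (n + 1) → y k = f n k := by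
  refine ⟨fun k => f (Nat.findGreatest (fun n => p n ≤ k) k) k, fun n k h h' => ?_⟩
  have : Nat.findGreatest (fun n => p n ≤ k) k = n := by
    rw [Nat.findGreatest_eq_iff]
    refine ⟨(hp.id_le n).trans h, fun _ => h, fun {m} hm _ hle => ?_⟩
    have := hp.monotone (show n + 1 ≤ m from hm)
    omega
  simp only [this]

/-- A word is cut after each position `d n`. -/
theorem mem_iff_accS_red (hL : IsNeutralLetter L e) (y : OmegaWord A) {d : ℕ → ℕ}
    (hd : StrictMono d) : y ∈ L ↔
      AccS L e (red e y 0 (d 0 + 1)) (fun n => red e y (d n + 1) (d (n + 1) + 1)) := by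
  classical
  have h := mem_iff_accS_seg hL y (f := fun n => d n + 1) (fun _ _ h => Nat.succ_lt_succ (hd h))
    (Nat.succ_pos _)
  rw [h]
  exact accS_congr hL (by simp [red, seg]) (by simp [red, seg])

theorem red_block_append (hD : D.Infinite) (y : OmegaWord A) {d d' : ℕ}
    (hd' : d' ∈ D) (h : d < d') :
    red e y (d + 1) (d' + 1) = content e D y d ++ red e y (nxt D d) (d' + 1) :=
  (red_append y (Nat.succ_le_of_lt (nxt_spec hD d).2) ((nxt_le hd' h).trans (Nat.le_succ _))).symm

theorem content_congr (hD : D.Infinite) {X : Set ℕ} {d : ℕ} (hd : d ∈ X) {y z : OmegaWord A}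
    (h : ∀ k, InBlock D X k → y k = z k) : content e D y d = content e D z d :=
  red_congr fun k h1 h2 => h k ((inBlock_iff hD).2 ⟨d, hd, h1, h2⟩)

theorem not_inBlock_gap (hD : D.Infinite) {d : ℕ → ℕ} (hd : StrictMono d) {n k : ℕ}
    (h : nxt D (d n) ≤ k) (h' : k ≤ d (n + 1)) : ¬ InBlock D (Set.range d) k := by
  rw [inBlock_iff hD]
  rintro ⟨_, ⟨m, rfl⟩, h1, h2⟩
  rcases Nat.lt_or_ge n m with hm | hm
  · have := hd.monotone (show n + 1 ≤ m from hm); omega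
  · rcases hm.eq_or_lt with rfl | hlt
    · omega
    · have h3 := hd hlt
      have h4 : d n < nxt D (d n) := (nxt_spec hD _).2
      have h5 : nxt D (d m) ≤ nxt D (d n) := nxt_le (nxt_spec hD _).1 (h3.trans h4)
      omega

theorem exists_strictMono_range {X : Set ℕ} (hX : X.Infinite) :
    ∃ d : ℕ → ℕ, StrictMono d ∧ Set.range d = X :=
  ⟨Nat.nth (· ∈ X), Nat.nth_strictMono hX, Nat.range_nth_of_infinite hX⟩

/-- Reading a word with contents `u` in infinitely many blocks. -/
theorem mem_iff_accS_content (hL : IsNeutralLetter L e) (hD : D.Infinite) {d : ℕ → ℕ}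
    (hd : StrictMono d) (hdD : ∀ n, d n ∈ D) {y u : OmegaWord A}
    (hy : ∀ k, InBlock D (Set.range d) k → y k = u k) : y ∈ L ↔
      AccS L e (red e y 0 (d 0 + 1))
        (fun n => content e D u (d n) ++ red e y (nxt D (d n)) (d (n + 1) + 1)) := by
  rw [mem_iff_accS_red hL y hd]
  simp only [red_block_append hD y (hdD _) (hd (Nat.lt_succ_self _)),
    content_congr hD (Set.mem_range_self _) hy]

/-- Cut after the start of each block in `X`: the two words become `τ` and `σ` repeated infinitely
often in the same context, as in `factorSetoid`. -/
theorem replaceable_of_infinite (hL : IsNeutralLetter L e) (hD : D.Infinite) {X : Set ℕ}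
    (hX : X.Infinite) (hXD : X ⊆ D) {u v : OmegaWord A} {τ σ : List A}
    (hu : ∀ d ∈ X, content e D u d = τ) (hv : ∀ d ∈ X, content e D v d = σ)
    (h : factorSetoid L e τ σ) {y z : OmegaWord A}
    (h1 : ∀ k, InBlock D X k → y k = u k ∧ z k = v k)
    (h2 : ∀ k, ¬ InBlock D X k → y k = z k) : y ∈ L ↔ z ∈ L := by
  obtain ⟨d, hd, rfl⟩ := exists_strictMono_range hX
  have hdD : ∀ n, d n ∈ D := fun n => hXD ⟨n, rfl⟩
  rw [mem_iff_accS_content hL hD hd hdD (fun k hk => (h1 k hk).1),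
    mem_iff_accS_content hL hD hd hdD (fun k hk => (h1 k hk).2)]
  simp only [hu _ (Set.mem_range_self _), hv _ (Set.mem_range_self _)]
  have e1 : red e y 0 (d 0 + 1) = red e z 0 (d 0 + 1) := red_congr fun k _ hk => h2 k (by
    rw [inBlock_iff hD]
    rintro ⟨_, ⟨m, rfl⟩, h3, h4⟩
    have := hd.monotone (Nat.zero_le m)
    omega)
  have e2 : ∀ n, red e y (nxt D (d n)) (d (n + 1) + 1) = red e z (nxt D (d n)) (d (n + 1) + 1) :=
    fun n => red_congr fun k h3 h4 => h2 k (not_inBlock_gap hD hd h3 (Nat.lt_succ_iff.1 h4))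
  simp only [e1, e2]
  exact h _ _

/-- Cutting a word at the end of a block. -/
theorem mem_iff_accS_block (hL : IsNeutralLetter L e) (hD : D.Infinite) (y : OmegaWord A) (d : ℕ) :
    y ∈ L ↔ AccS L e (red e y 0 (d + 1) ++ content e D y d)
      (fun n => red e y (nxt D d + n) (nxt D d + n + 1)) := by
  classical
  have h := mem_iff_accS_seg hL y (f := fun n => nxt D d + n)
    (fun _ _ h => Nat.add_lt_add_left h _) (by have := nxt_spec hD d; simp; omega)
  rw [h, content, red_append y (Nat.zero_le _) (nxt_spec hD d).2]
  exact accS_congr hL (by simp [red, seg]) (by simp [red, seg, add_assoc])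

theorem replaceable_singleton (hL : IsNeutralLetter L e) (hD : D.Infinite) {d : ℕ}
    {u v : OmegaWord A}
    (h : contextSetoid L e (content e D u d) (content e D v d)) : Replaceable L D u v {d} := by
  intro X hX y z h1 h2
  rcases Set.subset_singleton_iff_eq.1 hX with rfl | rfl
  · have : y = z := funext fun k => h2 k fun ⟨d, hd, _⟩ => hd
    rw [this]
  · have hmem : d ∈ ({d} : Set ℕ) := rfl
    rw [mem_iff_accS_block hL hD y d, mem_iff_accS_block hL hD z d,
      content_congr hD hmem (fun k hk => (h1 k hk).1),
      content_congr hD hmem (fun k hk => (h1 k hk).2)]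
    have e1 : red e y 0 (d + 1) = red e z 0 (d + 1) := red_congr fun k _ hk => h2 k (by
      rw [inBlock_iff hD]
      rintro ⟨_, rfl, h3, h4⟩
      omega)
    have e2 : ∀ n, red e y (nxt D d + n) (nxt D d + n + 1) =
        red e z (nxt D d + n) (nxt D d + n + 1) :=
      fun n => red_congr fun k h3 h4 => h2 k (by
        rw [inBlock_iff hD]
        rintro ⟨_, rfl, h3, h4⟩
        omega)
    simp only [e1, e2]
    exact h _ _

theorem Replaceable.mono {u v : OmegaWord A} {Z Z' : Set ℕ} (h : Replaceable L D u v Z)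
    (hZ : Z' ⊆ Z) : Replaceable L D u v Z' := fun X hX => h X (hX.trans hZ)

/-- Replace the blocks in `X ∩ Z` first and those in `X \ Z` afterwards, through the intermediate
word `y'`. Blocks with different starts in `D` are disjoint, so the two steps do not interfere. -/
theorem Replaceable.union (hD : D.Infinite) {u v : OmegaWord A} {Z Z' : Set ℕ}
    (h : Replaceable L D u v Z) (h' : Replaceable L D u v Z') (hZ : Z ⊆ D) (hZ' : Z' ⊆ D) :
    Replaceable L D u v (Z ∪ Z') := by
  classical
  intro X hX y z h1 h2
  have hXD : X ⊆ D := hX.trans (Set.union_subset hZ hZ')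
  let y' : OmegaWord A := fun k => if InBlock D (X ∩ Z) k then v k else y k
  have hsub : ∀ {Y Y' : Set ℕ} {k}, Y ⊆ Y' → InBlock D Y k → InBlock D Y' k :=
    fun hY ⟨d, hd, h⟩ => ⟨d, hY hd, h⟩
  have hdisj : ∀ k, InBlock D (X \ Z) k → ¬ InBlock D (X ∩ Z) k := by
    intro k h3 h4
    rw [inBlock_iff hD] at h3 h4
    obtain ⟨d, hd, hdk, hdk'⟩ := h3
    obtain ⟨d', hd', hdk2, hdk2'⟩ := h4
    have := block_unique (hXD hd.1) (hXD hd'.1) hdk hdk' hdk2 hdk2'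
    subst this
    exact hd.2 hd'.2
  have hcov : ∀ k, InBlock D X k → ¬ InBlock D (X \ Z) k → InBlock D (X ∩ Z) k := by
    rintro k ⟨d, hd, h3⟩ h4
    by_cases hdZ : d ∈ Z
    · exact ⟨d, ⟨hd, hdZ⟩, h3⟩
    · exact absurd ⟨d, ⟨hd, hdZ⟩, h3⟩ h4
  refine (h (X ∩ Z) Set.inter_subset_right y y' (fun k hk => ?_) fun k hk => ?_).trans
    (h' (X \ Z) (fun d hd => (hX hd.1).resolve_left hd.2) y' z (fun k hk => ?_) fun k hk => ?_)
  · exact ⟨(h1 k (hsub Set.inter_subset_left hk)).1, if_pos hk⟩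
  · exact (if_neg hk).symm
  · have := h1 k (hsub Set.sdiff_subset hk)
    exact ⟨(if_neg (hdisj k hk)).trans this.1, this.2⟩
  · by_cases h3 : InBlock D (X ∩ Z) k
    · exact (if_pos h3).trans (h1 k (hsub Set.inter_subset_left h3)).2.symm
    · refine (if_neg h3).trans (h2 k fun h4 => h3 (hcov k h4 hk))

theorem Replaceable.biUnion (hD : D.Infinite) {u v : OmegaWord A} {ι : Type*} {s : Set ι}
    (hs : s.Finite) {Z : ι → Set ℕ} (hZ : ∀ i ∈ s, Z i ⊆ D)
    (h : ∀ i ∈ s, Replaceable L D u v (Z i)) : Replaceable L D u v (⋃ i ∈ s, Z i) := by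
  induction s, hs using Set.Finite.induction_on with
  | empty =>
    intro X hX y z _ h2
    have : y = z := funext fun k => h2 k fun ⟨d, hd, _⟩ => by simpa using hX hd
    rw [this]
  | insert _ _ ih =>
    rw [Set.biUnion_insert]
    exact (h _ (Set.mem_insert _ _)).union hD (ih (fun i hi => hZ i (Set.mem_insert_of_mem _ hi))
      fun i hi => h i (Set.mem_insert_of_mem _ hi)) (hZ _ (Set.mem_insert _ _))
      (Set.iUnion₂_subset fun i hi => hZ i (Set.mem_insert_of_mem _ hi))

/-- Infinitely many blocks are replaced by factor equivalence; finitely many are replaced one at a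
time by context equivalence. -/
theorem replaceable_of_const (hL : IsNeutralLetter L e) (hD : D.Infinite) {Z : Set ℕ}
    (hZ : Z ⊆ D) {u v : OmegaWord A} {τ σ : List A}
    (hu : ∀ d ∈ Z, content e D u d = τ) (hv : ∀ d ∈ Z, content e D v d = σ)
    (h : contextSetoid L e τ σ) (h' : factorSetoid L e τ σ) : Replaceable L D u v Z := by
  intro X hX
  by_cases hX' : X.Infinite
  · intro y z h1 h2
    exact replaceable_of_infinite hL hD hX' (hX.trans hZ) (fun d hd => hu d (hX hd))
      (fun d hd => hv d (hX hd)) h' h1 h2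
  · have := Replaceable.biUnion (L := L) (u := u) (v := v) hD (Set.not_infinite.1 hX')
      (Z := fun d => {d}) (fun d hd => by simpa using hZ (hX hd)) (fun d hd =>
        replaceable_singleton hL hD (by rwa [hu d (hX hd), hv d (hX hd)]))
    rw [Set.biUnion_of_singleton] at this
    exact this X subset_rfl

/-- Realizing a context for infinitely many blocks. -/
theorem Replaceable.accS (hL : IsNeutralLetter L e) (hD : D.Infinite) {u v : OmegaWord A}
    {Z : Set ℕ} (h : Replaceable L D u v Z) (hZ : Z ⊆ D) {d : ℕ → ℕ} (hd : StrictMono d)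
    (hdZ : ∀ n, d n ∈ Z) {s : List A} {t : ℕ → List A} (hs : s.length ≤ d 0)
    (ht : ∀ n, nxt D (d n) + (t n).length ≤ d (n + 1)) :
    AccS L e s (fun n => content e D u (d n) ++ t n) ↔
      AccS L e s (fun n => content e D v (d n) ++ t n) := by
  classical
  -- The filler `g` carries the context: `s` before the first block, and `t n` between the end of
  -- the block at `d n` and `d (n + 1)`. The bounds `hs` and `ht` make it fit.
  obtain ⟨g, hg⟩ := exists_glue (p := fun n => if n = 0 then 0 else d (n - 1) + 1)
    (strictMono_nat_of_lt_succ fun n => by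
      rcases n with _ | n
      · simp
      · simpa using hd (Nat.lt_succ_self n))
    (fun n => if n = 0 then place e (Finset.range (d 0)) s else
      place e (Finset.Ico (nxt D (d (n - 1))) (d n)) (t (n - 1)))
  have key : ∀ w : OmegaWord A,
      (fun k => if InBlock D (Set.range d) k then w k else g k) ∈ L ↔
        AccS L e s (fun n => content e D w (d n) ++ t n) := by
    intro w
    rw [mem_iff_accS_content hL hD hd (fun n => hZ (hdZ n)) (u := w) (fun k hk => if_pos hk)]
    refine accS_congr hL ?_ fun n => ?_
    · rw [filter_red, red_congr (z := place e (Finset.range (d 0)) s), red_place]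
      · intro k hk
        have := Finset.mem_range.1 hk
        omega
      · simpa using hs
      · intro k _ hk
        rw [if_neg, hg 0 k (by simp) (by simpa using hk), if_pos rfl]
        rw [inBlock_iff hD]
        rintro ⟨_, ⟨m, rfl⟩, h3, h4⟩
        have := hd.monotone (Nat.zero_le m)
        omega
    · rw [List.filter_append, List.filter_append, filter_red,
        red_congr (z := place e (Finset.Ico (nxt D (d n)) (d (n + 1))) (t n)), red_place]
      · intro k hk
        have := Finset.mem_Ico.1 hk
        omega
      · have := ht n
        simp
        omega
      · intro k h1 h2
        have h3 := (nxt_spec hD (d n)).2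
        rw [if_neg (not_inBlock_gap hD hd h1 (Nat.lt_succ_iff.1 h2)),
          hg (n + 1) k (by simp; omega) (by simpa using h2), if_neg (by omega)]
        rfl
  rw [← key u, ← key v]
  refine h (Set.range d) (by rintro _ ⟨n, rfl⟩; exact hdZ n) _ _ (fun k hk => ?_) fun k hk => ?_
  · exact ⟨if_pos hk, if_pos hk⟩
  · simp only [if_neg hk]

/-- Cutting a word at the position from which it is a given word. -/
theorem mem_iff_accS_tail (hL : IsNeutralLetter L e) {x y : OmegaWord A} {p : ℕ → ℕ}
    {w : ℕ → List A} (hx : Realizes e x p w) {m : ℕ} (hm : 0 < m)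
    (hy : ∀ k, m ≤ k → y k = x (k - m)) : y ∈ L ↔ AccS L e (red e y 0 m) w := by
  classical
  obtain ⟨hp, hp0, hx⟩ := hx
  refine Realizes.mem_iff hL (p := fun n => if n = 0 then 0 else m + p (n - 1)) ⟨?_, rfl, ?_⟩
  · refine strictMono_nat_of_lt_succ fun n => ?_
    rcases n with _ | n
    · simp; omega
    · simpa using hp (Nat.lt_succ_self n)
  · intro n
    rcases n with _ | n
    · simp only [seqCons, filter_red, hp0, if_true, zero_add, one_ne_zero, if_false, Nat.sub_self,
        add_zero]
    · simp only [seqCons, Nat.succ_ne_zero, if_false, Nat.add_sub_cancel, ← hx n]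
      have hmap : ∀ a b, List.Ico (m + a) (m + b) = (List.Ico a b).map (m + ·) := fun a b => by
        rw [List.Ico.map_add, add_comm a, add_comm b]
      rw [red, red, hmap, List.map_map]
      congr 1
      refine List.map_congr_left fun k hk => ?_
      simp only [Function.comp]
      rw [hy _ (by omega), Nat.add_sub_cancel_left]

/-- Realizing a context for one block. -/
theorem Replaceable.accS_append (hL : IsNeutralLetter L e) (hD : D.Infinite) {u v : OmegaWord A}
    {Z : Set ℕ} (h : Replaceable L D u v Z) {d : ℕ} (hd : d ∈ Z) {s : List A}
    (hs : s.length ≤ d) (w : ℕ → List A) :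
    AccS L e (s ++ content e D u d) w ↔ AccS L e (s ++ content e D v d) w := by
  classical
  obtain ⟨x, p, hx⟩ := exists_realizes e w
  have hdn := (nxt_spec hD d).2
  have key : ∀ c : OmegaWord A,
      (fun k => if k < d + 1 then place e (Finset.range d) s k else
        if k < nxt D d then c k else x (k - nxt D d)) ∈ L ↔
        AccS L e (s ++ content e D c d) w := by
    intro c
    rw [mem_iff_accS_tail hL hx (m := nxt D d) (by omega) fun k hk => by
      rw [if_neg (by omega), if_neg (by omega)]]
    refine accS_congr hL ?_ fun _ => rfl
    rw [filter_red, List.filter_append, ← red_append _ (Nat.zero_le (d + 1)) hdn,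
      red_congr (a := 0) (z := place e (Finset.range d) s), red_place,
      red_congr (a := d + 1) (z := c), content, filter_red]
    · intro k h1 h2
      rw [if_neg (by omega), if_pos h2]
    · intro k hk
      have := Finset.mem_range.1 hk
      omega
    · simpa using hs
    · intro k _ hk
      rw [if_pos hk]
  rw [← key u, ← key v]
  refine h {d} (by simpa using hd) _ _ (fun k hk => ?_) fun k hk => ?_
  · rw [inBlock_iff hD] at hk
    obtain ⟨d', hd', h1, h2⟩ := hk
    obtain rfl : d' = d := hd'
    simp only [if_neg (show ¬ k < d' + 1 by omega), if_pos h2, and_self]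
  · have : k < d + 1 ∨ ¬ k < nxt D d := by
      by_contra hc
      push Not at hc
      exact hk ((inBlock_iff hD).2 ⟨d, rfl, hc.1, hc.2⟩)
    rcases this with h1 | h1
    · simp only [if_pos h1]
    · simp only [if_neg h1]

end Blocks

/-! ### Bounded blocks have the three properties -/

section Bounded

variable {A : Type u} {L : OmegaLanguage A} {e : A} {D : Set ℕ}

/-- As `factorSetoid`, where all words in the context but the first have length at most `c`. -/
def LimEquiv (L : OmegaLanguage A) (e : A) (c : ℕ) (u v : List A) : Prop :=
  ∀ (s : List A) (t : ℕ → List A), (∀ n, (t n).length ≤ c) →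
    (AccS L e s (fun n => u ++ t n) ↔ AccS L e s (fun n => v ++ t n))

open Classical in
/-- The word that agrees with `y` on `C` and is `e` elsewhere. -/
noncomputable def restr (e : A) (C : Set ℕ) (y : OmegaWord A) : OmegaWord A := fun k =>
  if k ∈ C then y k else e

theorem restr_supp (C : Set ℕ) (y : OmegaWord A) : Supp e (restr e C y) C := fun k hk => by
  by_contra h
  exact hk (if_neg h)

/-- All letters of `u` in the block other than `e` stand before `C`, so the block splits at a point
with `u` on its left and the letters on `C` on its right. -/
theorem content_restr (hD : D.Infinite) {C : Set ℕ} {d : ℕ} {u y : OmegaWord A}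
    (hC : ∀ i k, d < i → d < k → i < nxt D d → k < nxt D d → k ∈ C → u i ≠ e → i < k)
    (hy : ∀ k, d < k → k < nxt D d → k ∉ C → y k = u k) :
    content e D y d = content e D u d ++ content e D (restr e C y) d := by
  classical
  have hdn := (nxt_spec hD d).2
  have hex : ∃ m, d < m ∧ (m ∈ C ∨ nxt D d ≤ m) := ⟨nxt D d, hdn, Or.inr le_rfl⟩
  -- The splitting point `m` is the first element of `C` in the block, or the end of the block if
  -- there is none.
  obtain ⟨m, ⟨hdm, hm⟩, hmin⟩ : ∃ m, (d < m ∧ (m ∈ C ∨ nxt D d ≤ m)) ∧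
      ∀ k, d < k → k < m → k ∉ C ∧ k < nxt D d := ⟨Nat.find hex, Nat.find_spec hex, fun k h h' => by
    have := Nat.find_min hex h'
    push Not at this
    exact this h⟩
  have hmn : m ≤ nxt D d := by
    by_contra h
    have := (hmin (nxt D d) hdn (by omega)).2
    omega
  have hue : ∀ i, m ≤ i → i < nxt D d → u i = e := fun i h h' => by
    by_contra hne
    rcases hm with hm | hm
    · have := hC i m (by omega) hdm h' (by omega) hm hne
      omega
    · omega
  simp only [content]
  rw [← red_append y (Nat.succ_le_of_lt hdm) hmn, ← red_append u (Nat.succ_le_of_lt hdm) hmn,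
    ← red_append (restr e C y) (Nat.succ_le_of_lt hdm) hmn,
    red_eq_nil (y := u) (a := m) hue, red_eq_nil (y := restr e C y) (a := d + 1)
      (fun k h h' => if_neg (hmin k h h').1), List.append_nil, List.nil_append]
  congr 1
  · exact red_congr fun k h h' => hy k h (hmin k h h').2 (hmin k h h').1
  · refine red_congr fun k h h' => ?_
    by_cases hk : k ∈ C
    · exact (if_pos hk).symm
    · exact (hy k (by omega) h' hk).trans ((hue k h h').trans (if_neg hk).symm)

theorem length_red_le {y : OmegaWord A} {W : Set ℕ} (hy : Supp e y W) (a b : ℕ) :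
    (red e y a b).length ≤ (W ∩ Set.Ico a b).ncard := by
  classical
  have h : (red e y a b).length = ((List.Ico a b).filter (fun k => y k ≠ e)).length := by
    rw [red, List.filter_map, List.length_map]; rfl
  have hnd : ((List.Ico a b).filter (fun k => y k ≠ e)).Nodup := (List.Ico.nodup a b).filter _
  rw [h, ← List.toFinset_card_of_nodup hnd, ← Set.ncard_coe_finset]
  refine Set.ncard_le_ncard (fun k hk => ?_) ((Set.finite_Ico a b).inter_of_right W)
  simp only [List.coe_toFinset, List.mem_filter, List.Ico.mem, decide_eq_true_eq] at hk
  exact ⟨hy k hk.2, hk.1⟩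

/-- Reading two words as in the definition of `LimReplaceable`. -/
theorem exists_accS_of_lim (hL : IsNeutralLetter L e) (hD : D.Infinite) {C : Set ℕ}
    {u v : OmegaWord A} (hC : ComesAfter e D C u v) {d : ℕ → ℕ} (hd : StrictMono d)
    (hdD : ∀ n, d n ∈ D) {y z : OmegaWord A}
    (h1 : ∀ k, InBlock D (Set.range d) k → k ∉ C → y k = u k ∧ z k = v k)
    (h2 : ∀ k, InBlock D (Set.range d) k → k ∈ C → y k = z k)
    (h3 : ∀ k, ¬ InBlock D (Set.range d) k → y k = z k ∧ (y k = e ∨ ∀ d' ∈ Set.range d, k < d')) :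
    ∃ (s : List A) (t : ℕ → List A),
      (∀ n, (t n).length ≤ (C ∩ Set.Ico (d n + 1) (nxt D (d n))).ncard) ∧
      (y ∈ L ↔ AccS L e s (fun n => content e D u (d n) ++ t n)) ∧
      (z ∈ L ↔ AccS L e s (fun n => content e D v (d n) ++ t n)) := by
  have hC' : ∀ n i k, d n < i → d n < k → i < nxt D (d n) → k < nxt D (d n) → k ∈ C →
      (u i ≠ e ∨ v i ≠ e) → i < k := fun n i k a1 a2 a3 a4 =>
    hC _ (hdD n) i k a1 a2 ((before_iff hD).2 a3) ((before_iff hD).2 a4)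
  have hin : ∀ n k, d n < k → k < nxt D (d n) → InBlock D (Set.range d) k := fun n k a1 a2 =>
    (inBlock_iff hD).2 ⟨_, ⟨n, rfl⟩, a1, a2⟩
  have hgap : ∀ n, ∀ k, nxt D (d n) ≤ k → k < d (n + 1) + 1 →
      y k = e ∧ z k = e := fun n k a1 a2 => by
    have := h3 k (not_inBlock_gap hD hd a1 (by omega))
    have h4 : y k = e := this.2.resolve_right fun a3 => by
      have := a3 _ ⟨n, rfl⟩
      have := (nxt_spec hD (d n)).2
      omega
    exact ⟨h4, this.1 ▸ h4⟩
  have h0 : red e y 0 (d 0 + 1) = red e z 0 (d 0 + 1) := red_congr fun k _ hk => (h3 k (by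
    rw [inBlock_iff hD]
    rintro ⟨_, ⟨m, rfl⟩, h3, h4⟩
    have := hd.monotone (Nat.zero_le m)
    omega)).1
  have hyz : ∀ n, content e D (restr e C y) (d n) = content e D (restr e C z) (d n) := fun n =>
    red_congr fun k a1 a2 => by
      by_cases hk : k ∈ C
      · simp only [restr, if_pos hk]
        exact h2 k (hin n k a1 a2) hk
      · simp only [restr, if_neg hk]
  have key : ∀ n, red e y (d n + 1) (d (n + 1) + 1) =
        content e D u (d n) ++ content e D (restr e C y) (d n) ∧
      red e z (d n + 1) (d (n + 1) + 1) =
        content e D v (d n) ++ content e D (restr e C y) (d n) := fun n => by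
    rw [red_block_append hD y (hdD _) (hd (Nat.lt_succ_self n)),
      red_block_append hD z (hdD _) (hd (Nat.lt_succ_self n)),
      red_eq_nil fun k a1 a2 => (hgap n k a1 a2).1, red_eq_nil fun k a1 a2 => (hgap n k a1 a2).2,
      List.append_nil, List.append_nil,
      content_restr hD (u := u) (fun i k a1 a2 a3 a4 a5 a6 => hC' n i k a1 a2 a3 a4 a5 (Or.inl a6))
        (fun k a1 a2 a3 => (h1 k (hin n k a1 a2) a3).1),
      content_restr hD (u := v) (fun i k a1 a2 a3 a4 a5 a6 => hC' n i k a1 a2 a3 a4 a5 (Or.inr a6))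
        (fun k a1 a2 a3 => (h1 k (hin n k a1 a2) a3).2), hyz]
    exact ⟨rfl, rfl⟩
  refine ⟨red e y 0 (d 0 + 1), fun n => content e D (restr e C y) (d n),
    fun n => length_red_le (restr_supp C y) _ _, ?_, ?_⟩
  · rw [mem_iff_accS_red hL y hd]
    simp only [fun n => (key n).1]
  · rw [mem_iff_accS_red hL z hd, h0]
    simp only [fun n => (key n).2]

theorem limReplaceable_of_const (hL : IsNeutralLetter L e) (hD : D.Infinite) {C Z : Set ℕ}
    (hZ : Z ⊆ D) {u v : OmegaWord A} (hC : ComesAfter e D C u v) {τ σ : List A} {c : ℕ}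
    (hu : ∀ d ∈ Z, content e D u d = τ) (hv : ∀ d ∈ Z, content e D v d = σ)
    (hc : ∀ d ∈ Z, (C ∩ Set.Ico (d + 1) (nxt D d)).ncard ≤ c)
    (h : LimEquiv L e c τ σ) : LimReplaceable L e D C u v Z := by
  intro X hX hXZ y z h1 h2 h3
  obtain ⟨d, hd, rfl⟩ := exists_strictMono_range hX
  have hdZ : ∀ n, d n ∈ Z := fun n => hXZ ⟨n, rfl⟩
  obtain ⟨s, t, ht, hy, hz⟩ :=
    exists_accS_of_lim hL hD hC hd (fun n => hZ (hdZ n)) h1 h2 h3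
  simp only [fun n => hu _ (hdZ n), fun n => hv _ (hdZ n)] at hy hz
  rw [hy, hz]
  exact h s t fun n => (ht n).trans (hc _ (hdZ n))

theorem LimReplaceable.mono {C : Set ℕ} {u v : OmegaWord A} {Z Z' : Set ℕ}
    (h : LimReplaceable L e D C u v Z) (hZ : Z' ⊆ Z) : LimReplaceable L e D C u v Z' :=
  fun X hX hX' => h X hX (hX'.trans hZ)

/-- The converse of reading a context: `t n` is written on the part of `C` in the block at `d n`,
after the letters of `u` and `v`, and the gaps between blocks are filled with `e`. -/
theorem LimReplaceable.accS (hL : IsNeutralLetter L e) (hD : D.Infinite) {C : Set ℕ}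
    {u v : OmegaWord A} (hC : ComesAfter e D C u v) {Z : Set ℕ} (hZ : Z ⊆ D)
    (h : LimReplaceable L e D C u v Z) {d : ℕ → ℕ} (hd : StrictMono d) (hdZ : ∀ n, d n ∈ Z)
    {s : List A} {t : ℕ → List A} (hs : s.length ≤ d 0)
    (ht : ∀ n, (t n).length ≤ (C ∩ Set.Ico (d n + 1) (nxt D (d n))).ncard) :
    AccS L e s (fun n => content e D u (d n) ++ t n) ↔
      AccS L e s (fun n => content e D v (d n) ++ t n) := by
  classical
  let F : ℕ → Finset ℕ := fun n =>
    ((Set.finite_Ico (d n + 1) (nxt D (d n))).inter_of_right C).toFinset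
  have hF : ∀ n k, k ∈ F n ↔ k ∈ C ∧ d n + 1 ≤ k ∧ k < nxt D (d n) := fun n k => by simp [F]
  obtain ⟨g, hg⟩ := exists_glue (p := fun n => if n = 0 then 0 else d (n - 1) + 1)
    (strictMono_nat_of_lt_succ fun n => by
      rcases n with _ | n
      · simp
      · simpa using hd (Nat.lt_succ_self n))
    (fun n => if n = 0 then place e (Finset.range (d 0)) s else place e (F (n - 1)) (t (n - 1)))
  have hg0 : ∀ k, k ≤ d 0 → g k = place e (Finset.range (d 0)) s k := fun k hk =>
    hg 0 k (by simp) (by simpa [Nat.lt_succ_iff] using hk)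
  have hg1 : ∀ n k, d n < k → k ≤ d (n + 1) → g k = place e (F n) (t n) k := fun n k hk hk' =>
    hg (n + 1) k (by simpa using hk) (by simpa [Nat.lt_succ_iff] using hk')
  have hin : ∀ n k, d n < k → k < nxt D (d n) → InBlock D (Set.range d) k := fun n k a1 a2 =>
    (inBlock_iff hD).2 ⟨_, ⟨n, rfl⟩, a1, a2⟩
  have hle : ∀ n, nxt D (d n) ≤ d (n + 1) := fun n =>
    nxt_le (hZ (hdZ _)) (hd (Nat.lt_succ_self n))
  let Y : OmegaWord A → OmegaWord A := fun w k =>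
    if InBlock D (Set.range d) k ∧ k ∉ C then w k else g k
  have key : ∀ w : OmegaWord A, (∀ d ∈ D, ∀ i k, d < i → d < k → i < nxt D d → k < nxt D d →
      k ∈ C → w i ≠ e → i < k) →
      (Y w ∈ L ↔ AccS L e s (fun n => content e D w (d n) ++ t n)) := by
    intro w hw
    rw [mem_iff_accS_red hL _ hd]
    refine accS_congr hL ?_ fun n => ?_
    · rw [filter_red, red_congr (z := place e (Finset.range (d 0)) s), red_place]
      · intro k hk
        have := Finset.mem_range.1 hk
        omega
      · simpa using hs
      · intro k _ hk
        rw [← hg0 k (by omega)]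
        refine if_neg fun h => ?_
        rw [inBlock_iff hD] at h
        obtain ⟨⟨_, ⟨m, rfl⟩, h3, h4⟩, _⟩ := h
        have := hd.monotone (Nat.zero_le m)
        omega
    · have e1 : red e (Y w) (nxt D (d n)) (d (n + 1) + 1) = [] := red_eq_nil fun k h1 h2 => by
        have h3 := (nxt_spec hD (d n)).2
        simp only [Y]
        rw [if_neg fun h => not_inBlock_gap hD hd h1 (Nat.lt_succ_iff.1 h2) h.1,
          hg1 n k (by omega) (by omega)]
        by_contra h4
        have := (hF n k).1 (place_supp _ _ k h4)
        omega
      have e2 : content e D (restr e C (Y w)) (d n) = (t n).filter (· ≠ e) := by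
        rw [← red_place (e := e) (F := F n) (l := t n) (a := d n + 1) (b := nxt D (d n))]
        · refine red_congr fun k h1 h2 => ?_
          have h3 := hle n
          by_cases hk : k ∈ C
          · simp only [restr, Y, hk, if_true, not_true_eq_false, and_false, if_false]
            exact hg1 n k h1 (by omega)
          · simp only [restr, if_neg hk]
            by_contra h4
            exact hk ((hF n k).1 (place_supp _ _ k (Ne.symm h4))).1
        · intro k hk
          exact ((hF n k).1 hk).2
        · rw [← Set.ncard_eq_toFinset_card _ _]
          exact ht n
      rw [filter_red, red_block_append hD _ (hZ (hdZ _)) (hd (Nat.lt_succ_self n)), e1,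
        content_restr hD (u := w) (fun i k => hw _ (hZ (hdZ n)) i k)
          (fun k a1 a2 a3 => if_pos ⟨hin n k a1 a2, a3⟩), e2, List.append_nil, List.filter_append,
        content, filter_red]
  have hC' : ∀ d ∈ D, ∀ i k, d < i → d < k → i < nxt D d → k < nxt D d → k ∈ C →
      (u i ≠ e ∨ v i ≠ e) → i < k := fun d hd i k a1 a2 a3 a4 =>
    hC d hd i k a1 a2 ((before_iff hD).2 a3) ((before_iff hD).2 a4)
  rw [← key u fun d hd i k a1 a2 a3 a4 a5 a6 => hC' d hd i k a1 a2 a3 a4 a5 (Or.inl a6),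
    ← key v fun d hd i k a1 a2 a3 a4 a5 a6 => hC' d hd i k a1 a2 a3 a4 a5 (Or.inr a6)]
  refine h (Set.range d) (Set.infinite_range_of_injective hd.injective)
    (by rintro _ ⟨n, rfl⟩; exact hdZ n) _ _ (fun k hk hkC => ?_) (fun k hk hkC => ?_) fun k hk => ?_
  · exact ⟨if_pos ⟨hk, hkC⟩, if_pos ⟨hk, hkC⟩⟩
  · simp only [Y, hkC, not_true_eq_false, and_false, if_false]
  · simp only [Y, hk, false_and, if_false, true_and]
    by_cases h0 : k < d 0
    · right
      rintro _ ⟨n, rfl⟩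
      exact h0.trans_le (hd.monotone (Nat.zero_le n))
    · left
      rcases (not_lt.1 h0).eq_or_lt with rfl | h1
      · rw [hg0 _ le_rfl]
        by_contra h2
        simpa using place_supp _ _ _ h2
      · obtain ⟨n, hn1, hn2⟩ : ∃ n, d n < k ∧ k ≤ d (n + 1) := by
          have hex : ∃ n, k ≤ d (n + 1) := ⟨k, (Nat.le_succ k).trans (hd.id_le (k + 1))⟩
          refine ⟨Nat.find hex, ?_, Nat.find_spec hex⟩
          rcases hn : Nat.find hex with _ | m
          · exact h1
          · exact not_le.1 (Nat.find_min hex (show m < Nat.find hex by omega))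
        rw [hg1 n k hn1 hn2]
        by_contra h2
        have := (hF n k).1 (place_supp _ _ k h2)
        exact hk (hin n k hn1 this.2.2)

theorem exists_infinite_const {T : Type*} {Z : Set ℕ} (hZ : Z.Infinite) {s : Set T} (hs : s.Finite)
    {f : ℕ → T} (hf : ∀ d ∈ Z, f d ∈ s) :
    ∃ τ, ∃ Z', Z' ⊆ Z ∧ Z'.Infinite ∧ ∀ d ∈ Z', f d = τ := by
  by_contra! h
  refine hZ ((hs.biUnion (t := fun τ => {d | d ∈ Z ∧ f d = τ}) fun τ _ => ?_).subset fun d hd =>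
    Set.mem_biUnion (hf d hd) ⟨hd, rfl⟩)
  by_contra hinf
  obtain ⟨d, hd, hne⟩ := h τ _ (fun d hd => hd.1) hinf
  exact hne hd.2

theorem Bdd.exists_content {W : Set ℕ} (h : Bdd D W) :
    ∃ K, ∀ d, (W ∩ Set.Ico (d + 1) (nxt D d)).ncard ≤ K := by
  obtain ⟨K, hK⟩ := h
  refine ⟨K, fun d => hK _ _ fun j hj hlt => ?_⟩
  have := nxt_le hj (show d < j by omega)
  omega

theorem Bdd.exists_finite_content [Finite A] {W : Set ℕ} (h : Bdd D W) :
    ∃ s : Set (List A), s.Finite ∧ ∀ y, Supp e y W → ∀ d, content e D y d ∈ s := by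
  obtain ⟨K, hK⟩ := h.exists_content (D := D)
  exact ⟨_, List.finite_length_le A K, fun y hy d => (length_red_le hy _ _).trans (hK d)⟩

/-- Only finitely many pairs of contents occur, so `P`, the blocks with equivalent contents, is a
finite union of replaceable sets. An infinite set outside `P` has infinitely many blocks with one
constant pair of contents. Far enough out these leave room for any context, so replaceability would
make the pair equivalent. -/
theorem Bdd.replaceProp [Finite A] (hL : IsNeutralLetter L e) (hD : D.Infinite) {W : Set ℕ}
    (h : Bdd D W) : ReplaceProp L e D W := by
  intro u v hu hv
  obtain ⟨s, hs, hsc⟩ := h.exists_finite_content (e := e)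
  refine ⟨{d | d ∈ D ∧ contextSetoid L e (content e D u d) (content e D v d) ∧
    factorSetoid L e (content e D u d) (content e D v d)}, fun d hd => hd.1, ?_, ?_⟩
  · refine (Replaceable.biUnion hD (hs.prod hs) (Z := fun τ => {d | d ∈ D ∧
        contextSetoid L e (content e D u d) (content e D v d) ∧
        factorSetoid L e (content e D u d) (content e D v d) ∧
        content e D u d = τ.1 ∧ content e D v d = τ.2}) (fun τ _ d hd => hd.1)
        fun τ _ => ?_).mono fun d hd => ?_
    · rcases Set.eq_empty_or_nonempty {d | d ∈ D ∧
        contextSetoid L e (content e D u d) (content e D v d) ∧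
        factorSetoid L e (content e D u d) (content e D v d) ∧
        content e D u d = τ.1 ∧ content e D v d = τ.2} with hemp | ⟨d, hd⟩
      · rw [hemp]
        exact replaceable_of_const hL hD (τ := []) (σ := []) (by simp) (by simp) (by simp)
          (Setoid.refl' _ _) (Setoid.refl' _ _)
      · refine replaceable_of_const hL hD (fun d hd => hd.1) (fun d hd => hd.2.2.2.1)
          (fun d hd => hd.2.2.2.2) ?_ ?_
        · rw [← hd.2.2.2.1, ← hd.2.2.2.2]; exact hd.2.1
        · rw [← hd.2.2.2.1, ← hd.2.2.2.2]; exact hd.2.2.1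
    · exact Set.mem_biUnion (x := (content e D u d, content e D v d))
        ⟨hsc u hu d, hsc v hv d⟩ ⟨hd.1, hd.2.1, hd.2.2, rfl, rfl⟩
  · intro Z hZ hZinf hZP hrep
    obtain ⟨⟨τ, σ⟩, Z', hZ', hinf, hc⟩ := exists_infinite_const hZinf (hs.prod hs)
      (f := fun d => (content e D u d, content e D v d)) fun d _ => ⟨hsc u hu d, hsc v hv d⟩
    simp only [Prod.mk.injEq] at hc
    have hrep' := hrep.mono hZ'
    have hZ'D := hZ'.trans hZ
    obtain ⟨d, hd⟩ := hinf.nonempty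
    refine hZP d (hZ' hd) ⟨hZ'D hd, ?_, ?_⟩
    · rw [(hc d hd).1, (hc d hd).2]
      intro s w
      -- A block far enough to the right that `s` fits before it; its contents are still `τ` and
      -- `σ`.
      obtain ⟨d', hd', hlt⟩ := hinf.exists_gt s.length
      have := hrep'.accS_append hL hD hd' hlt.le w
      rwa [(hc d' hd').1, (hc d' hd').2] at this
    · rw [(hc d hd).1, (hc d hd).2]
      intro s t
      obtain ⟨d, hmono, hge, hd, hgap⟩ := exists_strictMono_seq (p := fun _ d => d ∈ Z')
        (fun _ N => (hinf.exists_gt N).imp fun d hd => ⟨hd.2.le, hd.1⟩) s.length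
        (fun n d => nxt D d + (t n).length)
      have := hrep'.accS hL hD hZ'D hmono hd hge hgap
      simpa only [fun n => (hc _ (hd n)).1, fun n => (hc _ (hd n)).2] using this

/-- As for `ReplaceProp`, with the size of `C` in the block as a third quantity to be made constant.
The constant size is the bound in `LimEquiv`. -/
theorem Bdd.limReplaceProp [Finite A] (hL : IsNeutralLetter L e) (hD : D.Infinite) {W : Set ℕ}
    (h : Bdd D W) : LimReplaceProp L e D W := by
  intro u v C hu hv hCW hC
  obtain ⟨s, hs, hsc⟩ := h.exists_finite_content (e := e)
  obtain ⟨K, hK⟩ := h.exists_content (D := D)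
  let size : ℕ → ℕ := fun d => (C ∩ Set.Ico (d + 1) (nxt D d)).ncard
  have hsize : ∀ d, size d ∈ Set.Iic K := fun d =>
    (Set.ncard_le_ncard (Set.inter_subset_inter_left _ hCW)
      ((Set.finite_Ico _ _).inter_of_right W)).trans (hK d)
  have hconst : ∀ Z : Set ℕ, Z.Infinite → ∃ τ σ c, ∃ Z', Z' ⊆ Z ∧ Z'.Infinite ∧
      ∀ d ∈ Z', content e D u d = τ ∧ content e D v d = σ ∧ size d = c := fun Z hZ => by
    obtain ⟨⟨τ, σ, c⟩, Z', hZ', hinf, hc⟩ :=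
      exists_infinite_const hZ (hs.prod (hs.prod (Set.finite_Iic K)))
        (f := fun d => (content e D u d, content e D v d, size d))
        fun d _ => ⟨hsc u hu d, hsc v hv d, hsize d⟩
    exact ⟨τ, σ, c, Z', hZ', hinf, fun d hd => by simpa only [Prod.mk.injEq] using hc d hd⟩
  refine ⟨{d | d ∈ D ∧ LimEquiv L e (size d) (content e D u d) (content e D v d)},
    fun d hd => hd.1, fun Z hZ hinf => ?_, fun Z hZ hinf hZP hrep => ?_⟩
  · obtain ⟨τ, σ, c, Z', hZ', hinf', hc⟩ := hconst Z hinf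
    obtain ⟨d, hd⟩ := hinf'.nonempty
    have := (hZ (hZ' hd)).2
    rw [(hc d hd).1, (hc d hd).2.1, (hc d hd).2.2] at this
    exact ⟨Z', hZ', hinf', limReplaceable_of_const hL hD (fun d hd => (hZ (hZ' hd)).1) hC
      (fun d hd => (hc d hd).1) (fun d hd => (hc d hd).2.1) (fun d hd => (hc d hd).2.2.le) this⟩
  · obtain ⟨τ, σ, c, Z', hZ', hinf', hc⟩ := hconst Z hinf
    obtain ⟨d, hd⟩ := hinf'.nonempty
    refine hZP d (hZ' hd) ⟨hZ (hZ' hd), ?_⟩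
    rw [(hc d hd).1, (hc d hd).2.1, (hc d hd).2.2]
    intro s t ht
    obtain ⟨d, hd, hr⟩ := exists_strictMono_range hinf'
    have hdZ : ∀ n, d n ∈ Z' := fun n => hr ▸ ⟨n, rfl⟩
    -- Skipping the first `s.length` blocks leaves room for `s`.
    have := (hrep.mono hZ').accS hL hD hC (hZ'.trans hZ) (d := fun n => d (n + s.length))
      (fun _ _ h => hd (Nat.add_lt_add_right h _)) (fun n => hdZ _) (s := s) (t := t)
      (by simpa using hd.id_le s.length) (fun n => (ht n).trans (hc _ (hdZ _)).2.2.ge)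
    simpa only [fun n => (hc _ (hdZ n)).1, fun n => (hc _ (hdZ n)).2.1] using this

/-- By pigeonhole, infinitely many blocks in `S` have the same content under `w`. Moving it from one
of these to another leaves the letters of the zone other than `e` unchanged. -/
theorem Bdd.moveProp [Finite A] (hL : IsNeutralLetter L e) (hD : D.Infinite) {W : Set ℕ}
    (h : Bdd D W) : MoveProp L e D W := by
  intro w hw S hS hSinf
  obtain ⟨s, hs, hsc⟩ := h.exists_finite_content (e := e)
  obtain ⟨τ, Y, hY, hinf, hc⟩ := exists_infinite_const hSinf hs
    (f := fun d => content e D w d) fun d _ => hsc w hw d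
  refine ⟨Y, hY, hinf, fun E O hE hO ⟨hEO, hE', hO'⟩ y z h1 h2 => ?_⟩
  have hED := hE.trans (hY.trans hS)
  have hOD := hO.trans (hY.trans hS)
  simp only [InZone, before_iff hD, inBlock_iff hD] at h1 h2
  -- The cut points are the positions not strictly inside a zone. From the start of a zone the chain
  -- jumps to its end; elsewhere it advances by one letter.
  refine mem_iff_of_chain hL (fun n => ∀ x ∈ E, ∀ x' ∈ O, NextIn E O x x' →
    n ≤ x ∨ nxt D x' ≤ n) (fun x _ x' _ _ => Or.inl (Nat.zero_le _)) fun n hn => ?_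
  by_cases hnE : n ∈ E
  · obtain ⟨x', hx', hnx⟩ := hE' n hnE
    have hlt := hnx.1
    have hxn := (nxt_spec hD x').2
    have hnn : nxt D n ≤ x' := nxt_le (hOD hx') hlt
    have hnn' := (nxt_spec hD n).2
    have hzone : ∀ k, n ≤ k → k < nxt D x' → ((n < k ∧ k < nxt D n → y k = w k) ∧
        (¬ (n < k ∧ k < nxt D n) → y k = e) ∧ (x' < k → z k = w k) ∧ (k ≤ x' → z k = e)) := by
      intro k hk hk'
      obtain ⟨a1, a2, a3, a4⟩ := h1 k ⟨n, hnE, x', hx', hnx, hk, hk'⟩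
      refine ⟨fun h => a1 ⟨n, hnE, h⟩, fun h => a2 ?_, fun h => a3 ⟨x', hx', h, hk'⟩,
        fun h => a4 ?_⟩
      · rintro ⟨d, hd, hdk, hdk'⟩
        rcases lt_trichotomy d n with h3 | rfl | h3
        · have := nxt_le (hED hnE) h3
          omega
        · exact h ⟨hdk, hdk'⟩
        · have h4 := hnx.2 d (Or.inl hd)
          have h5 : d ≠ x' := fun h6 => hEO d hd (h6 ▸ hx')
          have := nxt_le (hED hd) (show x' < d by omega)
          omega
      · rintro ⟨d, hd, hdk, hdk'⟩
        rcases lt_trichotomy d n with h3 | rfl | h3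
        · have := nxt_le (hED hnE) h3
          omega
        · exact hEO d hnE hd
        · have h4 := hnx.2 d (Or.inr hd)
          omega
    refine ⟨nxt D x', by omega, fun a ha a' ha' haa => ?_, ?_⟩
    · rcases lt_trichotomy a n with h3 | rfl | h3
      · have h4 := haa.2 n (Or.inl hnE)
        have h5 : a' ≠ n := fun h6 => hEO n hnE (h6 ▸ ha')
        right
        have := nxt_le (hED hnE) (show a' < n by omega)
        omega
      · have h4 := haa.2 x' (Or.inr hx')
        have h5 := hnx.2 a' (Or.inr ha')
        have h6 := haa.1
        have : a' = x' := by omega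
        right
        rw [this]
      · left
        have h4 := hnx.2 a (Or.inl ha)
        have h5 : a ≠ x' := fun h6 => hEO a ha (h6 ▸ hx')
        exact nxt_le (hED ha) (by omega)
    · rw [← red_append y (show n ≤ n + 1 by omega) (show n + 1 ≤ nxt D x' by omega),
        ← red_append y (show n + 1 ≤ nxt D n by omega) (show nxt D n ≤ nxt D x' by omega),
        ← red_append z (show n ≤ x' + 1 by omega) (show x' + 1 ≤ nxt D x' by omega),
        red_eq_nil (y := y) (a := n), red_eq_nil (y := y) (a := nxt D n),
        red_eq_nil (y := z) (a := n), List.nil_append, List.append_nil, List.nil_append,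
        red_congr (y := y) (z := w), red_congr (y := z) (z := w)]
      · exact (hc n (hE hnE)).trans (hc x' (hO hx')).symm
      · intro k a1 a2
        exact (hzone k (by omega) a2).2.2.1 a1
      · intro k a1 a2
        exact (hzone k (by omega) (by omega)).1 ⟨a1, a2⟩
      · intro k a1 a2
        exact (hzone k a1 (by omega)).2.2.2 (by omega)
      · intro k a1 a2
        exact (hzone k (by omega) a2).2.1 (by omega)
      · intro k a1 a2
        exact (hzone k a1 (by omega)).2.1 (by omega)
  · refine ⟨n + 1, Nat.lt_succ_self n, fun x hx x' hx' hxx => ?_, red_congr fun k a1 a2 => ?_⟩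
    · rcases hn x hx x' hx' hxx with h3 | h3
      · left
        have : x ≠ n := fun h4 => hnE (h4 ▸ hx)
        omega
      · right
        omega
    · obtain rfl : k = n := by omega
      refine h2 k ?_
      rintro ⟨x, hx, x', hx', hxx, h3, h4⟩
      rcases hn x hx x' hx' hxx with h5 | h5
      · exact hnE ((show x = k by omega) ▸ hx)
      · omega

end Bounded

/-! ### Unbounded blocks with one of the two replacement properties -/

section Unbounded

variable {A : Type u} {L : OmegaLanguage A} {e : A} {D W : Set ℕ}

theorem exists_large_block (hD : D.Infinite) (hW : ¬ Bdd D W) (k N : ℕ) :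
    ∃ d, N ≤ d ∧ d ∈ D ∧ k ≤ (W ∩ Set.Ico (d + 1) (nxt D d)).ncard := by
  classical
  obtain ⟨d₀, hd₀, hN⟩ := hD.exists_gt N
  simp only [Bdd, not_exists, not_forall, not_le] at hW
  -- There are `d₀ + 1` positions up to `d₀`, so an interval with more than `k + d₀ + 1` elements of
  -- `W` must extend past `d₀`. Being free of `D`, it lies after `d₀` and inside one block.
  obtain ⟨a, b, hab, hlt⟩ := hW (k + d₀ + 1)
  have hb : d₀ < b := by
    by_contra hb
    have h1 : (W ∩ Set.Ico a b).ncard ≤ (Set.Iio (d₀ + 1)).ncard :=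
      Set.ncard_le_ncard (fun x hx => by
        have := hx.2.2
        simp only [Set.mem_Iio]
        omega) (Set.finite_Iio _)
    rw [← Finset.coe_Iio, Set.ncard_coe_finset, Nat.card_Iio] at h1
    omega
  have ha : d₀ < a := by
    have := hab d₀ hd₀
    omega
  let d := Nat.findGreatest (· ∈ D) (a - 1)
  have hd : d ∈ D := Nat.findGreatest_spec (P := (· ∈ D)) (m := d₀) (by omega) hd₀
  have hd₀d : d₀ ≤ d := Nat.le_findGreatest (by omega) hd₀
  have hda : d ≤ a - 1 := Nat.findGreatest_le _
  have hn := nxt_spec hD d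
  have hna : a ≤ nxt D d := by
    by_contra h
    have := Nat.le_findGreatest (P := (· ∈ D)) (n := a - 1) (by omega) hn.1
    have : nxt D d ≤ d := this
    omega
  have hnb : b ≤ nxt D d := by
    have := hab _ hn.1
    omega
  refine ⟨d, by omega, hd, ?_⟩
  have : (W ∩ Set.Ico a b).ncard ≤ (W ∩ Set.Ico (d + 1) (nxt D d)).ncard :=
    Set.ncard_le_ncard (fun x hx => ⟨hx.1, by
      have := hx.2.1
      have := hx.2.2
      constructor <;> omega⟩) ((Set.finite_Ico _ _).inter_of_right W)
  omega

/-- A sequence of blocks that are large enough, with large enough gaps. -/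
theorem exists_large_blocks (hD : D.Infinite) (hW : ¬ Bdd D W) (l gap : ℕ → ℕ) :
    ∃ (d : ℕ → ℕ) (F : ℕ → Finset ℕ), StrictMono d ∧ (∀ n, d n ∈ D) ∧
      (∀ n, nxt D (d n) + gap n ≤ d (n + 1)) ∧
      (∀ n, ∀ k ∈ F n, k ∈ W ∧ d n < k ∧ k < nxt D (d n)) ∧ ∀ n, (F n).card = l n := by
  obtain ⟨d, hd, -, hdp, hgap⟩ := exists_strictMono_seq
    (fun n N => exists_large_block hD hW (l n) N) 0 (fun n d => nxt D d + gap n)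
  have hF : ∀ n, ∃ F : Finset ℕ, (∀ k ∈ F, k ∈ W ∧ d n < k ∧ k < nxt D (d n)) ∧ F.card = l n := by
    intro n
    have hfin := (Set.finite_Ico (d n + 1) (nxt D (d n))).inter_of_right W
    have h := (hdp n).2
    rw [Set.ncard_eq_toFinset_card _ hfin] at h
    obtain ⟨F, hF, hc⟩ := Finset.exists_subset_card_eq h
    refine ⟨F, fun k hk => ?_, hc⟩
    have := hF hk
    rw [Set.Finite.mem_toFinset] at this
    exact ⟨this.1, this.2.1, this.2.2⟩
  choose F hF hc using hF
  exact ⟨d, F, hd, fun n => (hdp n).1, hgap, hF, hc⟩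

open Classical in
/-- Words are placed in blocks. -/
theorem exists_host {d : ℕ → ℕ} (hd : StrictMono d) (hdD : ∀ n, d n ∈ D) {F : ℕ → Finset ℕ}
    (hF : ∀ n, ∀ k ∈ F n, d n < k ∧ k < nxt D (d n)) {u : ℕ → List A}
    (hu : ∀ n, (u n).length ≤ (F n).card) :
    ∃ y : OmegaWord A, (∀ k, y k ≠ e → ∃ n, k ∈ F n) ∧
      ∀ n, content e D y (d n) = (u n).filter (· ≠ e) := by
  obtain ⟨y, hy⟩ := exists_glue (p := fun n => if n = 0 then 0 else d (n - 1) + 1)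
    (strictMono_nat_of_lt_succ fun n => by
      rcases n with _ | n
      · simp
      · simpa using hd (Nat.lt_succ_self n))
    (fun n => if n = 0 then fun _ => e else place e (F (n - 1)) (u (n - 1)))
  have hy1 : ∀ n k, d n < k → k ≤ d (n + 1) → y k = place e (F n) (u n) k := fun n k hk hk' =>
    hy (n + 1) k (by simpa using hk) (by simpa [Nat.lt_succ_iff] using hk')
  refine ⟨y, fun k hk => ?_, fun n => ?_⟩
  · by_cases h0 : k ≤ d 0
    · exact absurd (hy 0 k (by simp) (by simpa [Nat.lt_succ_iff] using h0)) hk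
    · have hex : ∃ n, k ≤ d (n + 1) := ⟨k, (Nat.le_succ k).trans (hd.id_le (k + 1))⟩
      have h1 : d (Nat.find hex) < k := by
        rcases hn : Nat.find hex with _ | m
        · exact not_le.1 h0
        · exact not_le.1 (Nat.find_min hex (show m < Nat.find hex by omega))
      rw [hy1 _ _ h1 (Nat.find_spec hex)] at hk
      exact ⟨_, place_supp _ _ k hk⟩
  · rw [← red_place (e := e) (F := F n) (l := u n) (hF n) (hu n)]
    refine red_congr fun k h1 h2 => hy1 n k h1 ?_
    have := nxt_le (hdD (n + 1)) (hd (Nat.lt_succ_self n))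
    omega

open Classical in
theorem contextSetoid_filter (hL : IsNeutralLetter L e) (u : List A) :
    contextSetoid L e (u.filter (· ≠ e)) u := fun s _ =>
  accS_congr hL (by rw [List.filter_append, List.filter_append, List.filter_filter]; simp)
    fun _ => rfl

open Classical in
theorem accS_filter (hL : IsNeutralLetter L e) (s : List A) (u t : ℕ → List A) :
    AccS L e s (fun n => (u n).filter (· ≠ e) ++ t n) ↔ AccS L e s (fun n => u n ++ t n) :=
  accS_congr hL rfl fun n => by
    rw [List.filter_append, List.filter_append, List.filter_filter]; simp

theorem infinite_unpair (n N : ℕ) : {i | N ≤ i ∧ (Nat.unpair i).1 = n}.Infinite :=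
  Set.infinite_of_forall_exists_gt fun a => ⟨Nat.pair n (max (a + 1) N),
    ⟨(le_max_right _ _).trans (Nat.right_le_pair _ _), by simp⟩,
    (le_max_left _ _).trans (Nat.right_le_pair _ _)⟩

/-- Each pair `u n`, `v n` is hosted by infinitely many blocks. For fixed `n` any infinite set of
these is replaceable, so `P` contains infinitely many of them. Choosing one block of `P` for each
`n` in increasing order and replacing all of them turns `u` into `v`. -/
theorem accS_of_replaceProp (hL : IsNeutralLetter L e) (hD : D.Infinite) (hW : ¬ Bdd D W)
    (hprop : ReplaceProp L e D W) {u v : ℕ → List A} (h : ∀ n, contextSetoid L e (u n) (v n))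
    (h' : ∀ n, factorSetoid L e (u n) (v n)) (s : List A) (hs : AccS L e s u) :
    AccS L e s v := by
  classical
  let σ : ℕ → ℕ := fun i => (Nat.unpair i).1
  obtain ⟨d, F, hd, hdD, -, hF, hc⟩ := exists_large_blocks hD hW
    (fun i => max (u (σ i)).length (v (σ i)).length) 0
  obtain ⟨U, hU, hU'⟩ := exists_host (e := e) hd hdD (fun n k hk => (hF n k hk).2)
    (u := fun i => u (σ i)) (fun i => (hc i).symm ▸ le_max_left _ _)
  obtain ⟨V, hV, hV'⟩ := exists_host (e := e) hd hdD (fun n k hk => (hF n k hk).2)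
    (u := fun i => v (σ i)) (fun i => (hc i).symm ▸ le_max_right _ _)
  obtain ⟨P, hPD, hP, hPmax⟩ := hprop U V
    (fun k hk => (hU k hk).elim fun n hn => (hF n k hn).1)
    (fun k hk => (hV k hk).elim fun n hn => (hF n k hn).1)
  have key : ∀ n N, ∃ i, N ≤ i ∧ σ i = n ∧ d i ∈ P := by
    intro n N
    by_contra! hcon
    have hsub : d '' {i | N ≤ i ∧ σ i = n} ⊆ D := by rintro _ ⟨i, -, rfl⟩; exact hdD i
    refine hPmax (d '' {i | N ≤ i ∧ σ i = n}) hsub ?_ ?_ ?_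
    · exact (infinite_unpair n N).image hd.injective.injOn
    · rintro _ ⟨i, hi, rfl⟩
      exact hcon i hi.1 hi.2
    · refine replaceable_of_const hL hD hsub (τ := (u n).filter (· ≠ e))
        (σ := (v n).filter (· ≠ e)) ?_ ?_ ?_ fun s t => ?_
      · rintro _ ⟨i, ⟨-, rfl⟩, rfl⟩
        exact hU' i
      · rintro _ ⟨i, ⟨-, rfl⟩, rfl⟩
        exact hV' i
      · exact Setoid.trans' _ (contextSetoid_filter hL _)
          (Setoid.trans' _ (h n) (Setoid.symm' _ (contextSetoid_filter hL _)))
      · rw [accS_filter hL, accS_filter hL]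
        exact h' n s t
  obtain ⟨i, hi, hi0, hip, -⟩ := exists_strictMono_seq key s.length 0
  have := hP.accS hL hD hPD (d := fun n => d (i n)) (hd.comp hi) (fun n => (hip n).2) (s := s)
    (t := fun _ => []) (hi0.trans (hd.id_le _))
    (fun n => by simpa using nxt_le (hdD _) (hd (hi (Nat.lt_succ_self n))))
  simp only [hU', hV', fun n => (hip n).1] at this
  rw [accS_filter hL, accS_filter hL] at this
  simpa using this.1 (by simpa using hs)

/-- Words with a space of the given size after each of them are placed infinitely often. -/
theorem exists_lim_host (hD : D.Infinite) (hW : ¬ Bdd D W) (u v : ℕ → List A) (c : ℕ → ℕ) :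
    ∃ (d : ℕ → ℕ) (C : Set ℕ) (U V : OmegaWord A), StrictMono d ∧ (∀ i, d i ∈ D) ∧ C ⊆ W ∧
      Supp e U W ∧ Supp e V W ∧ ComesAfter e D C U V ∧ open Classical in
      ∀ i, content e D U (d i) = (u (Nat.unpair i).1).filter (· ≠ e) ∧
        content e D V (d i) = (v (Nat.unpair i).1).filter (· ≠ e) ∧
        (C ∩ Set.Ico (d i + 1) (nxt D (d i))).ncard = c (Nat.unpair i).1 := by
  classical
  let σ : ℕ → ℕ := fun i => (Nat.unpair i).1
  let m : ℕ → ℕ := fun i => max (u (σ i)).length (v (σ i)).length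
  obtain ⟨d, F, hd, hdD, -, hF, hc⟩ := exists_large_blocks hD hW (fun i => m i + c (σ i)) 0
  -- The positions available in a block are split: `G` for the letters of the two words, and `H`
  -- after it for `C`.
  have hsplit : ∀ i, ∃ G H : Finset ℕ, G ⊆ F i ∧ H ⊆ F i ∧ G.card = m i ∧ H.card = c (σ i) ∧
      ∀ a ∈ G, ∀ b ∈ H, a < b := by
    intro i
    let f := (F i).orderEmbOfFin (hc i)
    refine ⟨Finset.univ.map ((Fin.castAddEmb _).trans f.toEmbedding),
      Finset.univ.map ((Fin.natAddEmb _).trans f.toEmbedding), ?_, ?_, by simp, by simp, ?_⟩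
    · intro a ha
      simp only [Finset.mem_map, Finset.mem_univ, true_and] at ha
      obtain ⟨j, rfl⟩ := ha
      exact Finset.orderEmbOfFin_mem _ (hc i) _
    · intro a ha
      simp only [Finset.mem_map, Finset.mem_univ, true_and] at ha
      obtain ⟨j, rfl⟩ := ha
      exact Finset.orderEmbOfFin_mem _ (hc i) _
    · intro a ha b hb
      simp only [Finset.mem_map, Finset.mem_univ, true_and] at ha hb
      obtain ⟨j, rfl⟩ := ha
      obtain ⟨l, rfl⟩ := hb
      exact f.strictMono (Fin.lt_def.2 (by simp; omega))
  choose G H hG hH hGc hHc hGH using hsplit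
  obtain ⟨U, hU, hU'⟩ := exists_host (e := e) hd hdD (fun n k hk => (hF n k (hG n hk)).2)
    (u := fun i => u (σ i)) (fun i => (hGc i).symm ▸ le_max_left _ _)
  obtain ⟨V, hV, hV'⟩ := exists_host (e := e) hd hdD (fun n k hk => (hF n k (hG n hk)).2)
    (u := fun i => v (σ i)) (fun i => (hGc i).symm ▸ le_max_right _ _)
  refine ⟨d, {k | ∃ i, k ∈ H i}, U, V, hd, hdD, ?_, ?_, ?_, ?_, fun i => ⟨hU' i, hV' i, ?_⟩⟩
  · rintro k ⟨i, hi⟩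
    exact (hF i k (hH i hi)).1
  · exact fun k hk => (hU k hk).elim fun n hn => (hF n k (hG n hn)).1
  · exact fun k hk => (hV k hk).elim fun n hn => (hF n k (hG n hn)).1
  · rintro a ha j k haj hak hj hk ⟨n, hn⟩ hne
    rw [before_iff hD] at hj hk
    obtain ⟨l, hl⟩ : ∃ l, j ∈ G l := hne.elim (hU j) (hV j)
    have h1 := (hF n k (hH n hn)).2
    have h2 := (hF l j (hG l hl)).2
    have h3 := block_unique ha (hdD n) hak hk h1.1 h1.2
    have h4 := block_unique ha (hdD l) haj hj h2.1 h2.2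
    obtain rfl := hd.injective (h3.symm.trans h4)
    exact hGH n j hl k hn
  · rw [← hHc i, ← Set.ncard_coe_finset]
    congr 1
    ext k
    constructor
    · rintro ⟨⟨n, hn⟩, h1, h2⟩
      have h3 := (hF n k (hH n hn)).2
      have := block_unique (hdD i) (hdD n) h1 h2 h3.1 h3.2
      exact hd.injective this ▸ hn
    · intro hk
      exact ⟨⟨i, hk⟩, (hF i k (hH i hk)).2⟩

/-- The same two words are hosted with ever larger rooms `c n`, each room size infinitely often. By
`LimEquiv` with bound `c n`, the set `P` contains infinitely many blocks for each size. A
replaceable subset of a selection with increasing sizes accommodates all of `t`. -/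
theorem factorSetoid_of_limReplaceProp (hL : IsNeutralLetter L e) (hD : D.Infinite)
    (hW : ¬ Bdd D W) (hprop : LimReplaceProp L e D W) {u v : List A}
    (h : ∀ c, LimEquiv L e c u v) : factorSetoid L e u v := by
  classical
  intro s t
  -- Cumulative lengths: after thinning, `t k` goes to a block with index `φ k ≥ k`, whose room must
  -- still suffice.
  let c : ℕ → ℕ := fun n => ∑ j ∈ Finset.range (n + 1), (t j).length
  have hc : ∀ {k n}, k ≤ n → (t k).length ≤ c n := fun {k n} hk =>
    Finset.single_le_sum (f := fun j => (t j).length) (fun _ _ => Nat.zero_le _)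
      (Finset.mem_range.2 (Nat.lt_succ_of_le hk))
  obtain ⟨d, C, U, V, hd, hdD, hCW, hU, hV, hC, hcont⟩ :=
    exists_lim_host (e := e) hD hW (fun _ => u) (fun _ => v) c
  obtain ⟨P, hPD, hP, hPmax⟩ := hprop U V C hU hV hCW hC
  have key : ∀ n N, ∃ i, N ≤ i ∧ (Nat.unpair i).1 = n ∧ d i ∈ P := by
    intro n N
    by_contra! hcon
    have hsub : d '' {i | N ≤ i ∧ (Nat.unpair i).1 = n} ⊆ D := by
      rintro _ ⟨i, -, rfl⟩; exact hdD i
    refine hPmax (d '' {i | N ≤ i ∧ (Nat.unpair i).1 = n}) hsub ?_ ?_ ?_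
    · exact (infinite_unpair n N).image hd.injective.injOn
    · rintro _ ⟨i, hi, rfl⟩
      exact hcon i hi.1 hi.2
    · refine limReplaceable_of_const hL hD hsub hC (c := c n) (τ := u.filter (· ≠ e))
        (σ := v.filter (· ≠ e)) ?_ ?_ ?_ fun s t ht => ?_
      · rintro _ ⟨i, -, rfl⟩
        exact (hcont i).1
      · rintro _ ⟨i, -, rfl⟩
        exact (hcont i).2.1
      · rintro _ ⟨i, ⟨-, rfl⟩, rfl⟩
        exact (hcont i).2.2.le
      · rw [accS_filter hL, accS_filter hL]
        exact h _ s t ht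
  obtain ⟨i, hi, hi0, hip, -⟩ := exists_strictMono_seq key s.length 0
  obtain ⟨Z, hZ, hZinf, hrep⟩ := hP (Set.range fun n => d (i n))
    (by rintro _ ⟨n, rfl⟩; exact (hip n).2)
    (Set.infinite_range_of_injective (hd.comp hi).injective)
  have hIinf : {n | d (i n) ∈ Z}.Infinite := by
    intro hfin
    refine hZinf ((hfin.image fun n => d (i n)).subset fun a ha => ?_)
    obtain ⟨n, rfl⟩ := hZ ha
    exact ⟨n, ha, rfl⟩
  obtain ⟨φ, hφ, hφr⟩ := exists_strictMono_range hIinf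
  have hφZ : ∀ k, d (i (φ k)) ∈ Z := fun k => by
    have : φ k ∈ {n | d (i n) ∈ Z} := hφr ▸ ⟨k, rfl⟩
    exact this
  have := hrep.accS hL hD hC (fun a ha => by obtain ⟨n, rfl⟩ := hZ ha; exact hdD _)
    (d := fun k => d (i (φ k))) (hd.comp (hi.comp hφ)) hφZ (s := s) (t := t)
    (hi0.trans ((hi.monotone (Nat.zero_le _)).trans (hd.id_le _)))
    (fun k => by
      rw [(hcont _).2.2, (hip _).1]
      exact hc (hφ.id_le k))
  simp only [fun k => (hcont (i (φ k))).1, fun k => (hcont (i (φ k))).2.1] at this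
  rwa [accS_filter hL, accS_filter hL] at this

/-- If `P` contained infinitely many of the blocks for some `n`, a replaceable infinite subset of
them would give `LimEquiv` with bound `c n`. So every `n` has arbitrarily late blocks outside `P`.
One such block for each `n` gives a set that is not replaceable, and the failure on an infinite
subset is a single context separating a whole subsequence of pairs. -/
theorem exists_distinguishing_context (hL : IsNeutralLetter L e) (hD : D.Infinite)
    (hW : ¬ Bdd D W) (hprop : LimReplaceProp L e D W) {u v : ℕ → List A} {c : ℕ → ℕ}
    (h : ∀ n, ¬ LimEquiv L e (c n) (u n) (v n)) :
    ∃ (φ : ℕ → ℕ) (s : List A) (t : ℕ → List A), StrictMono φ ∧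
      (∀ n, (t n).length ≤ c (φ n)) ∧
      ¬ (AccS L e s (fun n => u (φ n) ++ t n) ↔ AccS L e s (fun n => v (φ n) ++ t n)) := by
  classical
  obtain ⟨d, C, U, V, hd, hdD, hCW, hU, hV, hC, hcont⟩ := exists_lim_host (e := e) hD hW u v c
  obtain ⟨P, hPD, hP, hPmax⟩ := hprop U V C hU hV hCW hC
  have key : ∀ n N, ∃ i, N ≤ i ∧ (Nat.unpair i).1 = n ∧ d i ∉ P := by
    intro n N
    by_contra! hcon
    have hsub : d '' {i | N ≤ i ∧ (Nat.unpair i).1 = n} ⊆ P := by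
      rintro _ ⟨i, hi, rfl⟩
      exact hcon i hi.1 hi.2
    obtain ⟨Z, hZ, hZinf, hrep⟩ := hP _ hsub ((infinite_unpair n N).image hd.injective.injOn)
    have hZn : ∀ a ∈ Z, ∃ i, (Nat.unpair i).1 = n ∧ d i = a := fun a ha => by
      obtain ⟨i, hi, hi'⟩ := hZ ha
      exact ⟨i, hi.2, hi'⟩
    have hZ' : ∀ a ∈ Z, content e D U a = (u n).filter (· ≠ e) ∧
        content e D V a = (v n).filter (· ≠ e) ∧
        (C ∩ Set.Ico (a + 1) (nxt D a)).ncard = c n := by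
      intro a ha
      obtain ⟨i, rfl, rfl⟩ := hZn a ha
      exact hcont i
    refine h n fun s t ht => ?_
    obtain ⟨f, hf, hf0, hfZ, -⟩ := exists_strictMono_seq (p := fun _ a => a ∈ Z)
      (fun _ N => (hZinf.exists_gt N).imp fun d hd => ⟨hd.2.le, hd.1⟩) s.length 0
    have := hrep.accS hL hD hC ((hZ.trans hsub).trans hPD) hf hfZ hf0 (t := t)
      (fun k => by rw [(hZ' _ (hfZ k)).2.2]; exact ht k)
    simp only [fun k => (hZ' _ (hfZ k)).1, fun k => (hZ' _ (hfZ k)).2.1] at this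
    rwa [accS_filter hL, accS_filter hL] at this
  obtain ⟨i, hi, -, hip, -⟩ := exists_strictMono_seq key 0 0
  have hnot := hPmax (Set.range fun n => d (i n)) (by rintro _ ⟨n, rfl⟩; exact hdD _)
    (Set.infinite_range_of_injective (hd.comp hi).injective)
    (by rintro _ ⟨n, rfl⟩; exact (hip n).2)
  simp only [LimReplaceable, not_forall] at hnot
  obtain ⟨X, hX, hXs, y, z, h1, h2, h3, hyz⟩ := hnot
  have hIinf : {n | d (i n) ∈ X}.Infinite := by
    intro hfin
    refine hX ((hfin.image fun n => d (i n)).subset fun a ha => ?_)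
    obtain ⟨n, rfl⟩ := hXs ha
    exact ⟨n, ha, rfl⟩
  obtain ⟨φ, hφ, hφr⟩ := exists_strictMono_range hIinf
  have hXr : X = Set.range fun k => d (i (φ k)) := by
    ext a
    constructor
    · intro ha
      obtain ⟨n, rfl⟩ := hXs ha
      have : n ∈ Set.range φ := hφr ▸ ha
      obtain ⟨k, rfl⟩ := this
      exact ⟨k, rfl⟩
    · rintro ⟨k, rfl⟩
      have : φ k ∈ {n | d (i n) ∈ X} := hφr ▸ ⟨k, rfl⟩
      exact this
  subst hXr
  obtain ⟨s, t, ht, hy, hz⟩ := exists_accS_of_lim hL hD hC (d := fun k => d (i (φ k)))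
    (hd.comp (hi.comp hφ)) (fun _ => hdD _) h1 h2 h3
  simp only [fun k => (hcont (i (φ k))).1, fun k => (hcont (i (φ k))).2.1,
    fun k => (hcont (i (φ k))).2.2, fun k => (hip (φ k)).1] at hy hz ht
  rw [accS_filter hL s (fun k => u (φ k))] at hy
  rw [accS_filter hL s (fun k => v (φ k))] at hz
  exact ⟨φ, s, t, hφ, ht, by rwa [← hy, ← hz]⟩

end Unbounded

/-! ### Finite index from moving contents, and the dichotomy -/

section Dichotomy

variable {A : Type u} {L : OmegaLanguage A} {e : A} {D W : Set ℕ}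

/-- The words are hosted in successive blocks, and `Y` contains two of these blocks. Moving one
content from the earlier block to the later one, in front of an arbitrary continuation `w`,
exchanges `u p` with `u q`. -/
theorem exists_prefixSetoid_of_moveProp (hL : IsNeutralLetter L e) (hD : D.Infinite)
    (hW : ¬ Bdd D W) (hprop : MoveProp L e D W) (u : ℕ → List A) :
    ∃ p q, p < q ∧ prefixSetoid L e (u p) (u q) := by
  classical
  obtain ⟨d, F, hd, hdD, -, hF, hc⟩ := exists_large_blocks hD hW (fun i => (u i).length) 0
  obtain ⟨U, hU, hU'⟩ := exists_host (e := e) hd hdD (fun n k hk => (hF n k hk).2)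
    (u := u) (fun i => (hc i).ge)
  obtain ⟨Y, hY, hinf, hmov⟩ := hprop U (fun k hk => (hU k hk).elim fun n hn => (hF n k hn).1)
    (Set.range d) (by rintro _ ⟨n, rfl⟩; exact hdD n)
    (Set.infinite_range_of_injective hd.injective)
  obtain ⟨a, ha⟩ := hinf.nonempty
  obtain ⟨b, hb, hab⟩ := hinf.exists_gt a
  obtain ⟨p, rfl⟩ := hY ha
  obtain ⟨q, rfl⟩ := hY hb
  refine ⟨p, q, hd.lt_iff_lt.1 hab, fun w => ?_⟩
  obtain ⟨x, r, hx⟩ := exists_realizes e w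
  have hn1 := (nxt_spec hD (d p)).2
  have hn2 := (nxt_spec hD (d q)).2
  have hle : nxt D (d p) ≤ d q := nxt_le (hdD q) hab
  -- `u i` alone, in its own block, followed by a word for `w` from the end of the later block on.
  let Y' : ℕ → OmegaWord A := fun i k => if k < nxt D (d q) then
    (if d i < k ∧ k < nxt D (d i) then U k else e) else x (k - nxt D (d q))
  have hY' : ∀ i, i ≤ q → (Y' i ∈ L ↔ AccS L e (u i) w) := by
    intro i hi
    have h1 := (nxt_spec hD (d i)).2
    have h2 : nxt D (d i) ≤ nxt D (d q) := by
      rcases hi.eq_or_lt with rfl | hlt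
      · rfl
      · exact (nxt_le (hdD q) (hd hlt)).trans hn2.le
    rw [mem_iff_accS_tail hL hx (m := nxt D (d q)) (by omega) fun k hk => if_neg (by omega)]
    refine accS_congr hL ?_ fun _ => rfl
    rw [filter_red, ← red_append _ (show 0 ≤ d i + 1 by omega) (show d i + 1 ≤ nxt D (d q) by omega),
      ← red_append _ (show d i + 1 ≤ nxt D (d i) by omega) h2, red_eq_nil (a := 0),
      red_eq_nil (a := nxt D (d i)), List.nil_append, List.append_nil, red_congr (z := U)]
    · exact hU' i
    · intro k h3 h4
      rw [if_pos (by omega), if_pos (by omega)]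
    · intro k h3 h4
      rw [if_pos (by omega), if_neg (by omega)]
    · intro k h3 h4
      rw [if_pos (by omega), if_neg (by omega)]
  rw [← hY' p (hd.lt_iff_lt.1 hab).le, ← hY' q le_rfl]
  have hnext : NextIn {d p} {d q} (d p) (d q) := ⟨hab, fun z hz => by
    simp only [Set.mem_singleton_iff] at hz
    omega⟩
  have hzone : ∀ k, InZone D {d p} {d q} k ↔ d p ≤ k ∧ k < nxt D (d q) := fun k => by
    simp only [InZone, before_iff hD, Set.mem_singleton_iff]
    constructor
    · rintro ⟨_, rfl, _, rfl, -, h1, h2⟩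
      exact ⟨h1, h2⟩
    · rintro ⟨h1, h2⟩
      exact ⟨_, rfl, _, rfl, hnext, h1, h2⟩
  have hblock : ∀ i k, InBlock D {d i} k ↔ d i < k ∧ k < nxt D (d i) := fun i k => by
    simp [inBlock_iff hD]
  refine hmov {d p} {d q} (by simpa using ha) (by simpa using hb) ⟨?_, ?_, ?_⟩ _ _
    (fun k hk => ?_) fun k hk => ?_
  · rintro _ rfl h
    exact hab.ne h
  · rintro _ rfl
    exact ⟨_, rfl, hnext⟩
  · rintro _ rfl
    exact ⟨_, rfl, hnext⟩
  · rw [hzone] at hk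
    simp only [hblock, Y', if_pos hk.2]
    exact ⟨fun h => if_pos h, fun h => if_neg h, fun h => if_pos h, fun h => if_neg h⟩
  · rw [hzone] at hk
    simp only [Y']
    by_cases h : k < nxt D (d q)
    · rw [if_pos h, if_pos h, if_neg (by omega), if_neg (by omega)]
    · rw [if_neg h, if_neg h]

theorem nextIn_range {a b : ℕ → ℕ} (hab : ∀ n, a n < b n) (hba : ∀ n, b n < a (n + 1)) :
    Alternate (Set.range a) (Set.range b) ∧
      ∀ n m, NextIn (Set.range a) (Set.range b) (a n) (b m) → m = n := by
  have ha : StrictMono a := strictMono_nat_of_lt_succ fun n => (hab n).trans (hba n)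
  have hb : StrictMono b := strictMono_nat_of_lt_succ fun n => (hba n).trans (hab _)
  have hba' : ∀ {n m}, n < m → b n < a m := fun {n m} h => (hba n).trans_le (ha.monotone h)
  have hab' : ∀ {n m}, n ≤ m → a n < b m := fun {n m} h => (hab n).trans_le (hb.monotone h)
  have hnext : ∀ n, NextIn (Set.range a) (Set.range b) (a n) (b n) := fun n => by
    refine ⟨hab n, ?_⟩
    rintro _ (⟨m, rfl⟩ | ⟨m, rfl⟩) ⟨h1, h2⟩
    · exact absurd (hba' (ha.lt_iff_lt.1 h1)) (by omega)
    · exact absurd (hba' (hb.lt_iff_lt.1 h2)) (by omega)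
  refine ⟨⟨?_, ?_, ?_⟩, fun n m h => ?_⟩
  · rintro _ ⟨n, rfl⟩ ⟨m, hm⟩
    rcases Nat.lt_or_ge m n with h | h
    · exact absurd (hba' h) (by omega)
    · exact absurd (hab' h) (by omega)
  · rintro _ ⟨n, rfl⟩
    exact ⟨b n, ⟨n, rfl⟩, hnext n⟩
  · rintro _ ⟨n, rfl⟩
    exact ⟨a n, ⟨n, rfl⟩, hnext n⟩
  · rcases lt_trichotomy m n with hlt | rfl | hlt
    · exact absurd (hba' hlt) (by have := h.1; omega)
    · rfl
    · exact absurd ⟨hab n, hb hlt⟩ (h.2 (b n) (Or.inr ⟨n, rfl⟩))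

/-- Moving contents realizes contexts. -/
theorem Movable.accS (hL : IsNeutralLetter L e) (hD : D.Infinite) {U : OmegaWord A} {Y : Set ℕ}
    (h : Movable L e D U Y) (hYD : Y ⊆ D) {a b : ℕ → ℕ} (ha : ∀ n, a n ∈ Y) (hb : ∀ n, b n ∈ Y)
    (hab : ∀ n, a n < b n) {s : List A} {t : ℕ → List A} (hs : s.length ≤ a 0)
    (ht : ∀ n, nxt D (b n) + (t n).length ≤ a (n + 1)) :
    AccS L e s (fun n => content e D U (a n) ++ t n) ↔
      AccS L e s (fun n => content e D U (b n) ++ t n) := by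
  classical
  have hnb : ∀ n, b n < nxt D (b n) := fun n => (nxt_spec hD _).2
  have hna : ∀ n, a n < nxt D (a n) := fun n => (nxt_spec hD _).2
  have hnab : ∀ n, nxt D (a n) ≤ b n := fun n => nxt_le (hYD (hb n)) (hab n)
  have hba : ∀ n, b n < a (n + 1) := fun n => (hnb n).trans_le ((Nat.le_add_right _ _).trans (ht n))
  have hsa : StrictMono a := strictMono_nat_of_lt_succ fun n => (hab n).trans (hba n)
  obtain ⟨halt, hnext⟩ := nextIn_range hab hba
  obtain ⟨g, hg⟩ := exists_glue (p := fun n => if n = 0 then 0 else a (n - 1) + 1)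
    (strictMono_nat_of_lt_succ fun n => by
      rcases n with _ | n
      · simp
      · simpa using hsa (Nat.lt_succ_self n))
    (fun n => if n = 0 then place e (Finset.range (a 0)) s else
      place e (Finset.Ico (nxt D (b (n - 1))) (a n)) (t (n - 1)))
  have hg0 : ∀ k, k ≤ a 0 → g k = place e (Finset.range (a 0)) s k := fun k hk =>
    hg 0 k (by simp) (by simpa [Nat.lt_succ_iff] using hk)
  have hg1 : ∀ n k, a n < k → k ≤ a (n + 1) →
      g k = place e (Finset.Ico (nxt D (b n)) (a (n + 1))) (t n) k := fun n k hk hk' =>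
    hg (n + 1) k (by simpa using hk) (by simpa [Nat.lt_succ_iff] using hk')
  have hge : ∀ n k, a n ≤ k → k < nxt D (b n) → g k = e := by
    intro n k h1 h2
    by_contra h3
    rcases h1.eq_or_lt with rfl | h1
    · rcases n with _ | n
      · rw [hg0 _ le_rfl] at h3
        simpa using place_supp _ _ _ h3
      · rw [hg1 n _ (hsa (Nat.lt_succ_self n)) le_rfl] at h3
        have := place_supp _ _ _ h3
        simp at this
    · have h4 := ht n
      rw [hg1 n k h1 (by omega)] at h3
      have := place_supp _ _ _ h3
      simp only [Finset.coe_Ico, Set.mem_Ico] at this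
      omega
  have hzone : ∀ k, InZone D (Set.range a) (Set.range b) k ↔
      ∃ n, a n ≤ k ∧ k < nxt D (b n) := by
    intro k
    simp only [InZone, before_iff hD]
    constructor
    · rintro ⟨_, ⟨n, rfl⟩, _, ⟨m, rfl⟩, h1, h2, h3⟩
      obtain rfl := hnext n m h1
      exact ⟨_, h2, h3⟩
    · rintro ⟨n, h1, h2⟩
      obtain ⟨_, ⟨m, rfl⟩, hm⟩ := halt.2.1 (a n) ⟨n, rfl⟩
      obtain rfl := hnext n m hm
      exact ⟨_, ⟨m, rfl⟩, _, ⟨m, rfl⟩, hm, h1, h2⟩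
  have hsubA : ∀ k, InBlock D (Set.range a) k → InZone D (Set.range a) (Set.range b) k := by
    intro k hk
    rw [inBlock_iff hD] at hk
    obtain ⟨_, ⟨n, rfl⟩, h1, h2⟩ := hk
    have := hnb n
    have := hnab n
    exact (hzone k).2 ⟨n, by omega, by omega⟩
  have hsubB : ∀ k, InBlock D (Set.range b) k → InZone D (Set.range a) (Set.range b) k := by
    intro k hk
    rw [inBlock_iff hD] at hk
    obtain ⟨_, ⟨n, rfl⟩, h1, h2⟩ := hk
    have := hab n
    exact (hzone k).2 ⟨n, by omega, by omega⟩
  let Y' : Set ℕ → OmegaWord A := fun X k => if InBlock D X k then U k else g k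
  -- Used for both `c = a` and `c = b`: within a zone only the block at `c n` is filled.
  have key : ∀ c : ℕ → ℕ, (∀ n, a n ≤ c n ∧ c n ≤ b n ∧ c n ∈ D) →
      (Y' (Set.range c) ∈ L ↔ AccS L e s (fun n => content e D U (c n) ++ t n)) := by
    intro c hc
    have hcn : ∀ n, c n < nxt D (c n) := fun n => (nxt_spec hD _).2
    have hcb : ∀ n, nxt D (c n) ≤ nxt D (b n) := fun n => by
      rcases (hc n).2.1.eq_or_lt with h1 | h1
      · rw [h1]
      · exact (nxt_le (hYD (hb n)) h1).trans (hnb n).le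
    have hcm : StrictMono c := strictMono_nat_of_lt_succ fun n =>
      (hc n).2.1.trans_lt ((hba n).trans_le (hc (n + 1)).1)
    have hout : ∀ k, (∀ n, c n < k → k < nxt D (c n) → False) → Y' (Set.range c) k = g k :=
      fun k hk => if_neg fun h1 => by
        rw [inBlock_iff hD] at h1
        obtain ⟨_, ⟨n, rfl⟩, h2, h3⟩ := h1
        exact hk n h2 h3
    rw [mem_iff_accS_red hL _ hsa]
    refine accS_congr hL ?_ fun n => ?_
    · rw [filter_red, red_congr (z := place e (Finset.range (a 0)) s), red_place]
      · intro k hk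
        have := Finset.mem_range.1 hk
        omega
      · simpa using hs
      · intro k _ hk
        rw [hout k fun n h1 _ => ?_, hg0 k (by omega)]
        have := (hc n).1
        have := hsa.monotone (Nat.zero_le n)
        omega
    · have h1 := hc n
      have h2 := hcn n
      have h3 := hcb n
      have h4 := ht n
      rw [filter_red, ← red_append _ (show a n + 1 ≤ c n + 1 by omega)
          (show c n + 1 ≤ a (n + 1) + 1 by omega),
        ← red_append _ (show c n + 1 ≤ nxt D (c n) by omega)
          (show nxt D (c n) ≤ a (n + 1) + 1 by omega),
        ← red_append _ (show nxt D (c n) ≤ nxt D (b n) by omega)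
          (show nxt D (b n) ≤ a (n + 1) + 1 by omega),
        red_eq_nil (a := a n + 1), red_eq_nil (a := nxt D (c n)),
        red_congr (y := Y' _) (z := U) (a := c n + 1),
        red_congr (y := Y' _) (a := nxt D (b n))
          (z := place e (Finset.Ico (nxt D (b n)) (a (n + 1))) (t n)), red_place]
      · rw [List.filter_append, content, filter_red]
        rfl
      · intro k hk
        have := Finset.mem_Ico.1 hk
        omega
      · simp
        omega
      · intro k h5 h6
        have := hnb n
        rw [hout k fun m h7 h8 => ?_, hg1 n k (by omega) (by omega)]
        rcases Nat.lt_or_ge n m with h9 | h9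
        · have := hcm.monotone (show n + 1 ≤ m from h9)
          have := (hc (n + 1)).1
          omega
        · rcases h9.eq_or_lt with rfl | h9
          · omega
          · have := nxt_le (hc n).2.2 (hcm h9)
            omega
      · intro k h5 h6
        exact if_pos (show InBlock D (Set.range c) k from
          (inBlock_iff hD).2 ⟨c n, ⟨n, rfl⟩, h5, h6⟩)
      · intro k h5 h6
        rw [hout k fun m h7 h8 => ?_, hge n k (by omega) h6]
        rcases lt_trichotomy n m with h9 | rfl | h9
        · have := hcm.monotone (show n + 1 ≤ m from h9)
          have := (hc (n + 1)).1
          omega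
        · omega
        · have := nxt_le (hc n).2.2 (hcm h9)
          omega
      · intro k h5 h6
        rw [hout k fun m h7 h8 => ?_, hge n k (by omega) (by omega)]
        rcases Nat.lt_or_ge m n with h9 | h9
        · have := nxt_le (hc n).2.2 (hcm h9)
          have h10 := hcb m
          have h11 := ht m
          have := hsa.monotone (show m + 1 ≤ n from h9)
          omega
        · have := hcm.monotone h9
          omega
  rw [← key a fun n => ⟨le_rfl, (hab n).le, hYD (ha n)⟩,
    ← key b fun n => ⟨(hab n).le, le_rfl, hYD (hb n)⟩]
  refine h _ _ (by rintro _ ⟨n, rfl⟩; exact ha n) (by rintro _ ⟨n, rfl⟩; exact hb n) halt _ _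
    (fun k hk => ?_) fun k hk => ?_
  · obtain ⟨n, h1, h2⟩ := (hzone k).1 hk
    have hgk := hge n k h1 h2
    exact ⟨fun h => if_pos h, fun h => (if_neg h).trans hgk, fun h => if_pos h,
      fun h => (if_neg h).trans hgk⟩
  · simp only [Y']
    rw [if_neg fun h => hk (hsubA k h), if_neg fun h => hk (hsubB k h)]

theorem LimEquiv.mono {u v : List A} {c c' : ℕ} (h : LimEquiv L e c u v) (hc : c' ≤ c) :
    LimEquiv L e c' u v := fun s t ht => h s t fun n => (ht n).trans hc

theorem exists_short_prefix (h : Finite (Quotient (prefixSetoid L e))) :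
    ∃ R, ∀ s : List A, ∃ s', s'.length ≤ R ∧ prefixSetoid L e s s' := by
  obtain ⟨R, hR⟩ := (Set.finite_range fun q : Quotient (prefixSetoid L e) =>
    q.out.length).bddAbove
  exact ⟨R, fun s => ⟨(Quotient.mk (prefixSetoid L e) s).out, hR (Set.mem_range_self _),
    Setoid.symm' _ (Quotient.mk_out (s := prefixSetoid L e) s)⟩⟩

/-- Suppose that all words are pairwise inequivalent. By `hlim` each pair is separated with a
bounded context, and the gaps after the blocks are chosen to exceed these bounds. By `hdist` one
context separates infinitely many disjoint pairs taken from `Y`. This context fits into the gaps, so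
moving contents contradicts the separation. -/
theorem exists_factorSetoid_of_moveProp (hL : IsNeutralLetter L e) (hD : D.Infinite)
    (hW : ¬ Bdd D W) (hprop : MoveProp L e D W)
    (hfin : Finite (Quotient (prefixSetoid L e)))
    (hlim : ∀ u v : List A, (∀ c, LimEquiv L e c u v) → factorSetoid L e u v)
    (hdist : ∀ (u v : ℕ → List A) (c : ℕ → ℕ), (∀ n, ¬ LimEquiv L e (c n) (u n) (v n)) →
      ∃ (φ : ℕ → ℕ) (s : List A) (t : ℕ → List A), StrictMono φ ∧
        (∀ n, (t n).length ≤ c (φ n)) ∧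
        ¬ (AccS L e s (fun n => u (φ n) ++ t n) ↔ AccS L e s (fun n => v (φ n) ++ t n)))
    (u : ℕ → List A) : ∃ p q, p < q ∧ factorSetoid L e (u p) (u q) := by
  classical
  by_contra! hcon
  have hex : ∀ p q, ∃ c, p < q → ¬ LimEquiv L e c (u p) (u q) := fun p q => by
    by_cases hpq : p < q
    · obtain ⟨c, hc⟩ := not_forall.1 (mt (hlim _ _) (hcon p q hpq))
      exact ⟨c, fun _ => hc⟩
    · exact ⟨0, fun h => absurd h hpq⟩
  choose c₀ hc₀ using hex
  -- A bound that serves for `q` and all smaller `p`, hence known before the pairs are chosen.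
  let c : ℕ → ℕ := fun q => ∑ p ∈ Finset.range q, c₀ p q
  have hcc : ∀ p q, p < q → ¬ LimEquiv L e (c q) (u p) (u q) := fun p q hpq h =>
    hc₀ p q hpq (h.mono (Finset.single_le_sum (f := fun p => c₀ p q) (fun _ _ => Nat.zero_le _)
      (Finset.mem_range.2 hpq)))
  obtain ⟨R, hR⟩ := exists_short_prefix hfin
  obtain ⟨d, F, hd, hdD, hgap, hF, hc⟩ := exists_large_blocks hD hW (fun i => (u i).length) c
  obtain ⟨U, hU, hU'⟩ := exists_host (e := e) hd hdD (fun n k hk => (hF n k hk).2)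
    (u := u) (fun i => (hc i).ge)
  obtain ⟨Y, hY, hinf, hmov⟩ := hprop U (fun k hk => (hU k hk).elim fun n hn => (hF n k hn).1)
    (Set.range d) (by rintro _ ⟨n, rfl⟩; exact hdD n)
    (Set.infinite_range_of_injective hd.injective)
  have hIinf : {n | d n ∈ Y}.Infinite := by
    intro hfin
    refine hinf ((hfin.image d).subset fun a ha => ?_)
    obtain ⟨n, rfl⟩ := hY ha
    exact ⟨n, ha, rfl⟩
  obtain ⟨a, ha, har⟩ := exists_strictMono_range hIinf
  have haY : ∀ n, d (a n) ∈ Y := fun n => by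
    have : a n ∈ {n | d n ∈ Y} := har ▸ ⟨n, rfl⟩
    exact this
  -- Consecutive disjoint pairs of blocks in `Y`. The offset `R` leaves at least `R` positions
  -- before the first block.
  let p : ℕ → ℕ := fun i => a (R + 2 * i)
  let q : ℕ → ℕ := fun i => a (R + 2 * i + 1)
  have hpq : ∀ i, p i < q i := fun i => ha (by omega)
  have hqp : ∀ i j, i < j → q i < p j := fun i j hij => ha (by omega)
  obtain ⟨φ, s, t, hφ, ht, hne⟩ := hdist (fun i => u (p i)) (fun i => u (q i)) (fun i => c (q i))
    fun i => hcc _ _ (hpq i)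
  -- The prefix `s` is known only after the blocks have been fixed and might not fit; an equivalent
  -- prefix of length at most `R` does.
  obtain ⟨s', hs', hss'⟩ := hR s
  refine hne ((hss' _).trans (Iff.trans ?_ (hss' _).symm))
  have := hmov.accS hL hD (fun x hx => by obtain ⟨n, rfl⟩ := hY hx; exact hdD n)
    (a := fun k => d (p (φ k))) (b := fun k => d (q (φ k))) (fun k => haY _) (fun k => haY _)
    (fun k => hd (hpq _)) (s := s') (t := t)
    (hs'.trans ((Nat.le_add_right _ _).trans ((ha.id_le _).trans (hd.id_le _))))
    (fun k => by
      have h1 := hgap (q (φ k))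
      have h2 := ht k
      have h3 : d (q (φ k) + 1) ≤ d (p (φ (k + 1))) :=
        hd.monotone (hqp _ _ (hφ (Nat.lt_succ_self k)))
      omega)
  simp only [hU'] at this
  rwa [accS_filter hL s' (fun k => u (p (φ k))), accS_filter hL s' (fun k => u (q (φ k)))] at this

theorem finite_quotient_of_exists {r : Setoid (List A)}
    (h : ∀ u : ℕ → List A, ∃ p q, p < q ∧ r (u p) (u q)) : Finite (Quotient r) := by
  by_contra hinf
  rw [not_finite_iff_infinite] at hinf
  let f := Infinite.natEmbedding (Quotient r)
  obtain ⟨p, q, hpq, hr⟩ := h fun n => (f n).out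
  have := Quotient.sound hr
  rw [Quotient.out_eq, Quotient.out_eq] at this
  exact hpq.ne (f.injective this)

/-- One of the three properties, which hold if the blocks are bounded, fails for all unbounded
blocks. -/
theorem exists_unbounded_criterion (hL : IsNeutralLetter L e) (hreg : ¬ IsOmegaRegular L) :
    (∀ D W : Set ℕ, D.Infinite → ¬ Bdd D W → ¬ ReplaceProp L e D W) ∨
    (∀ D W : Set ℕ, D.Infinite → ¬ Bdd D W → ¬ LimReplaceProp L e D W) ∨
    (∀ D W : Set ℕ, D.Infinite → ¬ Bdd D W → ¬ MoveProp L e D W) := by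
  -- The three properties may hold for different unbounded pairs: their consequences concern `L`
  -- alone and can be combined.
  by_contra! h
  obtain ⟨⟨D₁, W₁, hD₁, hW₁, h₁⟩, ⟨D₂, W₂, hD₂, hW₂, h₂⟩, ⟨D₃, W₃, hD₃, hW₃, h₃⟩⟩ := h
  have hfin := finite_quotient_of_exists (exists_prefixSetoid_of_moveProp hL hD₃ hW₃ h₃)
  refine hreg (isOmegaRegular_of_finite hL hfin (finite_quotient_of_exists
    (exists_factorSetoid_of_moveProp hL hD₃ hW₃ h₃ hfin
      (fun u v => factorSetoid_of_limReplaceProp hL hD₂ hW₂ h₂)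
      fun u v c => exists_distinguishing_context hL hD₂ hW₂ h₂)) fun u v h h' s =>
        accS_of_replaceProp hL hD₁ hW₁ h₁ h h' s)

end Dichotomy

/-! ### Definability in MSO+`L` -/

section Definability

variable {A : Type u} {L : OmegaLanguage A} {Γ : Type v} {n m : ℕ} {E : Type w}

/-- A word with a valuation of `n` position variables and of `m` set variables. -/
abbrev Env (Γ : Type v) (n m : ℕ) : Type v := OmegaWord Γ × (Fin n → ℕ) × (Fin m → Set ℕ)

/-- The predicate `P` on `E` is definable by a formula, where `c` assigns to the elements of `E`
the values of the variables. -/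
def Def (L : OmegaLanguage A) (c : E → Env Γ n m) (P : E → Prop) : Prop :=
  ∃ φ : FormulaL A Γ n m, ∀ x, φ.Sat L (c x).1 (c x).2.1 (c x).2.2 ↔ P x

/-- The position `f` is the value of a variable. -/
def PosVar (c : E → Env Γ n m) (f : E → ℕ) : Prop := ∃ i, ∀ x, (c x).2.1 i = f x

/-- The set `F` is the value of a variable. -/
def SetVar (c : E → Env Γ n m) (F : E → Set ℕ) : Prop := ∃ i, ∀ x, (c x).2.2 i = F x

/-- The positions of the letters in the word `y` are the values of variables. -/
def WordVar (c : E → Env Γ n m) (y : E → OmegaWord A) : Prop :=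
  ∀ a, SetVar c (fun x => {k | y x k = a})

/-- The assignment `c` with an additional position variable. -/
def consPos (c : E → Env Γ n m) : E × ℕ → Env Γ (n + 1) m :=
  fun x => ((c x.1).1, Fin.cons x.2 (c x.1).2.1, (c x.1).2.2)

/-- The assignment `c` with an additional set variable. -/
def consSet (c : E → Env Γ n m) : E × Set ℕ → Env Γ n (m + 1) :=
  fun x => ((c x.1).1, (c x.1).2.1, Fin.cons x.2 (c x.1).2.2)

/-- A valuation of set variables extended to `k` further variables. -/
def consSets (S : Fin m → Set ℕ) : (k : ℕ) → (Fin k → Set ℕ) → Fin (m + k) → Set ℕ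
  | 0, _ => S
  | k + 1, T => Fin.cons (T (Fin.last k)) (consSets S k fun i => T i.castSucc)

/-- The assignment `c` with additional variables for the letters of a word. -/
noncomputable def consWord [Finite A] (c : E → Env Γ n m) :
    E × OmegaWord A → Env Γ n (m + Nat.card A) :=
  fun x => ((c x.1).1, (c x.1).2.1,
    consSets (c x.1).2.2 _ fun i => {k | x.2 k = (Finite.equivFin A).symm i})

variable {c : E → Env Γ n m}

theorem PosVar.new : PosVar (consPos c) (fun x => x.2) := ⟨0, fun _ => rfl⟩

theorem SetVar.new : SetVar (consSet c) (fun x => x.2) := ⟨0, fun _ => rfl⟩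

theorem PosVar.pos {f : E → ℕ} : PosVar c f → PosVar (consPos c) (fun x => f x.1) :=
  fun ⟨i, h⟩ => ⟨i.succ, fun x => h x.1⟩

theorem PosVar.set {f : E → ℕ} : PosVar c f → PosVar (consSet c) (fun x => f x.1) :=
  fun ⟨i, h⟩ => ⟨i, fun x => h x.1⟩

theorem SetVar.pos {F : E → Set ℕ} : SetVar c F → SetVar (consPos c) (fun x => F x.1) :=
  fun ⟨i, h⟩ => ⟨i, fun x => h x.1⟩

theorem SetVar.set {F : E → Set ℕ} : SetVar c F → SetVar (consSet c) (fun x => F x.1) :=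
  fun ⟨i, h⟩ => ⟨i.succ, fun x => h x.1⟩

theorem consSets_old (k : ℕ) (i : Fin m) : ∃ j, ∀ (S : Fin m → Set ℕ) (T : Fin k → Set ℕ),
    consSets S k T j = S i := by
  induction k with
  | zero => exact ⟨i, fun _ _ => rfl⟩
  | succ k ih =>
    obtain ⟨j, hj⟩ := ih
    exact ⟨j.succ, fun S T => hj S _⟩

theorem consSets_new (k : ℕ) (i : Fin k) : ∃ j, ∀ (S : Fin m → Set ℕ) (T : Fin k → Set ℕ),
    consSets S k T j = T i := by
  induction k with
  | zero => exact i.elim0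
  | succ k ih =>
    induction i using Fin.lastCases with
    | last => exact ⟨0, fun _ _ => rfl⟩
    | cast i =>
      obtain ⟨j, hj⟩ := ih i
      exact ⟨j.succ, fun S T => hj S _⟩

theorem SetVar.word [Finite A] {F : E → Set ℕ} :
    SetVar c F → SetVar (consWord (A := A) c) (fun x => F x.1) := fun ⟨i, h⟩ => by
  obtain ⟨j, hj⟩ := consSets_old (Nat.card A) i
  exact ⟨j, fun x => (hj _ _).trans (h x.1)⟩

theorem WordVar.pos {y : E → OmegaWord A} (h : WordVar c y) :
    WordVar (consPos c) (fun x => y x.1) := fun a => (h a).pos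

theorem WordVar.set {y : E → OmegaWord A} (h : WordVar c y) :
    WordVar (consSet c) (fun x => y x.1) := fun a => (h a).set

theorem WordVar.word [Finite A] {y : E → OmegaWord A} (h : WordVar c y) :
    WordVar (consWord (A := A) c) (fun x => y x.1) := fun a => (h a).word

theorem WordVar.new [Finite A] : WordVar (consWord (A := A) c) (fun x => x.2) := fun a => by
  obtain ⟨j, hj⟩ := consSets_new (m := m) (Nat.card A) (Finite.equivFin A a)
  exact ⟨j, fun x => (hj _ _).trans (by simp)⟩

namespace Def

theorem congr {P Q : E → Prop} : Def L c P → (∀ x, P x ↔ Q x) → Def L c Q :=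
  fun ⟨φ, h⟩ hPQ => ⟨φ, fun x => (h x).trans (hPQ x)⟩

theorem lt {f g : E → ℕ} : PosVar c f → PosVar c g → Def L c (fun x => f x < g x) :=
  fun ⟨i, hi⟩ ⟨j, hj⟩ => ⟨.lt i j, fun x => by rw [FormulaL.Sat, hi, hj]⟩

theorem mem {f : E → ℕ} {F : E → Set ℕ} : PosVar c f → SetVar c F →
    Def L c (fun x => f x ∈ F x) :=
  fun ⟨i, hi⟩ ⟨j, hj⟩ => ⟨.mem i j, fun x => by rw [FormulaL.Sat, hi, hj]⟩

theorem not {P : E → Prop} : Def L c P → Def L c (fun x => ¬ P x) :=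
  fun ⟨φ, h⟩ => ⟨.neg φ, fun x => not_congr (h x)⟩

theorem and {P Q : E → Prop} : Def L c P → Def L c Q → Def L c (fun x => P x ∧ Q x) :=
  fun ⟨φ, h⟩ ⟨ψ, h'⟩ => ⟨.conj φ ψ, fun x => and_congr (h x) (h' x)⟩

theorem imp {P Q : E → Prop} (h : Def L c P) (h' : Def L c Q) : Def L c (fun x => P x → Q x) :=
  (h.and h'.not).not.congr fun x => by tauto

theorem or {P Q : E → Prop} (h : Def L c P) (h' : Def L c Q) : Def L c (fun x => P x ∨ Q x) :=
  (h.not.and h'.not).not.congr fun x => by tauto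

theorem iff {P Q : E → Prop} (h : Def L c P) (h' : Def L c Q) : Def L c (fun x => P x ↔ Q x) :=
  ((h.imp h').and (h'.imp h)).congr fun x => by tauto

theorem exPos {P : E → ℕ → Prop} : Def L (consPos c) (fun x => P x.1 x.2) →
    Def L c (fun x => ∃ k, P x k) :=
  fun ⟨φ, h⟩ => ⟨.exPos φ, fun x => exists_congr fun k => h (x, k)⟩

theorem allPos {P : E → ℕ → Prop} (h : Def L (consPos c) (fun x => P x.1 x.2)) :
    Def L c (fun x => ∀ k, P x k) :=
  (exPos (P := fun x k => ¬ P x k) h.not).not.congr fun _ => not_exists_not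

theorem exSet {P : E → Set ℕ → Prop} : Def L (consSet c) (fun x => P x.1 x.2) →
    Def L c (fun x => ∃ X, P x X) :=
  fun ⟨φ, h⟩ => ⟨.exSet φ, fun x => exists_congr fun k => h (x, k)⟩

theorem allSet {P : E → Set ℕ → Prop} (h : Def L (consSet c) (fun x => P x.1 x.2)) :
    Def L c (fun x => ∀ X, P x X) :=
  (exSet (P := fun x k => ¬ P x k) h.not).not.congr fun _ => not_exists_not

theorem const_true : Def L c (fun _ => True) :=
  (exPos (P := fun _ k => k < k) (lt PosVar.new PosVar.new)).not.congr fun x => by simp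

theorem allFinset {ι : Type*} {P : ι → E → Prop} (h : ∀ a, Def L c (P a)) (s : Finset ι) :
    Def L c (fun x => ∀ a ∈ s, P a x) := by
  classical
  induction s using Finset.induction with
  | empty => exact const_true.congr fun x => by simp
  | insert a s _ ih => exact ((h a).and ih).congr fun x => by simp

theorem all {ι : Type*} [Finite ι] {P : ι → E → Prop} (h : ∀ a, Def L c (P a)) :
    Def L c (fun x => ∀ a, P a x) := by
  have := Fintype.ofFinite ι
  exact (allFinset h Finset.univ).congr fun x => by simp

theorem ex {ι : Type*} [Finite ι] {P : ι → E → Prop} (h : ∀ a, Def L c (P a)) :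
    Def L c (fun x => ∃ a, P a x) :=
  (all fun a => (h a).not).not.congr fun _ => not_forall_not

theorem exists_exSets (k : ℕ) (φ : FormulaL A Γ n (m + k)) : ∃ ψ : FormulaL A Γ n m,
    ∀ x p S, ψ.Sat L x p S ↔ ∃ T : Fin k → Set ℕ, φ.Sat L x p (consSets S k T) := by
  induction k with
  | zero => exact ⟨φ, fun x p S => ⟨fun h => ⟨Fin.elim0, h⟩, fun ⟨T, h⟩ => h⟩⟩
  | succ k ih =>
    obtain ⟨ψ, hψ⟩ := ih (.exSet φ)
    refine ⟨ψ, fun x p S => (hψ x p S).trans ⟨?_, ?_⟩⟩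
    · rintro ⟨T, X, h⟩
      refine ⟨Fin.snoc (α := fun _ => Set ℕ) T X, ?_⟩
      simpa [consSets] using h
    · rintro ⟨T, h⟩
      exact ⟨fun i => T i.castSucc, T (Fin.last k), h⟩

/-- For a finite alphabet, a quantifier over words is a block of set quantifiers, one for each
letter, restricted to partitions. -/
theorem exWord [Finite A] {P : E → OmegaWord A → Prop}
    (h : Def L (consWord (A := A) c) (fun x => P x.1 x.2)) :
    Def L c (fun x => ∃ y, P x y) := by
  obtain ⟨φ, hφ⟩ := h
  let ε := Finite.equivFin A
  let c' : E × (Fin (Nat.card A) → Set ℕ) → Env Γ n (m + Nat.card A) :=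
    fun x => ((c x.1).1, (c x.1).2.1, consSets (c x.1).2.2 _ x.2)
  have hvar : ∀ i, SetVar c' (fun x => x.2 i) := fun i => by
    obtain ⟨j, hj⟩ := consSets_new (m := m) (Nat.card A) i
    exact ⟨j, fun x => hj _ _⟩
  have hpart : Def L c' (fun x => ∀ k, (∃ i, k ∈ x.2 i) ∧
      ∀ i j, i ≠ j → k ∈ x.2 i → ¬ k ∈ x.2 j) :=
    allPos ((ex fun i => mem PosVar.new (hvar i).pos).and (all fun i => all fun j => by
      by_cases hij : i = j
      · exact const_true.congr fun x => by simp [hij]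
      · exact ((mem PosVar.new (hvar i).pos).imp (mem PosVar.new (hvar j).pos).not).congr
          fun x => by simp [hij]))
  obtain ⟨χ, hχ⟩ := hpart
  obtain ⟨ψ, hψ⟩ := exists_exSets (L := L) _ (.conj χ φ)
  refine ⟨ψ, fun x => (hψ _ _ _).trans ⟨?_, ?_⟩⟩
  · rintro ⟨T, h1, h2⟩
    have h3 := (hχ (x, T)).1 h1
    choose i hi using fun k => (h3 k).1
    have hT : T = fun j => {k | ε.symm (i k) = ε.symm j} := by
      funext j
      refine Set.ext fun k => ⟨fun h => ?_, fun h => ε.symm.injective h ▸ hi k⟩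
      by_contra hne
      exact (h3 k).2 _ _ (fun hij => hne (congrArg ε.symm hij)) (hi k) h
    rw [hT] at h2
    exact ⟨fun k => ε.symm (i k), (hφ (x, _)).1 h2⟩
  · rintro ⟨y, hy⟩
    refine ⟨fun i => {k | y k = ε.symm i}, (hχ (x, _)).2 ?_, (hφ (x, y)).2 hy⟩
    refine fun k => ⟨⟨ε (y k), (ε.symm_apply_apply (y k)).symm⟩, fun i j hij h1 h2 => hij ?_⟩
    exact ε.symm.injective (Eq.trans (Eq.symm h1) h2)

theorem allWord [Finite A] {P : E → OmegaWord A → Prop}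
    (h : Def L (consWord (A := A) c) (fun x => P x.1 x.2)) : Def L c (fun x => ∀ y, P x y) :=
  (exWord (P := fun x k => ¬ P x k) h.not).not.congr fun _ => not_exists_not

theorem wordMem {y : E → OmegaWord A} (hy : WordVar c y) : Def L c (fun x => y x ∈ L) := by
  choose i hi using hy
  refine ⟨.lang i, fun x => ⟨?_, fun h => ⟨y x, h, fun a => hi a x⟩⟩⟩
  rintro ⟨z, hz, hS⟩
  have : z = y x := funext fun k => by
    have h1 : k ∈ (c x).2.2 (i (z k)) := by rw [hS]; rfl
    rw [hi] at h1
    exact (show y x k = z k from h1).symm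
  exact this ▸ hz

theorem eqLetter {y : E → OmegaWord A} {k : E → ℕ} (hy : WordVar c y) (hk : PosVar c k) (a : A) :
    Def L c (fun x => y x (k x) = a) := mem hk (hy a)

theorem eqLetters [Finite A] {y z : E → OmegaWord A} {k : E → ℕ} (hy : WordVar c y)
    (hz : WordVar c z) (hk : PosVar c k) : Def L c (fun x => y x (k x) = z x (k x)) :=
  (all fun a => (eqLetter hy hk a).imp (eqLetter hz hk a)).congr fun _ =>
    ⟨fun h => (h _ rfl).symm, fun h _ ha => h ▸ ha⟩

theorem subset {F G : E → Set ℕ} (hF : SetVar c F) (hG : SetVar c G) :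
    Def L c (fun x => F x ⊆ G x) :=
  allPos ((mem PosVar.new hF.pos).imp (mem PosVar.new hG.pos))

theorem infinite {F : E → Set ℕ} (hF : SetVar c F) : Def L c (fun x => (F x).Infinite) :=
  Def.congr (P := fun x => ∀ a, ∃ k, k ∈ F x ∧ a < k)
    (allPos (exPos ((mem PosVar.new hF.pos.pos).and (lt PosVar.new.pos PosVar.new))))
    fun _ => ⟨fun h => Set.infinite_of_forall_exists_gt h, fun h a => h.exists_gt a⟩

theorem before {D : E → Set ℕ} {d k : E → ℕ} (hD : SetVar c D) (hd : PosVar c d)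
    (hk : PosVar c k) : Def L c (fun x => ∀ j ∈ D x, d x < j → k x < j) :=
  allPos ((mem PosVar.new hD.pos).imp ((lt hd.pos PosVar.new).imp (lt hk.pos PosVar.new)))

theorem inBlock {D X : E → Set ℕ} {k : E → ℕ} (hD : SetVar c D) (hX : SetVar c X)
    (hk : PosVar c k) : Def L c (fun x => InBlock (D x) (X x) (k x)) :=
  exPos ((mem PosVar.new hX.pos).and ((lt PosVar.new hk.pos).and
    (before hD.pos PosVar.new hk.pos)))

variable {e : A}

theorem supp {y : E → OmegaWord A} {W : E → Set ℕ} (hy : WordVar c y) (hW : SetVar c W) :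
    Def L c (fun x => Supp e (y x) (W x)) :=
  allPos ((eqLetter hy.pos PosVar.new e).not.imp (mem PosVar.new hW.pos))

theorem comesAfter {D C : E → Set ℕ} {u v : E → OmegaWord A} (hD : SetVar c D)
    (hC : SetVar c C) (hu : WordVar c u) (hv : WordVar c v) :
    Def L c (fun x => ComesAfter e (D x) (C x) (u x) (v x)) :=
  allPos ((mem PosVar.new hD.pos).imp (allPos (allPos ((lt PosVar.new.pos.pos PosVar.new.pos).imp
    ((lt PosVar.new.pos.pos PosVar.new).imp
    ((before hD.pos.pos.pos PosVar.new.pos.pos PosVar.new.pos).imp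
    ((before hD.pos.pos.pos PosVar.new.pos.pos PosVar.new).imp
    ((mem PosVar.new hC.pos.pos.pos).imp
    (((eqLetter hu.pos.pos.pos PosVar.new.pos e).not.or
      (eqLetter hv.pos.pos.pos PosVar.new.pos e).not).imp
    (lt PosVar.new.pos PosVar.new))))))))))

theorem nextIn {X Y : E → Set ℕ} {k l : E → ℕ} (hX : SetVar c X) (hY : SetVar c Y)
    (hk : PosVar c k) (hl : PosVar c l) : Def L c (fun x => NextIn (X x) (Y x) (k x) (l x)) :=
  (lt hk hl).and (allPos (((mem PosVar.new hX.pos).or (mem PosVar.new hY.pos)).imp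
    ((lt hk.pos PosVar.new).and (lt PosVar.new hl.pos)).not))

theorem alternate {X Y : E → Set ℕ} (hX : SetVar c X) (hY : SetVar c Y) :
    Def L c (fun x => Alternate (X x) (Y x)) :=
  (allPos ((mem PosVar.new hX.pos).imp (mem PosVar.new hY.pos).not)).and
    ((allPos ((mem PosVar.new hX.pos).imp (exPos ((mem PosVar.new hY.pos.pos).and
      (nextIn hX.pos.pos hY.pos.pos PosVar.new.pos PosVar.new))))).and
    (allPos ((mem PosVar.new hY.pos).imp (exPos ((mem PosVar.new hX.pos.pos).and
      (nextIn hX.pos.pos hY.pos.pos PosVar.new PosVar.new.pos))))))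

theorem inZone {D X Y : E → Set ℕ} {k : E → ℕ} (hD : SetVar c D) (hX : SetVar c X)
    (hY : SetVar c Y) (hk : PosVar c k) : Def L c (fun x => InZone (D x) (X x) (Y x) (k x)) :=
  exPos ((mem PosVar.new hX.pos).and (exPos ((mem PosVar.new hY.pos.pos).and
    ((nextIn hX.pos.pos hY.pos.pos PosVar.new.pos PosVar.new).and
    (((lt hk.pos.pos PosVar.new.pos).not.congr fun _ => not_lt).and
    (before hD.pos.pos PosVar.new hk.pos.pos))))))

variable [Finite A]

theorem replaceable {D Z : E → Set ℕ} {u v : E → OmegaWord A} (hD : SetVar c D) (hZ : SetVar c Z)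
    (hu : WordVar c u) (hv : WordVar c v) :
    Def L c (fun x => Replaceable L (D x) (u x) (v x) (Z x)) :=
  allSet ((subset SetVar.new hZ.set).imp (allWord (allWord
    ((allPos ((inBlock hD.set.word.word.pos SetVar.new.word.word.pos PosVar.new).imp
      ((eqLetters WordVar.new.word.pos hu.set.word.word.pos PosVar.new).and
        (eqLetters WordVar.new.pos hv.set.word.word.pos PosVar.new)))).imp
    ((allPos ((inBlock hD.set.word.word.pos SetVar.new.word.word.pos PosVar.new).not.imp
      (eqLetters WordVar.new.word.pos WordVar.new.pos PosVar.new))).imp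
    ((wordMem WordVar.new.word).iff (wordMem WordVar.new)))))))

theorem limReplaceable {D C Z : E → Set ℕ} {u v : E → OmegaWord A} (hD : SetVar c D)
    (hC : SetVar c C) (hZ : SetVar c Z) (hu : WordVar c u) (hv : WordVar c v) :
    Def L c (fun x => LimReplaceable L e (D x) (C x) (u x) (v x) (Z x)) :=
  allSet ((infinite SetVar.new).imp ((subset SetVar.new hZ.set).imp (allWord (allWord
    ((allPos ((inBlock hD.set.word.word.pos SetVar.new.word.word.pos PosVar.new).imp
      ((mem PosVar.new hC.set.word.word.pos).not.imp
      ((eqLetters WordVar.new.word.pos hu.set.word.word.pos PosVar.new).and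
        (eqLetters WordVar.new.pos hv.set.word.word.pos PosVar.new))))).imp
    ((allPos ((inBlock hD.set.word.word.pos SetVar.new.word.word.pos PosVar.new).imp
      ((mem PosVar.new hC.set.word.word.pos).imp
      (eqLetters WordVar.new.word.pos WordVar.new.pos PosVar.new)))).imp
    ((allPos ((inBlock hD.set.word.word.pos SetVar.new.word.word.pos PosVar.new).not.imp
      ((eqLetters WordVar.new.word.pos WordVar.new.pos PosVar.new).and
        ((eqLetter WordVar.new.word.pos PosVar.new e).or
          (allPos ((mem PosVar.new SetVar.new.word.word.pos.pos).imp
            (lt PosVar.new.pos PosVar.new))))))).imp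
    ((wordMem WordVar.new.word).iff (wordMem WordVar.new)))))))))

theorem movable {D Y : E → Set ℕ} {u : E → OmegaWord A} (hD : SetVar c D)
    (hY : SetVar c Y) (hu : WordVar c u) :
    Def L c (fun x => Movable L e (D x) (u x) (Y x)) :=
  allSet (allSet ((subset SetVar.new.set hY.set.set).imp ((subset SetVar.new hY.set.set).imp
    ((alternate SetVar.new.set SetVar.new).imp (allWord (allWord
    ((allPos ((inZone hD.set.set.word.word.pos SetVar.new.set.word.word.pos
        SetVar.new.word.word.pos PosVar.new).imp
      (((inBlock hD.set.set.word.word.pos SetVar.new.set.word.word.pos PosVar.new).imp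
        (eqLetters WordVar.new.word.pos hu.set.set.word.word.pos PosVar.new)).and
      (((inBlock hD.set.set.word.word.pos SetVar.new.set.word.word.pos PosVar.new).not.imp
        (eqLetter WordVar.new.word.pos PosVar.new e)).and
      (((inBlock hD.set.set.word.word.pos SetVar.new.word.word.pos PosVar.new).imp
        (eqLetters WordVar.new.pos hu.set.set.word.word.pos PosVar.new)).and
      ((inBlock hD.set.set.word.word.pos SetVar.new.word.word.pos PosVar.new).not.imp
        (eqLetter WordVar.new.pos PosVar.new e))))))).imp
    ((allPos ((inZone hD.set.set.word.word.pos SetVar.new.set.word.word.pos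
        SetVar.new.word.word.pos PosVar.new).not.imp
      (eqLetters WordVar.new.word.pos WordVar.new.pos PosVar.new))).imp
    ((wordMem WordVar.new.word).iff (wordMem WordVar.new))))))))))

theorem replaceProp {D W : E → Set ℕ} (hD : SetVar c D) (hW : SetVar c W) :
    Def L c (fun x => ReplaceProp L e (D x) (W x)) :=
  allWord (allWord ((supp WordVar.new.word hW.word.word).imp ((supp WordVar.new hW.word.word).imp
    (exSet ((subset SetVar.new hD.word.word.set).and
    ((replaceable hD.word.word.set SetVar.new WordVar.new.word.set WordVar.new.set).and
    (allSet ((subset SetVar.new hD.word.word.set.set).imp ((infinite SetVar.new).imp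
    ((allPos ((mem PosVar.new SetVar.new.pos).imp (mem PosVar.new SetVar.new.set.pos).not)).imp
    (replaceable hD.word.word.set.set SetVar.new WordVar.new.word.set.set
      WordVar.new.set.set).not))))))))))

theorem limReplaceProp {D W : E → Set ℕ} (hD : SetVar c D) (hW : SetVar c W) :
    Def L c (fun x => LimReplaceProp L e (D x) (W x)) :=
  allWord (allWord (allSet ((supp WordVar.new.word.set hW.word.word.set).imp
    ((supp WordVar.new.set hW.word.word.set).imp
    ((subset SetVar.new hW.word.word.set).imp
    ((comesAfter hD.word.word.set SetVar.new WordVar.new.word.set WordVar.new.set).imp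
    (exSet ((subset SetVar.new hD.word.word.set.set).and
    ((allSet ((subset SetVar.new SetVar.new.set).imp ((infinite SetVar.new).imp
      (exSet ((subset SetVar.new SetVar.new.set).and ((infinite SetVar.new).and
        (limReplaceable hD.word.word.set.set.set.set SetVar.new.set.set.set SetVar.new
          WordVar.new.word.set.set.set.set WordVar.new.set.set.set.set))))))).and
    (allSet ((subset SetVar.new hD.word.word.set.set.set).imp ((infinite SetVar.new).imp
    ((allPos ((mem PosVar.new SetVar.new.pos).imp (mem PosVar.new SetVar.new.set.pos).not)).imp
    (limReplaceable hD.word.word.set.set.set SetVar.new.set.set SetVar.new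
      WordVar.new.word.set.set.set WordVar.new.set.set.set).not)))))))))))))

theorem moveProp {D W : E → Set ℕ} (hD : SetVar c D) (hW : SetVar c W) :
    Def L c (fun x => MoveProp L e (D x) (W x)) :=
  allWord ((supp WordVar.new hW.word).imp (allSet ((subset SetVar.new hD.word.set).imp
    ((infinite SetVar.new).imp (exSet ((subset SetVar.new SetVar.new.set).and
    ((infinite SetVar.new).and (movable hD.word.set.set SetVar.new WordVar.new.set.set))))))))

/-- It is definable that there are infinitely many blocks and that these are unbounded. -/
theorem unbounded (hL : IsNeutralLetter L e) (hreg : ¬ IsOmegaRegular L) {D W : E → Set ℕ}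
    (hD : SetVar c D) (hW : SetVar c W) :
    Def L c (fun x => (D x).Infinite ∧ ¬ Bdd (D x) (W x)) := by
  -- The negation of the property that fails on unbounded pairs is the definition: on bounded pairs
  -- the property holds.
  rcases exists_unbounded_criterion hL hreg with h | h | h
  · exact ((infinite hD).and (replaceProp (e := e) hD hW).not).congr fun x =>
      and_congr_right fun hx => ⟨fun h' hb => h' (hb.replaceProp hL hx), h _ _ hx⟩
  · exact ((infinite hD).and (limReplaceProp (e := e) hD hW).not).congr fun x =>
      and_congr_right fun hx => ⟨fun h' hb => h' (hb.limReplaceProp hL hx), h _ _ hx⟩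
  · exact ((infinite hD).and (moveProp (e := e) hD hW).not).congr fun x =>
      and_congr_right fun hx => ⟨fun h' hb => h' (hb.moveProp hL hx), h _ _ hx⟩

end Def

end Definability

/-! ### The language `U` and the bounding quantifier in terms of blocks -/

theorem exists_sum_add_eq_false {x : OmegaWord Bool} (h : {j | x j = false}.Infinite) :
    ∃ k : ℕ → ℕ, ∀ n,
      (∀ i < k n, x ((∑ j ∈ Finset.range n, (k j + 1)) + i) = true) ∧
        x ((∑ j ∈ Finset.range n, (k j + 1)) + k n) = false := by
  have hex : ∀ a, ∃ i, x (a + i) = false := fun a => by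
    obtain ⟨j, hj, hlt⟩ := h.exists_gt a
    exact ⟨j - a, by rw [Nat.add_sub_cancel' hlt.le]; exact hj⟩
  let g : ℕ → ℕ := fun a => Nat.find (hex a)
  -- `s n` is the start of the `n`-th piece, and `g (s n)` the number of letters `true` before its
  -- `false`.
  let s : ℕ → ℕ := fun n => Nat.rec 0 (fun _ a => a + (g a + 1)) n
  have hs : ∀ n, ∑ j ∈ Finset.range n, (g (s j) + 1) = s n := fun n => by
    induction n with
    | zero => rfl
    | succ n ih => rw [Finset.sum_range_succ, ih]
  refine ⟨fun n => g (s n), fun n => ?_⟩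
  rw [hs]
  exact ⟨fun i hi => by simpa using Nat.find_min (hex (s n)) hi, Nat.find_spec (hex (s n))⟩

theorem isConcat_replicate_iff {k : ℕ → ℕ} {x : OmegaWord Bool} :
    IsConcat (fun n => List.replicate (k n) true ++ [false]) x ↔ ∀ n,
      (∀ i < k n, x ((∑ j ∈ Finset.range n, (k j + 1)) + i) = true) ∧
        x ((∑ j ∈ Finset.range n, (k j + 1)) + k n) = false := by
  simp only [IsConcat, List.length_append, List.length_replicate, List.length_singleton]
  constructor
  · refine fun h n => ⟨fun i hi => ?_, ?_⟩
    · rw [h.2 n i (by omega), List.getElem_append_left (by simpa using hi)]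
      simp
    · rw [h.2 n (k n) (by omega), List.getElem_append_right (by simp)]
      simp
  · refine fun h => ⟨Frequently.of_forall fun n => by simp, fun n i hi => ?_⟩
    rcases Nat.lt_succ_iff_lt_or_eq.1 hi with hi' | rfl
    · rw [(h n).1 i hi', List.getElem_append_left (by simpa using hi')]
      simp
    · rw [(h n).2, List.getElem_append_right (by simp)]
      simp

theorem limsup_eq_top_iff {k : ℕ → ℕ} :
    limsup (fun n => (k n : ℕ∞)) atTop = ⊤ ↔ ∀ K, ∃ n, K < k n := by
  constructor
  · intro h K
    obtain ⟨n, hn⟩ := (frequently_lt_of_lt_limsup (f := atTop) (u := fun n => (k n : ℕ∞))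
      (b := (K : ℕ∞)) (by isBoundedDefault) (h ▸ ENat.natCast_lt_top K)).exists
    exact ⟨n, by exact_mod_cast hn⟩
  · refine fun h => ENat.eq_top_iff_forall_ge.2 fun K => le_limsup_of_frequently_le ?_
    rw [frequently_atTop]
    intro N
    -- Exceeding the sum of the first `N` values forces `N ≤ n`.
    obtain ⟨n, hn⟩ := h (K + ∑ i ∈ Finset.range N, k i)
    refine ⟨n, ?_, by exact_mod_cast (show K ≤ k n by omega)⟩
    by_contra! hlt
    have := Finset.single_le_sum (f := k) (fun _ _ => Nat.zero_le _) (Finset.mem_range.2 hlt)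
    omega

/-- An interval without the letter `false` lies inside one run of `true`, so boundedness on such
intervals is boundedness of the exponents. -/
theorem mem_languageU_iff {x : OmegaWord Bool} : x ∈ languageU ↔
    {j | x j = false}.Infinite ∧ ¬ Bdd {j | x j = false} {j | x j = true} := by
  have key : ∀ k : ℕ → ℕ, (∀ n,
      (∀ i < k n, x ((∑ j ∈ Finset.range n, (k j + 1)) + i) = true) ∧
        x ((∑ j ∈ Finset.range n, (k j + 1)) + k n) = false) →
      ((∀ K, ∃ n, K < k n) ↔ ¬ Bdd {j | x j = false} {j | x j = true}) := by
    intro k hk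
    constructor
    · rintro h ⟨K, hK⟩
      obtain ⟨n, hn⟩ := h K
      set s := ∑ j ∈ Finset.range n, (k j + 1) with hs
      have htrue : ∀ j, s ≤ j → j < s + k n → x j = true := fun j h1 h2 => by
        have := (hk n).1 (j - s) (by omega)
        rwa [← hs, Nat.add_sub_cancel' h1] at this
      have h1 := hK s (s + k n) fun j hj h2 => by
        have := htrue j h2.1 h2.2
        simp_all
      have h2 : {j | x j = true} ∩ Set.Ico s (s + k n) = Set.Ico s (s + k n) :=
        Set.inter_eq_right.2 fun j hj => htrue j hj.1 hj.2
      rw [h2, ← Finset.coe_Ico, Set.ncard_coe_finset, Nat.card_Ico] at h1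
      omega
    · intro h
      by_contra! hK
      obtain ⟨K, hK⟩ := hK
      refine h ⟨K, fun a b hab => ?_⟩
      have hle : ({j | x j = true} ∩ Set.Ico a b).ncard ≤ b - a := by
        refine (Set.ncard_le_ncard Set.inter_subset_right (Set.finite_Ico a b)).trans ?_
        rw [← Finset.coe_Ico, Set.ncard_coe_finset, Nat.card_Ico]
      -- The piece containing `a`. The interval must stop before the `false` that ends it, so its
      -- length is at most the exponent.
      have hex : ∃ n, a < ∑ j ∈ Finset.range (n + 1), (k j + 1) :=
        ⟨a, by simp [Finset.sum_add_distrib]; omega⟩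
      have h1 := Nat.find_spec hex
      have h2 : ∑ j ∈ Finset.range (Nat.find hex), (k j + 1) ≤ a := by
        rcases hn : Nat.find hex with _ | n
        · simp
        · exact not_lt.1 (Nat.find_min hex (m := n) (by omega))
      rw [Finset.sum_range_succ] at h1
      have h3 := hab _ (hk (Nat.find hex)).2
      have h4 := hK (Nat.find hex)
      omega
  constructor
  · rintro ⟨k, hk, hlim⟩
    rw [isConcat_replicate_iff] at hk
    refine ⟨Set.infinite_of_forall_exists_gt fun a => ⟨_, (hk (a + 1)).2, ?_⟩,
      (key k hk).1 (limsup_eq_top_iff.1 hlim)⟩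
    simp only [Finset.sum_add_distrib, Finset.sum_const, Finset.card_range, smul_eq_mul]
    omega
  · rintro ⟨h, hb⟩
    obtain ⟨k, hk⟩ := exists_sum_add_eq_false h
    exact ⟨k, isConcat_replicate_iff.2 hk, limsup_eq_top_iff.2 ((key k hk).2 hb)⟩

/-- The bounding quantifier expressed by unboundedness of blocks. -/
theorem forall_exists_le_ncard_iff (P : Set ℕ → Prop) :
    (∀ k : ℕ, ∃ X : Set ℕ, X.Finite ∧ k ≤ X.ncard ∧ P X) ↔
      ∃ D W : Set ℕ, (D.Infinite ∧ ¬ Bdd D W) ∧ ∀ a b, (∀ j ∈ D, ¬ (a ≤ j ∧ j < b)) →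
        ∃ X : Set ℕ, X.Finite ∧ P X ∧ ∀ k, a ≤ k → k < b → k ∈ W → k ∈ X := by
  constructor
  · intro h
    choose F hfin hcard hP using h
    choose M hM using fun k => (hfin k).bddAbove
    -- All of `F (n + d n + 2)` lies below `d (n + 1)`, and at most `d n + 1` of its elements are `≤
    -- d n`. So at least `n + 1` elements fall strictly between `d n` and `d (n + 1)`, and these
    -- form `W` there.
    obtain ⟨d, hd, -, -, hG⟩ := exists_strictMono_seq (p := fun _ _ => True)
      (fun _ N => ⟨N, le_rfl, trivial⟩) 0 fun n a => M (n + a + 2) + 1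
    refine ⟨Set.range d, {k | ∃ n, d n < k ∧ k < d (n + 1) ∧ k ∈ F (n + d n + 2)},
      ⟨Set.infinite_range_of_injective hd.injective, ?_⟩, fun a b hab => ?_⟩
    · rintro ⟨K, hK⟩
      have h1 := hK (d K + 1) (d (K + 1)) (by
        rintro _ ⟨i, rfl⟩ ⟨h1, h2⟩
        have := hd.lt_iff_lt.1 h1
        have := hd.lt_iff_lt.1 h2
        omega)
      set Y := {k | ∃ n, d n < k ∧ k < d (n + 1) ∧ k ∈ F (n + d n + 2)} ∩
        Set.Ico (d K + 1) (d (K + 1)) with hY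
      have hsub : F (K + d K + 2) ⊆ Set.Ico 0 (d K + 1) ∪ Y := fun k hk => by
        have h2 : k ≤ M (K + d K + 2) := hM _ hk
        have h3 := hG K
        rcases lt_or_ge k (d K + 1) with h4 | h4
        · exact Or.inl ⟨Nat.zero_le _, h4⟩
        · exact Or.inr ⟨⟨K, h4, by omega, hk⟩, h4, by omega⟩
      have hYfin : Y.Finite := (Set.finite_Ico _ _).subset Set.inter_subset_right
      have h2 := (hcard (K + d K + 2)).trans ((Set.ncard_le_ncard hsub
        ((Set.finite_Ico _ _).union hYfin)).trans (Set.ncard_union_le _ _))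
      rw [← Finset.coe_Ico, Set.ncard_coe_finset, Nat.card_Ico] at h2
      omega
    · by_cases hne : ∃ k n, (a ≤ k ∧ k < b) ∧ d n < k ∧ k < d (n + 1)
      · obtain ⟨k, n, hk, h1, h2⟩ := hne
        refine ⟨_, hfin (n + d n + 2), hP _, ?_⟩
        rintro k' hak hkb ⟨n', h1', h2', hmem⟩
        rcases lt_trichotomy n n' with hlt | rfl | hlt
        · have := hd.monotone (Nat.succ_le_of_lt hlt)
          exact absurd ⟨by grind, by grind⟩ (hab (d n') ⟨n', rfl⟩)
        · exact hmem
        · have := hd.monotone (Nat.succ_le_of_lt hlt)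
          exact absurd ⟨by grind, by grind⟩ (hab (d n) ⟨n, rfl⟩)
      -- No position of the interval is strictly between two successive `d n`, so it misses `W` and
      -- any of the finite sets will do.
      · exact ⟨_, hfin 0, hP 0, fun k hak hkb ⟨n, h1, h2, _⟩ =>
          (hne ⟨k, n, ⟨hak, hkb⟩, h1, h2⟩).elim⟩
  · rintro ⟨D, W, ⟨-, hb⟩, h⟩ k
    simp only [Bdd, not_exists, not_forall, not_le] at hb
    obtain ⟨a, b, hab, hk⟩ := hb k
    obtain ⟨X, hX, hPX, hsub⟩ := h a b hab
    exact ⟨X, hX, hk.le.trans (Set.ncard_le_ncard (fun j hj => hsub j hj.2.1 hj.2.2 hj.1) hX), hPX⟩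

/-- A partition into two sets encodes exactly one word. The condition can thus be stated about the
sets themselves, without quantifying over words on `Bool`. -/
theorem forall_exists_eq_iff {S : Bool → Set ℕ} {R : OmegaLanguage Bool} :
    (∃ y ∈ R, ∀ a, S a = {k | y k = a}) ↔
      (∀ k, k ∈ S true ↔ k ∉ S false) ∧
        ∀ y : OmegaWord Bool, (∀ a, S a = {k | y k = a}) → y ∈ R := by
  classical
  constructor
  · rintro ⟨y, hy, hS⟩
    refine ⟨fun k => ?_, fun z hz => ?_⟩
    · rw [hS, hS]
      change y k = true ↔ ¬ y k = false
      simp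
    · have : z = y := funext fun k => by
        have h : k ∈ S (z k) := by rw [hz]; rfl
        rw [hS] at h
        exact (show y k = z k from h).symm
      exact this ▸ hy
  · rintro ⟨h, hR⟩
    have hS : ∀ a, S a = {k | decide (k ∈ S true) = a} := by
      rintro (_ | _) <;> refine Set.ext fun k => ?_
      · change k ∈ S false ↔ decide (k ∈ S true) = false
        simp [h]
      · change k ∈ S true ↔ decide (k ∈ S true) = true
        simp
    exact ⟨_, hR _ hS, hS⟩

/-! ### Translation of formulas -/

section Translation

variable {A : Type u} {L : OmegaLanguage A} {e : A} {Γ : Type v}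

theorem definableMSOPlus_of_def {K : OmegaLanguage Γ}
    (h : Def L (fun x : OmegaWord Γ => (x, Fin.elim0, Fin.elim0)) (fun x => x ∈ K)) :
    DefinableMSOPlus L K := by
  obtain ⟨φ, hφ⟩ := h
  exact ⟨φ, Set.ext fun x => (hφ x).symm⟩

namespace Def

theorem label {E : Type w} {n m : ℕ} {c : E → Env Γ n m} {f : E → ℕ} (a : Γ) :
    PosVar c f → Def L c (fun x => (c x).1 (f x) = a) :=
  fun ⟨i, hi⟩ => ⟨.label a i, fun x => by rw [FormulaL.Sat, hi]⟩

variable [Finite A]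

theorem langU (hL : IsNeutralLetter L e) (hreg : ¬ IsOmegaRegular L) {E : Type w} {n m : ℕ}
    {c : E → Env Γ n m} {S : Bool → E → Set ℕ} (hS : ∀ a, SetVar c (S a)) :
    Def L c (fun x => ∃ y ∈ languageU, ∀ a, S a x = {k | y k = a}) := by
  refine ((allPos (P := fun x k => k ∈ S true x ↔ k ∉ S false x) ((mem PosVar.new (hS true).pos).iff
    (mem PosVar.new (hS false).pos).not)).and (unbounded hL hreg (hS false) (hS true))).congr
    fun x => Iff.trans ?_ (forall_exists_eq_iff (S := fun a => S a x)).symm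
  refine and_congr_right fun h => ⟨fun hu y hy => mem_languageU_iff.2 ?_, fun hu => ?_⟩
  · rwa [← hy, ← hy]
  · obtain ⟨y, hy, hSy⟩ := forall_exists_eq_iff.2 ⟨h, hu⟩
    simpa only [← hSy] using mem_languageU_iff.1 hy

theorem satL (hL : IsNeutralLetter L e) (hreg : ¬ IsOmegaRegular L) {n₀ m₀ : ℕ}
    (φ : FormulaL Bool Γ n₀ m₀) {n m : ℕ} {E : Type w} (c : E → Env Γ n m)
    {p : E → Fin n₀ → ℕ} {S : E → Fin m₀ → Set ℕ} (hp : ∀ i, PosVar c (fun x => p x i))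
    (hS : ∀ j, SetVar c (fun x => S x j)) :
    Def L c (fun x => φ.Sat languageU (c x).1 (p x) (S x)) := by
  induction φ generalizing n m E with
  | label a i => exact label a (hp i)
  | lt i j => exact lt (hp i) (hp j)
  | mem i j => exact mem (hp i) (hS j)
  | neg φ ih => exact (ih c hp hS).not
  | conj φ ψ ih ih' => exact (ih c hp hS).and (ih' c hp hS)
  | exPos φ ih =>
    exact exPos (ih (consPos c) (p := fun x => Fin.cons x.2 (p x.1)) (S := fun x => S x.1)
      (Fin.cases PosVar.new fun i => (hp i).pos) fun j => (hS j).pos)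
  | exSet φ ih =>
    exact exSet (ih (consSet c) (p := fun x => p x.1) (S := fun x => Fin.cons x.2 (S x.1))
      (fun i => (hp i).set) (Fin.cases SetVar.new fun j => (hS j).set))
  | lang X => exact langU hL hreg (S := fun a x => S x (X a)) fun a => hS (X a)

/-- The induction leaves the ambient environment `c` arbitrary, as long as the variables of `φ` are
among its variables: translating the bounding quantifier introduces auxiliary variables in front of
the subformula. -/
theorem satU (hL : IsNeutralLetter L e) (hreg : ¬ IsOmegaRegular L) {n₀ m₀ : ℕ}
    (φ : FormulaU Γ n₀ m₀) {n m : ℕ} {E : Type w} (c : E → Env Γ n m)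
    {p : E → Fin n₀ → ℕ} {S : E → Fin m₀ → Set ℕ} (hp : ∀ i, PosVar c (fun x => p x i))
    (hS : ∀ j, SetVar c (fun x => S x j)) :
    Def L c (fun x => φ.Sat (c x).1 (p x) (S x)) := by
  induction φ generalizing n m E with
  | label a i => exact label a (hp i)
  | lt i j => exact lt (hp i) (hp j)
  | mem i j => exact mem (hp i) (hS j)
  | neg φ ih => exact (ih c hp hS).not
  | conj φ ψ ih ih' => exact (ih c hp hS).and (ih' c hp hS)
  | exPos φ ih =>
    exact exPos (ih (consPos c) (p := fun x => Fin.cons x.2 (p x.1)) (S := fun x => S x.1)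
      (Fin.cases PosVar.new fun i => (hp i).pos) fun j => (hS j).pos)
  | exSet φ ih =>
    exact exSet (ih (consSet c) (p := fun x => p x.1) (S := fun x => Fin.cons x.2 (S x.1))
      (fun i => (hp i).set) (Fin.cases SetVar.new fun j => (hS j).set))
  | unbounded φ ih =>
    -- The bounding quantifier is replaced by its block form; the goal left open is the subformula
    -- under the auxiliary `D`, `W`, `a`, `b` and the covering set `X`.
    refine Def.congr ?_ fun x => (forall_exists_le_ncard_iff fun X =>
      φ.Sat (c x).1 (p x) (Fin.cons X (S x) : Fin _ → Set ℕ)).symm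
    refine exSet (exSet ((unbounded hL hreg SetVar.new.set SetVar.new).and
      (allPos (allPos (imp (allPos ((mem PosVar.new SetVar.new.set.pos.pos.pos).imp
        (((lt PosVar.new PosVar.new.pos.pos).not.congr fun _ => not_lt).and
          (lt PosVar.new PosVar.new.pos)).not))
      (exSet (((infinite SetVar.new).not.congr fun _ => Set.not_infinite).and (and ?_
        (allPos (((lt PosVar.new PosVar.new.pos.set.pos).not.congr fun _ => not_lt).imp
          ((lt PosVar.new PosVar.new.set.pos).imp
          ((mem PosVar.new SetVar.new.pos.pos.set.pos).imp
            (mem PosVar.new SetVar.new.pos)))))))))))))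
    exact ih (E := ((((E × Set ℕ) × Set ℕ) × ℕ) × ℕ) × Set ℕ) _ (p := fun x => p x.1.1.1.1.1) (S := fun x => Fin.cons x.2 (S x.1.1.1.1.1))
      (fun i => (hp i).set.set.pos.pos.set)
      (Fin.cases SetVar.new fun j => (hS j).set.set.pos.pos.set)

end Def

end Translation

end OmegaMSO


theorem mainTheorem2 {A : Type*} [Finite A] (L : OmegaMSO.OmegaLanguage A)
    (hreg : ¬ OmegaMSO.IsOmegaRegular L) (hneutral : OmegaMSO.HasNeutralLetter L)
    {Γ : Type*} [Finite Γ] (K : OmegaMSO.OmegaLanguage Γ) :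
    (OmegaMSO.DefinableMSOU K → OmegaMSO.DefinableMSOPlus L K) ∧
      (OmegaMSO.DefinableMSOPlus OmegaMSO.languageU K → OmegaMSO.DefinableMSOPlus L K) := by
  obtain ⟨e, hL⟩ := hneutral
  constructor
  · rintro ⟨φ, rfl⟩
    exact OmegaMSO.definableMSOPlus_of_def (OmegaMSO.Def.satU hL hreg φ _
      (p := fun _ => Fin.elim0) (S := fun _ => Fin.elim0) (fun i => i.elim0) fun j => j.elim0)
  · rintro ⟨φ, rfl⟩
    exact OmegaMSO.definableMSOPlus_of_def (OmegaMSO.Def.satL hL hreg φ _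
      (p := fun _ => Fin.elim0) (S := fun _ => Fin.elim0) (fun i => i.elim0) fun j => j.elim0)
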